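/- Notation. For a graph $G=(V,E)$, the localization game with $k$ sensors is played as follows. In each round $t=1,2,\dots$ the cops, knowing $G$ and all earlier answers, choose a set $S_t\subseteq V$ with $|S_t|=k$; the invisible robber chooses a vertex $v_t$ (any vertex if $t=1$; otherwise $v_t=v_{t-1}$ or $v_t$ adjacent to $v_{t-1}$); then the cops learn the graph distances from $v_t$ to all vertices of $S_t$. The cops win in round $t$ if $v_t$ is determined by the answers received so far, i.e. if all possible robber walks $(w_1,\dots,w_t)$ consistent with these answers have $w_t=v_t$. The localization number $\zeta(G)$ is the least $k$ for which the cops have a strategy with $k$ sensors that wins in finitely many rounds, whatever the robber does. $\mathcal G(n,p)$ is the binomial random graph on $n$ labelled vertices, "a.a.s." means with probability tending to $1$ as $n\to\infty$, $f\ll g$ means $f/g\to0$ as $n\to\infty$, $\log$ is the natural logarithm, and all $o(1)$ terms are deterministic sequences tending to $0$. Theorem 2.1. Let $p=p(n)\in[0,1]$ and $d=d(n):=pn$. (a) Suppose that $\log n\ll d\ll n$ and that $i=i(n)$ is a sequence of natural numbers, which may depend on $n$, such that $d^i\ll n$ and $d^{i+1}/n-2\log n\to\infty$. Then, a.a.s.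 for $G\in\mathcal G(n,p)$, $$(\log d-3\log\log n)\,\frac{n}{d^i}\;\le\;\zeta(G)\;\le\;(1+o(1))\,(\log d+2\log\log n)\,\frac{n}{d^i}.$$ (b) If, in addition to the hypotheses of (a), $d\ge(\log n)^{\omega}$ for some $\omega=\omega(n)\to\infty$ and all large $n$, then a.a.s. $\zeta(G)=(1+o(1))\,\dfrac{n\log d}{d^i}$. (c) If $d=n^{x+o(1)}$ for a constant $x\in\left(\frac1{i+1},\frac1i\right)$, where $i\ge1$ is a constant integer, then a.a.s. $\zeta(G)=(1+o(1))\,\dfrac{x\,n\log n}{d^i}$. -/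

import Mathlib

open Filter Topology Asymptotics

namespace LocalizationGame

noncomputable section

open Classical in
/-- The `S`-signature of the vertex `v`: the vector of the graph distances `d(s, v)`, `s ∈ S`.
It is stored as a function on all vertices, padded by `0` outside the sensor set `S` (which is
known to the cops). The distance is the extended one, so it is `⊤` between vertices in different
components and the usual distance in a connected graph. -/
def signature {V : Type*} (G : SimpleGraph V) (S : Finset V) (v : V) : V → ℕ∞ :=
  fun s => if s ∈ S then G.edist s v else 0

/-- The robber's possible trajectories: at each round she stays or moves to a neighbour. -/
def IsRobberWalk {V : Type*} (G : SimpleGraph V) (w : ℕ → V) : Prop :=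
  ∀ t, w (t + 1) = w t ∨ G.Adj (w t) (w (t + 1))

/-- A (deterministic) strategy of the cops: the next sensor set as a function of the list of all
signatures received so far. -/
abbrev CopStrategy (V : Type*) : Type _ := List (V → ℕ∞) → Finset V

/-- The signatures received by the cops in the first `t` rounds, when they play `σ` and the robber
moves along `w`. Rounds are numbered `0, 1, 2, …`: in round `t` the sensors are placed
at `σ (infoTrail G σ w t)` and the robber is at `w t`. -/
def infoTrail {V : Type*} (G : SimpleGraph V) (σ : CopStrategy V) (w : ℕ → V) :
    ℕ → List (V → ℕ∞)
  | 0 => []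
  | t + 1 => infoTrail G σ w t ++ [signature G (σ (infoTrail G σ w t)) (w t)]

/-- The cops locate the robber in round `t`: every walk with the same info trail up to and
including that round ends in the same vertex. -/
def LocatedAt {V : Type*} (G : SimpleGraph V) (σ : CopStrategy V) (w : ℕ → V) (t : ℕ) : Prop :=
  ∀ x : ℕ → V, IsRobberWalk G x → infoTrail G σ x (t + 1) = infoTrail G σ w (t + 1) → x t = w t

/-- The cops can win the localization game with `k` sensors: some strategy that always uses
exactly `k` sensors locates the robber after finitely many rounds, however she moves. -/
def CopsWin {V : Type*} (G : SimpleGraph V) (k : ℕ) : Prop :=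
  ∃ σ : CopStrategy V, (∀ h, (σ h).card = k) ∧
    ∀ w : ℕ → V, IsRobberWalk G w → ∃ t, LocatedAt G σ w t

/-- The localization number `ζ(G)`. -/
def localizationNumber {V : Type*} (G : SimpleGraph V) : ℕ :=
  sInf {k | CopsWin G k}

/-- On a finite vertex set the infimum is over a nonempty set: a sensor on every vertex wins. -/
theorem copsWin_card {V : Type*} [Fintype V] (G : SimpleGraph V) :
    CopsWin G (Fintype.card V) := by
  refine ⟨fun _ => Finset.univ, fun _ => Finset.card_univ, fun w _ => ⟨0, fun x _ h => ?_⟩⟩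
  have h1 : signature G Finset.univ (x 0) = signature G Finset.univ (w 0) := by
    simpa [infoTrail] using h
  have h2 := congrFun h1 (x 0)
  simp only [signature, Finset.mem_univ, if_true, SimpleGraph.edist_self] at h2
  exact SimpleGraph.edist_eq_zero_iff.mp h2.symm

/-- The random graph `𝒢(n, p n)` on `n` labelled vertices has the property `P n` asymptotically
almost surely: with probability tending to `1` as `n → ∞`. -/
def AAS (p : ℕ → unitInterval) (P : (n : ℕ) → SimpleGraph (Fin n) → Prop) : Prop :=
  Tendsto (fun n => SimpleGraph.binomialRandom (Fin n) (p n) {G | P n G}) atTop (𝓝 1)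

/-- `ζ(𝒢(n, p)) ∼ g(n)` asymptotically almost surely. -/
def ZetaAsymp (p : ℕ → unitInterval) (g : ℕ → ℝ) : Prop :=
  ∃ ε : ℕ → ℝ, Tendsto ε atTop (𝓝 0) ∧
    AAS p (fun n G => (1 - ε n) * g n ≤ (localizationNumber G : ℝ) ∧
      (localizationNumber G : ℝ) ≤ (1 + ε n) * g n)

/-- The average-degree parameter `d = p n`. -/
def deg (p : ℕ → unitInterval) (n : ℕ) : ℝ := (p n : ℝ) * n

end

end LocalizationGame

/-!
For a set `T` of one or two vertices, the sphere of radius `j ≤ i` around `T` in `𝒢(n, p)` has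
about `|T| d ^ j` vertices: the levels of a breadth-first exploration are conditionally binomial, so
their exponential moments can be propagated through the levels (`expect_exp_front_le`,
`expect_thin_exp_neg_front_le`), with corrections `1 / d + 1 / d ^ 2 + ⋯` that are negligible since
`d ≫ log n`. The same computation shows that the diameter is at most `i + 1` if
`d ^ (i + 1) / n - 2 log n → ∞` and `d ≥ (log n) ^ 3` (`prob_diam_gt_le`, `diam_error_le`).

*Upper bound.* Since the spheres of radius `i` around two vertices `u ≠ v` are almost disjoint, about
`2 d ^ i` vertices have different distances to `u` and `v`. So `k` random sensors fail to separate
`u` and `v` with probability at most `exp (-2 k d ^ i / n)`, which is about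
`1 / (d ^ 2 (log n) ^ 4)` for the `k` of the theorem. For a set `A` of possible positions, some
choice of the sensors therefore leaves so few unresolved pairs that every class of indistinguishable
positions has fewer than `|A| / (2 d)` elements or is a singleton. As closed neighbourhoods have at
most `2 d` elements, the set of possible positions gets smaller in each round until the robber is
located (`copsWin_of_shrink`, `localizationNumber_le_of_separated`).

*Lower bound.* The robber wins if there is a family of sets of positions, with at least two elements
each, such that whatever the sensors are, some indistinguishable member of the family is reachable
from the current one (`not_copsWin_of_evasive`). For `d ≤ (log n) ^ 3` the claimed lower bound is not
positive. Otherwise let `S` be a set of about `(log d - 3 log log n) n / d ^ i` sensors. There are two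
cases.

* If `p` is at most of order `log log n / log n`, use the sets `A` of about `4 n log n / d`
  vertices. The ball of radius `i - 1` around `S` has about `(log d - 3 log log n) n / d` vertices, so
  a vertex has no neighbour there with probability about `(log n) ^ 3 / d`. Hence many vertices
  reachable from `A` have the maximal distance `i + 1` from all of `S`
  (`prob_farReach_small_le`, `lt_localizationNumber_of_farReach`). The failure probability is small
  enough for a union bound over all `S` and `A`.
* If `p` is larger, then `i = 1` and the diameter is at most two, so the sensors outside the current
  position only reveal which of them are neighbours. Use the pairs of vertices. The `d`
  neighbours of a vertex `x` are joined to `S` by independent random sets, two of which coincide by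
  a birthday argument (`expect_no_collision_le`, `lt_localizationNumber_of_collides`).

Both bounds hold with failure probability tending to zero for each fixed relative error; a diagonal
argument provides the error terms `o(1)` (`exists_error_tendsto_zero`). If `log log n` is negligible
compared to `log d`, the two bounds agree (`eventually_prob_not_near`).
-/

namespace LocalizationGame

open scoped Classical

set_option linter.unusedSectionVars false

/-! ### Deterministic strategies for the cops and for the robber -/

section Game

variable {V : Type*} [Fintype V]

/-- The vertices that the robber can reach in one move from some vertex of `A`. -/
noncomputable def reach (G : SimpleGraph V) (A : Finset V) : Finset V :=
  Finset.univ.filter fun w => ∃ v ∈ A, w = v ∨ G.Adj v w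

lemma mem_reach {G : SimpleGraph V} {A : Finset V} {w : V} :
    w ∈ reach G A ↔ ∃ v ∈ A, w = v ∨ G.Adj v w := by simp [reach]

/-- The positions in `A` that have the signature `c` with respect to `S`. -/
noncomputable def sigClass (G : SimpleGraph V) (S A : Finset V) (c : V → ℕ∞) : Finset V :=
  A.filter fun u => signature G S u = c

/-- The possible positions of the robber in the next round, when the cops use the sensors `Sel A`
whenever the possible positions are `A`, and the answers so far were `h`. -/
noncomputable def possible (G : SimpleGraph V) (Sel : Finset V → Finset V)
    (h : List (V → ℕ∞)) : Finset V :=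
  h.foldl (fun A c => reach G (sigClass G (Sel A) A c)) Finset.univ

lemma possible_append (G : SimpleGraph V) (Sel : Finset V → Finset V)
    (h : List (V → ℕ∞)) (c : V → ℕ∞) :
    possible G Sel (h ++ [c]) =
      reach G (sigClass G (Sel (possible G Sel h)) (possible G Sel h) c) := by
  simp [possible, List.foldl_append]

/-- The cops win if, for every set `A` of possible positions, some sensor set either pins the robber
down or leaves fewer than `A.card` possible positions after her next move. -/
theorem copsWin_of_shrink (G : SimpleGraph V) (k : ℕ)
    (H : ∀ A : Finset V, ∃ S : Finset V, S.card = k ∧ ∀ v ∈ A,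
      (∀ u ∈ A, signature G S u = signature G S v → u = v) ∨
        (reach G (sigClass G S A (signature G S v))).card < A.card) :
    CopsWin G k := by
  choose Sel hk hS using H
  set σ : CopStrategy V := fun h => Sel (possible G Sel h) with hσ
  have hmem : ∀ w : ℕ → V, IsRobberWalk G w → ∀ t, w t ∈ possible G Sel (infoTrail G σ w t) := by
    intro w hw t
    induction t with
    | zero => simp [infoTrail, possible]
    | succ t ih =>
      rw [infoTrail, possible_append, mem_reach]
      exact ⟨w t, by simp only [sigClass, Finset.mem_filter]; exact ⟨ih, rfl⟩, hw t⟩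
  refine ⟨σ, fun h => hk _, fun w hw => ?_⟩
  by_contra hcon
  push Not at hcon
  have hdec : ∀ t, (possible G Sel (infoTrail G σ w t)).card + t ≤
      (Finset.univ : Finset V).card := by
    intro t
    induction t with
    | zero => simp [infoTrail, possible]
    | succ t ih =>
      rcases hS _ (w t) (hmem w hw t) with h | h
      · exfalso
        apply hcon t
        intro x hx hxt
        rw [infoTrail, infoTrail] at hxt
        obtain ⟨h1, h2⟩ := List.append_inj' hxt rfl
        refine h (x t) (h1 ▸ hmem x hx t) ?_
        rw [h1] at h2
        simpa [hσ] using h2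
      · rw [infoTrail, possible_append]
        have : (reach G (sigClass G (Sel (possible G Sel (infoTrail G σ w t)))
          (possible G Sel (infoTrail G σ w t)) (signature G (σ (infoTrail G σ w t)) (w t)))).card
            < (possible G Sel (infoTrail G σ w t)).card := h
        omega
  have h1 := hdec ((Finset.univ : Finset V).card + 1)
  omega

/-- Along a sequence of nonempty sets, each contained in what can be reached from the previous one,
the robber can walk forever: a compactness argument. -/
lemma exists_walk_of_reach (G : SimpleGraph V) (A : ℕ → Finset V) (hne : ∀ t, (A t).Nonempty)
    (hA : ∀ t, A (t + 1) ⊆ reach G (A t)) :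
    ∃ w : ℕ → V, IsRobberWalk G w ∧ ∀ t, w t ∈ A t := by
  let _ : TopologicalSpace V := ⊥
  have _ : DiscreteTopology V := ⟨rfl⟩
  let Kt : ℕ → Set (ℕ → V) := fun T => ⋂ t ∈ Finset.range T,
    {w : ℕ → V | w t ∈ A t ∧ (w (t + 1) = w t ∨ G.Adj (w t) (w (t + 1)))}
  have hcl : ∀ T, IsClosed (Kt T) := by
    intro T
    refine isClosed_biInter fun t _ => ?_
    have : {w : ℕ → V | w t ∈ A t ∧ (w (t + 1) = w t ∨ G.Adj (w t) (w (t + 1)))} =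
        (fun w : ℕ → V => (w t, w (t + 1))) ⁻¹'
          {x : V × V | x.1 ∈ A t ∧ (x.2 = x.1 ∨ G.Adj x.1 x.2)} := rfl
    rw [this]
    exact (isClosed_discrete _).preimage (by fun_prop)
  have hanti : ∀ T, Kt (T + 1) ⊆ Kt T := by
    intro T w hw
    simp only [Kt, Set.mem_iInter, Finset.mem_range] at hw ⊢
    exact fun t ht => hw t (by omega)
  have hfin : ∀ T, ∀ v ∈ A T, ∃ w : ℕ → V, w ∈ Kt T ∧ ∀ t, T ≤ t → w t = v := by
    intro T
    induction T with
    | zero => exact fun v _ => ⟨fun _ => v, by simp [Kt], fun _ _ => rfl⟩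
    | succ T ih =>
      intro v hv
      obtain ⟨u, hu, huv⟩ := mem_reach.1 (hA T hv)
      obtain ⟨w, hw, hwT⟩ := ih u hu
      refine ⟨fun t => if t ≤ T then w t else v, ?_, fun t ht => by
        simp [show ¬ t ≤ T by omega]⟩
      simp only [Kt, Set.mem_iInter, Finset.mem_range, Set.mem_ofPred_eq] at hw ⊢
      intro t ht
      rcases Nat.lt_succ_iff_lt_or_eq.1 ht with h | h
      · simpa [show t ≤ T by omega, show t + 1 ≤ T by omega] using hw t h
      · subst h
        simpa [hwT t le_rfl] using ⟨hu, huv⟩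
  have hne' : ∀ T, (Kt T).Nonempty := fun T => by
    obtain ⟨v, hv⟩ := hne T
    obtain ⟨w, hw, -⟩ := hfin T v hv
    exact ⟨w, hw⟩
  obtain ⟨w, hw⟩ := IsCompact.nonempty_iInter_of_sequence_nonempty_isCompact_isClosed Kt hanti hne'
    ((hcl 0).isCompact) hcl
  simp only [Kt, Set.mem_iInter, Finset.mem_range, Set.mem_ofPred_eq] at hw
  exact ⟨w, fun t => (hw (t + 1) t (by omega)).2, fun t => (hw (t + 1) t (by omega)).1⟩

/-- The robber escapes forever if she can keep her set of possible positions inside a family of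
sets with at least two elements: whatever the sensors, some member of the family that is reachable
from the current one has constant signature. -/
theorem not_copsWin_of_evasive (G : SimpleGraph V) (k : ℕ) (𝒜 : Set (Finset V))
    (hne : 𝒜.Nonempty) (h2 : ∀ A ∈ 𝒜, 2 ≤ A.card)
    (H : ∀ A ∈ 𝒜, ∀ S : Finset V, S.card = k → ∃ A' ∈ 𝒜, A' ⊆ reach G A ∧
      ∀ u ∈ A', ∀ v ∈ A', signature G S u = signature G S v) :
    ¬ CopsWin G k := by
  rintro ⟨σ, hσ, hwin⟩
  choose! N hN1 hN2 hN3 using H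
  obtain ⟨A₀, hA₀⟩ := hne
  have hpos : ∀ A ∈ 𝒜, A.Nonempty := fun A hA => Finset.card_pos.1 (by have := h2 A hA; omega)
  -- `step` carries the current set together with the answers that led to it
  let step : Finset V × List (V → ℕ∞) → Finset V × List (V → ℕ∞) := fun x =>
    (N x.1 (σ x.2), x.2 ++ [if h : (N x.1 (σ x.2)).Nonempty then signature G (σ x.2) h.choose
      else fun _ => 0])
  let st : ℕ → Finset V × List (V → ℕ∞) := fun t => step^[t] (A₀, [])
  have hst : ∀ t, st (t + 1) = step (st t) := fun t => Function.iterate_succ_apply' step t _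
  have hmem : ∀ t, (st t).1 ∈ 𝒜 := by
    intro t
    induction t with
    | zero => exact hA₀
    | succ t ih => rw [hst]; exact hN1 _ ih _ (hσ _)
  let B : ℕ → Finset V := fun t => (st (t + 1)).1
  have htrail : ∀ w : ℕ → V, ∀ t, (∀ s < t, w s ∈ B s) → infoTrail G σ w t = (st t).2 := by
    intro w t
    induction t with
    | zero => intro _; rfl
    | succ t ih =>
      intro h
      have ih' := ih fun s hs => h s (by omega)
      have hN : (N (st t).1 (σ (st t).2)).Nonempty := hpos _ (hN1 _ (hmem t) _ (hσ _))
      rw [infoTrail, ih', hst]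
      simp only [step, hN, dif_pos]
      congr 2
      refine hN3 _ (hmem t) _ (hσ _) _ ?_ _ hN.choose_spec
      have := h t (by omega)
      simpa only [B, hst, step] using this
  have hreach : ∀ t, B (t + 1) ⊆ reach G (B t) := by
    intro t
    have : B (t + 1) = N (B t) (σ (st (t + 1)).2) := by simp only [B]; rw [hst]
    rw [this]
    exact hN2 _ (hmem _) _ (hσ _)
  obtain ⟨w, hw, hwB⟩ := exists_walk_of_reach G B (fun t => hpos _ (hmem _)) hreach
  obtain ⟨t, ht⟩ := hwin w hw
  obtain ⟨x, hxB, hxw⟩ := Finset.exists_mem_ne (h2 _ (hmem (t + 1))) (w t)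
  -- a second walk with the same answers that ends in `x`
  have key : ∀ T, ∀ v ∈ B T, ∃ y : ℕ → V, IsRobberWalk G y ∧ (∀ s ≤ T, y s ∈ B s) ∧
      ∀ s, T ≤ s → y s = v := by
    intro T
    induction T with
    | zero =>
      intro v hv
      exact ⟨fun _ => v, fun _ => Or.inl rfl, fun s hs => by
        obtain rfl : s = 0 := by omega
        exact hv, fun _ _ => rfl⟩
    | succ T ih =>
      intro v hv
      obtain ⟨u, hu, huv⟩ := mem_reach.1 (hreach T hv)
      obtain ⟨y, hy, hyB, hyT⟩ := ih u hu
      refine ⟨fun s => if s ≤ T then y s else v, ?_, ?_, fun s hs => by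
        simp [show ¬ s ≤ T by omega]⟩
      · intro s
        rcases lt_trichotomy s T with h | h | h
        · simpa [show s ≤ T by omega, show s + 1 ≤ T by omega] using hy s
        · subst h
          simpa [hyT s le_rfl] using huv
        · simp [show ¬ s ≤ T by omega, show ¬ s + 1 ≤ T by omega]
      · intro s hs
        by_cases h : s ≤ T
        · simpa [h] using hyB s h
        · obtain rfl : s = T + 1 := by omega
          simpa using hv
  obtain ⟨y, hy, hyB, hyT⟩ := key t x hxB
  refine hxw ?_
  rw [← hyT t le_rfl]
  refine ht y hy ?_
  rw [htrail y (t + 1) fun s hs => hyB s (by omega), htrail w (t + 1) fun s _ => hwB s]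

end Game

/-! ### Expectations over the binomial random graph -/

section Expectation

open MeasureTheory

variable {V : Type*} [Fintype V]

lemma measurableSingletonClass_simpleGraph : MeasurableSingletonClass (SimpleGraph V) where
  measurableSet_singleton G := by
    have h : ({G} : Set (SimpleGraph V)) = SimpleGraph.edgeSet ⁻¹' {G.edgeSet} := by
      ext H
      simp
    rw [h]
    exact SimpleGraph.measurable_edgeSet (measurableSet_singleton _)

/-- The expectation of `F` over the binomial random graph on `V`, as a finite sum. -/
noncomputable def expect (p : unitInterval) (F : SimpleGraph V → ℝ) : ℝ :=
  ∑ G : SimpleGraph V, (SimpleGraph.binomialRandom V p).real {G} * F G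

lemma expect_mono (p : unitInterval) {F F' : SimpleGraph V → ℝ} (h : ∀ G, F G ≤ F' G) :
    expect p F ≤ expect p F' :=
  Finset.sum_le_sum fun G _ => mul_le_mul_of_nonneg_left (h G) measureReal_nonneg

lemma expect_nonneg (p : unitInterval) {F : SimpleGraph V → ℝ} (h : ∀ G, 0 ≤ F G) :
    0 ≤ expect p F :=
  Finset.sum_nonneg fun G _ => mul_nonneg measureReal_nonneg (h G)

lemma expect_sum (p : unitInterval) {ι : Type*} (s : Finset ι) (F : ι → SimpleGraph V → ℝ) :
    expect p (fun G => ∑ i ∈ s, F i G) = ∑ i ∈ s, expect p (F i) := by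
  simp only [expect, Finset.mul_sum]
  exact Finset.sum_comm

lemma expect_mul_const (p : unitInterval) (F : SimpleGraph V → ℝ) (c : ℝ) :
    expect p (fun G => F G * c) = expect p F * c := by
  simp only [expect, Finset.sum_mul, mul_assoc]

lemma expect_const (p : unitInterval) (c : ℝ) :
    expect p (fun _ : SimpleGraph V => c) = c := by
  have := measurableSingletonClass_simpleGraph (V := V)
  have h := sum_measureReal_singleton (μ := SimpleGraph.binomialRandom V p)
    (Finset.univ : Finset (SimpleGraph V))
  rw [expect, ← Finset.sum_mul, h]
  simp

/-- The probability of `P` in the binomial random graph on `V`. -/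
noncomputable def prob (p : unitInterval) (P : SimpleGraph V → Prop) : ℝ :=
  expect p fun G => if P G then 1 else 0

lemma prob_eq_real (p : unitInterval) (P : SimpleGraph V → Prop) :
    prob p P = (SimpleGraph.binomialRandom V p).real {G | P G} := by
  have := measurableSingletonClass_simpleGraph (V := V)
  have h := sum_measureReal_singleton (μ := SimpleGraph.binomialRandom V p)
    (Finset.univ.filter P)
  rw [prob, expect]
  simp only [mul_ite, mul_one, mul_zero]
  rw [← Finset.sum_filter, h]
  simp

lemma prob_mono (p : unitInterval) {P Q : SimpleGraph V → Prop} (h : ∀ G, P G → Q G) :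
    prob p P ≤ prob p Q :=
  expect_mono p fun G => by
    by_cases hP : P G
    · simp [hP, h G hP]
    · simp only [hP, if_false]; split_ifs <;> norm_num

/-- The union bound. -/
lemma prob_exists_le (p : unitInterval) {ι : Type*} (s : Finset ι) (P : ι → SimpleGraph V → Prop) :
    prob p (fun G => ∃ i ∈ s, P i G) ≤ ∑ i ∈ s, prob p (P i) := by
  simp only [prob]
  rw [← expect_sum]
  refine expect_mono p fun G => ?_
  by_cases h : ∃ i ∈ s, P i G
  · obtain ⟨i, hi, hP⟩ := h
    have h1 : (1 : ℝ) ≤ ∑ i ∈ s, if P i G then 1 else 0 := by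
      refine le_trans ?_ (Finset.single_le_sum (f := fun i => if P i G then (1 : ℝ) else 0)
        (fun j _ => by positivity) hi)
      simp [hP]
    split_ifs <;> linarith
  · rw [if_neg h]
    exact Finset.sum_nonneg fun j _ => by positivity

lemma prob_or_le (p : unitInterval) (P Q : SimpleGraph V → Prop) :
    prob p (fun G => P G ∨ Q G) ≤ prob p P + prob p Q := by
  have : prob p P + prob p Q =
      expect p (fun G => (if P G then (1 : ℝ) else 0) + if Q G then 1 else 0) := by
    simp only [prob, expect, mul_add, Finset.sum_add_distrib]
  rw [this]
  refine expect_mono p fun G => ?_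
  by_cases h1 : P G <;> by_cases h2 : Q G <;> simp [h1, h2]

/-- Markov's inequality in the form used for exponential moments. -/
lemma prob_le_expect (p : unitInterval) (P : SimpleGraph V → Prop) {F : SimpleGraph V → ℝ} {c : ℝ}
    (h0 : ∀ G, 0 ≤ F G) (h : ∀ G, P G → 1 ≤ F G * c) (hc : 0 ≤ c) : prob p P ≤ expect p F * c := by
  rw [← expect_mul_const]
  refine expect_mono p fun G => ?_
  by_cases hP : P G
  · simpa [hP] using h G hP
  · simpa [hP] using mul_nonneg (h0 G) hc

/-! ### Independence of disjoint sets of edges -/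

/-- `F` only depends on which of the pairs in `R` are edges. -/
def DeterminedBy {α : Type*} (R : V → V → Prop) (F : SimpleGraph V → α) : Prop :=
  ∀ G G' : SimpleGraph V, (∀ x y, R x y → (G.Adj x y ↔ G'.Adj x y)) → F G = F G'

lemma DeterminedBy.mono {α : Type*} {R R' : V → V → Prop} {F : SimpleGraph V → α}
    (h : DeterminedBy R F) (hR : ∀ x y, R x y → R' x y) : DeterminedBy R' F :=
  fun G G' hG => h G G' fun x y hxy => hG x y (hR x y hxy)

/-- Adding an edge multiplies the weight of a graph by `p / (1 - p)`; the denominator is cleared so that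
`p = 1` is covered. -/
lemma real_singleton_sup_edge (p : unitInterval) (G : SimpleGraph V) {a b : V} (hab : a ≠ b)
    (h : ¬ G.Adj a b) :
    (1 - (p : ℝ)) * (SimpleGraph.binomialRandom V p).real {G ⊔ SimpleGraph.edge a b} =
      p * (SimpleGraph.binomialRandom V p).real {G} := by
  have hE : (G ⊔ SimpleGraph.edge a b).edgeSet.ncard = G.edgeSet.ncard + 1 := by
    have : (G ⊔ SimpleGraph.edge a b).edgeSet = insert s(a, b) G.edgeSet := by
      rw [SimpleGraph.edgeSet_sup, SimpleGraph.edgeSet_edge_of_ne hab, Set.union_comm]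
      rfl
    rw [this, Set.ncard_insert_of_notMem (by simpa using h)]
  have hle : (G ⊔ SimpleGraph.edge a b).edgeSet.ncard ≤ (Nat.card V).choose 2 := by
    rw [← Nat.card_coe_set_eq, Nat.card_eq_fintype_card, Nat.card_eq_fintype_card,
      ← SimpleGraph.edgeFinset_card]
    exact SimpleGraph.card_edgeFinset_le_card_choose_two
  rw [measureReal_def, measureReal_def, SimpleGraph.binomialRandom_singleton,
    SimpleGraph.binomialRandom_singleton]
  simp only [ENNReal.toReal_mul, ENNReal.toReal_pow, ENNReal.coe_toReal, unitInterval.coe_toNNReal,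
    unitInterval.coe_symm_eq]
  rw [hE] at hle ⊢
  obtain ⟨c, hc⟩ := Nat.exists_eq_add_of_le hle
  rw [hc, Nat.add_sub_cancel_left, show G.edgeSet.ncard + 1 + c - G.edgeSet.ncard = c + 1 by omega]
  ring

/-- An edge is present with probability `p`, independently of all other edges. -/
lemma expect_edge (p : unitInterval) {a b : V} (hab : a ≠ b) {F : SimpleGraph V → ℝ}
    (hF : DeterminedBy (fun x y => s(x, y) ≠ s(a, b)) F) :
    expect p (fun G => F G * if G.Adj a b then 1 else 0) = p * expect p F := by
  set μ := SimpleGraph.binomialRandom V p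
  have hsum : expect p F = ∑ G ∈ Finset.univ.filter (fun G : SimpleGraph V => G.Adj a b),
      μ.real {G} * F G + ∑ G ∈ Finset.univ.filter (fun G : SimpleGraph V => ¬ G.Adj a b),
      μ.real {G} * F G := (Finset.sum_filter_add_sum_filter_not _ _ _).symm
  have hbij : ∑ G ∈ Finset.univ.filter (fun G : SimpleGraph V => G.Adj a b),
      (1 - (p : ℝ)) * (μ.real {G} * F G) =
      ∑ G ∈ Finset.univ.filter (fun G : SimpleGraph V => ¬ G.Adj a b),
      (p : ℝ) * (μ.real {G} * F G) := by
    symm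
    refine Finset.sum_bij' (fun G _ => G ⊔ SimpleGraph.edge a b)
      (fun G _ => G.deleteEdges {s(a, b)}) ?_ ?_ ?_ ?_ ?_
    · intro G _
      simp [SimpleGraph.edge_adj, hab]
    · intro G _
      simp
    · intro G hG
      simp only [Finset.mem_filter, Finset.mem_univ, true_and] at hG
      ext x y
      simp only [SimpleGraph.deleteEdges_adj, SimpleGraph.sup_adj, SimpleGraph.edge_adj,
        Set.mem_singleton_iff, Sym2.eq_iff]
      constructor
      · rintro ⟨h | h, h'⟩
        · exact h
        · tauto
      · intro h
        refine ⟨Or.inl h, ?_⟩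
        rintro (⟨rfl, rfl⟩ | ⟨rfl, rfl⟩)
        · exact hG h
        · exact hG h.symm
    · intro G hG
      simp only [Finset.mem_filter, Finset.mem_univ, true_and] at hG
      ext x y
      simp only [SimpleGraph.deleteEdges_adj, SimpleGraph.sup_adj, SimpleGraph.edge_adj,
        Set.mem_singleton_iff, Sym2.eq_iff]
      constructor
      · rintro (h | ⟨⟨rfl, rfl⟩ | ⟨rfl, rfl⟩, h'⟩)
        · exact h.1
        · exact hG
        · exact hG.symm
      · intro h
        by_cases h' : (x = a ∧ y = b) ∨ (x = b ∧ y = a)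
        · exact Or.inr ⟨by tauto, h.ne⟩
        · exact Or.inl ⟨h, h'⟩
    · intro G hG
      simp only [Finset.mem_filter, Finset.mem_univ, true_and] at hG
      have h1 : F G = F (G ⊔ SimpleGraph.edge a b) := by
        refine hF _ _ fun x y hxy => ?_
        simp only [SimpleGraph.sup_adj, SimpleGraph.edge_adj]
        have h2 : ¬ ((x = a ∧ y = b) ∨ (x = b ∧ y = a)) := by
          simpa [Sym2.eq_iff] using hxy
        tauto
      rw [← h1, ← mul_assoc, ← mul_assoc, real_singleton_sup_edge p G hab hG]
  have hl : expect p (fun G => F G * if G.Adj a b then 1 else 0) =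
      ∑ G ∈ Finset.univ.filter (fun G : SimpleGraph V => G.Adj a b), μ.real {G} * F G := by
    simp only [expect, mul_ite, mul_one, mul_zero, Finset.sum_filter]
    rfl
  rw [← Finset.mul_sum, ← Finset.mul_sum] at hbij
  rw [hl, hsum]
  linarith

/-- The probability that a `p`-random subset of `Y` equals `Z`. -/
noncomputable def cellProb (p : unitInterval) (Y Z : Finset V) : ℝ :=
  (p : ℝ) ^ Z.card * (1 - p) ^ (Y.card - Z.card)

lemma cellProb_nonneg (p : unitInterval) (Y Z : Finset V) : 0 ≤ cellProb p Y Z :=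
  mul_nonneg (pow_nonneg p.2.1 _) (pow_nonneg (sub_nonneg.2 p.2.2) _)

lemma sum_cellProb (p : unitInterval) (Y : Finset V) :
    ∑ Z ∈ Y.powerset, cellProb p Y Z = 1 := by
  simp only [cellProb]
  rw [Finset.sum_pow_mul_eq_add_pow]
  simp

/-- The neighbours of `w` inside `Y`. -/
noncomputable def nbrIn (G : SimpleGraph V) (w : V) (Y : Finset V) : Finset V :=
  Y.filter (G.Adj w)

lemma nbrIn_subset (G : SimpleGraph V) (w : V) (Y : Finset V) : nbrIn G w Y ⊆ Y :=
  Finset.filter_subset _ _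

/-- The edges between `w` and `Y` are independent of the other edges. -/
lemma expect_nbrIn_eq (p : unitInterval) (w : V) {F : SimpleGraph V → ℝ} (Y : Finset V) :
    ∀ Z ⊆ Y, w ∉ Y →
    DeterminedBy (fun x y => ¬ (x = w ∧ y ∈ Y) ∧ ¬ (y = w ∧ x ∈ Y)) F →
    expect p (fun G => F G * if nbrIn G w Y = Z then 1 else 0) = expect p F * cellProb p Y Z := by
  induction Y using Finset.induction_on with
  | empty =>
    intro Z hZ _ _
    obtain rfl := Finset.subset_empty.1 hZ
    simp [nbrIn, cellProb]
  | insert y Y hy ih =>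
    intro Z hZ hw hF
    rw [Finset.mem_insert, not_or] at hw
    have hF' : DeterminedBy (fun x y => ¬ (x = w ∧ y ∈ Y) ∧ ¬ (y = w ∧ x ∈ Y)) F := by
      intro G G' h
      refine hF _ _ fun x z hxz => h x z ?_
      simp only [Finset.mem_insert] at hxz
      tauto
    set Z' := Z.erase y
    have hZ' : Z' ⊆ Y := by
      intro z hz
      have := hZ (Finset.mem_of_mem_erase hz)
      rw [Finset.mem_insert] at this
      exact this.resolve_left (Finset.ne_of_mem_erase hz)
    have hyZ' : y ∉ Z' := Finset.notMem_erase y Z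
    have hdet : DeterminedBy (fun x z => s(x, z) ≠ s(w, y))
        (fun G => F G * if nbrIn G w Y = Z' then (1 : ℝ) else 0) := by
      intro G G' h
      have h1 : F G = F G' := by
        refine hF _ _ fun x z hxz => h x z ?_
        simp only [Finset.mem_insert, ne_eq, Sym2.eq_iff] at hxz ⊢
        tauto
      have h2 : nbrIn G w Y = nbrIn G' w Y := by
        refine Finset.filter_congr fun z hz => h w z ?_
        simp only [ne_eq, Sym2.eq_iff]
        rintro (⟨-, rfl⟩ | ⟨rfl, -⟩)
        · exact hy hz
        · exact hw.1 rfl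
      simp only [h1, h2]
    have hedge := expect_edge p hw.1 hdet
    have ih' := ih Z' hZ' hw.2 hF'
    have hins : ∀ G : SimpleGraph V, nbrIn G w (insert y Y) =
        if G.Adj w y then insert y (nbrIn G w Y) else nbrIn G w Y := fun G => by
      simp only [nbrIn, Finset.filter_insert]
    have hynb : ∀ G : SimpleGraph V, y ∉ nbrIn G w Y := fun G h => hy (nbrIn_subset _ _ _ h)
    by_cases hyZ : y ∈ Z
    · have hZZ : Z = insert y Z' := (Finset.insert_erase hyZ).symm
      have hfun : (fun G => F G * if nbrIn G w (insert y Y) = Z then (1 : ℝ) else 0) =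
          fun G => (F G * if nbrIn G w Y = Z' then (1 : ℝ) else 0) *
            if G.Adj w y then 1 else 0 := by
        funext G
        have : nbrIn G w (insert y Y) = Z ↔ nbrIn G w Y = Z' ∧ G.Adj w y := by
          rw [hins]
          by_cases ha : G.Adj w y
          · simp only [ha, if_true, and_true]
            rw [hZZ]
            constructor
            · intro h
              rw [← Finset.erase_insert (hynb G), h, Finset.erase_insert hyZ']
            · rintro h; rw [h]
          · simp only [ha, if_false, and_false, iff_false]
            intro h
            exact hynb G (h ▸ hyZ)
        by_cases h1 : nbrIn G w Y = Z' <;> by_cases h2 : G.Adj w y <;> simp [this, h1, h2]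
      rw [hfun, hedge, ih', hZZ]
      simp only [cellProb, Finset.card_insert_of_notMem hyZ', Finset.card_insert_of_notMem hy,
        Nat.add_sub_add_right]
      ring
    · have hZZ : Z' = Z := Finset.erase_eq_of_notMem hyZ
      rw [hZZ] at hedge ih'
      have hfun : (fun G => F G * if nbrIn G w (insert y Y) = Z then (1 : ℝ) else 0) =
          fun G => (F G * if nbrIn G w Y = Z then (1 : ℝ) else 0) -
            (F G * if nbrIn G w Y = Z then (1 : ℝ) else 0) * if G.Adj w y then 1 else 0 := by
        funext G
        have : nbrIn G w (insert y Y) = Z ↔ nbrIn G w Y = Z ∧ ¬ G.Adj w y := by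
          rw [hins]
          by_cases ha : G.Adj w y
          · simp only [ha, if_true, not_true, and_false, iff_false]
            intro h
            exact hyZ (h ▸ Finset.mem_insert_self _ _)
          · simp [ha]
        by_cases h1 : nbrIn G w Y = Z <;> by_cases h2 : G.Adj w y <;> simp [this, h1, h2]
      have hsub : ∀ A B : SimpleGraph V → ℝ, expect p (fun G => A G - B G) =
          expect p A - expect p B := fun A B => by
        simp only [expect, mul_sub, Finset.sum_sub_distrib]
      rw [hfun, hsub, hedge, ih']
      have hZY : Z ⊆ Y := hZZ ▸ hZ'
      simp only [cellProb, Finset.card_insert_of_notMem hy]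
      rw [Nat.succ_sub (Finset.card_le_card hZY), pow_succ]
      ring

/-- The expectation of `φ` of a `p`-random subset of `Y`. -/
noncomputable def cellMean (p : unitInterval) (Y : Finset V) (φ : Finset V → ℝ) : ℝ :=
  ∑ Z ∈ Y.powerset, cellProb p Y Z * φ Z

lemma expect_nbrIn (p : unitInterval) (w : V) {F : SimpleGraph V → ℝ} (Y : Finset V) (hw : w ∉ Y)
    (hF : DeterminedBy (fun x y => ¬ (x = w ∧ y ∈ Y) ∧ ¬ (y = w ∧ x ∈ Y)) F)
    (φ : Finset V → ℝ) :
    expect p (fun G => F G * φ (nbrIn G w Y)) = expect p F * cellMean p Y φ := by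
  have : (fun G => F G * φ (nbrIn G w Y)) = fun G => ∑ Z ∈ Y.powerset,
      (F G * if nbrIn G w Y = Z then (1 : ℝ) else 0) * φ Z := by
    funext G
    rw [Finset.sum_eq_single (nbrIn G w Y)]
    · simp
    · intro Z _ hZ
      simp [hZ.symm]
    · intro h
      exact absurd (Finset.mem_powerset.2 (nbrIn_subset G w Y)) h
  rw [this, expect_sum, cellMean, Finset.mul_sum]
  refine Finset.sum_congr rfl fun Z hZ => ?_
  rw [expect_mul_const, expect_nbrIn_eq p w Y Z (Finset.mem_powerset.1 hZ) hw hF, mul_assoc]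

/-- The neighbourhoods inside `Y` of the vertices of a set `W` disjoint from `Y` are independent of
each other and of everything not depending on the edges between `W` and `Y`. -/
lemma expect_prod_nbrIn (p : unitInterval) {F : SimpleGraph V → ℝ} (Y W : Finset V)
    (hWY : Disjoint W Y)
    (hF : DeterminedBy (fun x y => ¬ (x ∈ W ∧ y ∈ Y) ∧ ¬ (y ∈ W ∧ x ∈ Y)) F)
    (φ : V → Finset V → ℝ) :
    expect p (fun G => F G * ∏ w ∈ W, φ w (nbrIn G w Y)) =
      expect p F * ∏ w ∈ W, cellMean p Y (φ w) := by
  induction W using Finset.induction_on with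
  | empty => simp
  | insert w W hw ih =>
    have hWY' : Disjoint W Y := (Finset.disjoint_insert_left.1 hWY).2
    have hwY : w ∉ Y := (Finset.disjoint_insert_left.1 hWY).1
    have ih' := ih hWY' (hF.mono fun x y h => by simp only [Finset.mem_insert] at h; tauto)
    have hdet : DeterminedBy (fun x y => ¬ (x = w ∧ y ∈ Y) ∧ ¬ (y = w ∧ x ∈ Y))
        (fun G => F G * ∏ w ∈ W, φ w (nbrIn G w Y)) := by
      intro G G' h
      have h1 : F G = F G' := by
        refine hF _ _ fun x z hxz => h x z ?_
        simp only [Finset.mem_insert] at hxz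
        tauto
      have h2 : ∀ u ∈ W, nbrIn G u Y = nbrIn G' u Y := by
        intro u hu
        refine Finset.filter_congr fun z hz => h u z ⟨?_, ?_⟩
        · rintro ⟨rfl, -⟩; exact hw hu
        · rintro ⟨rfl, -⟩; exact hwY hz
      simp only [h1]
      congr 1
      exact Finset.prod_congr rfl fun u hu => by rw [h2 u hu]
    have h := expect_nbrIn p w Y hwY hdet (φ w)
    rw [ih'] at h
    simp only [Finset.prod_insert hw]
    rw [mul_comm (cellMean p Y (φ w)), ← mul_assoc, ← h]
    congr 1
    funext G
    ring

/-- Conditioning on the value of `r`: if, given `r G = x`, both `F` and the event `r G = x` do not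
depend on the edges between `W x` and `Y x`, then these edges may be averaged out. -/
lemma expect_condition (p : unitInterval) {α : Type*} [Fintype α] (r : SimpleGraph V → α)
    {F : SimpleGraph V → ℝ} (Y W : α → Finset V) (hWY : ∀ x, Disjoint (W x) (Y x))
    (hF : ∀ x, DeterminedBy (fun a b => ¬ (a ∈ W x ∧ b ∈ Y x) ∧ ¬ (b ∈ W x ∧ a ∈ Y x))
      fun G => F G * if r G = x then 1 else 0)
    (φ : α → V → Finset V → ℝ) :
    expect p (fun G => F G * ∏ w ∈ W (r G), φ (r G) w (nbrIn G w (Y (r G)))) =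
      expect p (fun G => F G * ∏ w ∈ W (r G), cellMean p (Y (r G)) (φ (r G) w)) := by
  have hsplit : ∀ H : SimpleGraph V → α → ℝ, expect p (fun G => F G * H G (r G)) =
      ∑ x, expect p (fun G => (F G * if r G = x then (1 : ℝ) else 0) * H G x) := by
    intro H
    rw [← expect_sum]
    congr 1
    funext G
    rw [Finset.sum_eq_single (r G)]
    · simp
    · intro x _ hx
      simp [hx.symm]
    · simp
  rw [hsplit fun G x => ∏ w ∈ W x, φ x w (nbrIn G w (Y x)),
    hsplit fun _ x => ∏ w ∈ W x, cellMean p (Y x) (φ x w)]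
  refine Finset.sum_congr rfl fun x _ => ?_
  rw [expect_prod_nbrIn p (Y x) (W x) (hWY x) (hF x), expect_mul_const]

end Expectation

/-! ### Breadth-first exploration -/

section Exploration

variable {V : Type*} [Fintype V]

/-- Breadth-first exploration from `T`. The first component of `explore G T j` is the set of
vertices at distance less than `j` from `T`, the second one is the set of vertices at distance
exactly `j`. -/
noncomputable def explore (G : SimpleGraph V) (T : Finset V) : ℕ → Finset V × Finset V
  | 0 => (∅, T)
  | j + 1 => ((explore G T j).1 ∪ (explore G T j).2,
      Finset.univ.filter fun w => w ∉ (explore G T j).1 ∪ (explore G T j).2 ∧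
        ∃ u ∈ (explore G T j).2, G.Adj u w)

lemma explore_succ_fst (G : SimpleGraph V) (T : Finset V) (j : ℕ) :
    (explore G T (j + 1)).1 = (explore G T j).1 ∪ (explore G T j).2 := rfl

lemma mem_explore_succ_snd {G : SimpleGraph V} {T : Finset V} {j : ℕ} {w : V} :
    w ∈ (explore G T (j + 1)).2 ↔ w ∉ (explore G T (j + 1)).1 ∧
      ∃ u ∈ (explore G T j).2, G.Adj u w := by
  simp [explore]

lemma disjoint_explore (G : SimpleGraph V) (T : Finset V) (j : ℕ) :
    Disjoint (explore G T j).1 (explore G T j).2 := by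
  cases j with
  | zero => simp [explore]
  | succ j => exact Finset.disjoint_right.2 fun w hw => (mem_explore_succ_snd.1 hw).1

lemma card_explore_succ_fst (G : SimpleGraph V) (T : Finset V) (j : ℕ) :
    (explore G T (j + 1)).1.card = (explore G T j).1.card + (explore G T j).2.card :=
  Finset.card_union_of_disjoint (disjoint_explore G T j)

lemma card_explore_fst (G : SimpleGraph V) (T : Finset V) (j : ℕ) :
    (explore G T j).1.card = ∑ l ∈ Finset.range j, (explore G T l).2.card := by
  induction j with
  | zero => simp [explore]
  | succ j ih => rw [card_explore_succ_fst, ih, Finset.sum_range_succ]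

lemma edist_le_succ {G : SimpleGraph V} {t w : V} {j : ℕ} :
    G.edist t w ≤ ((j + 1 : ℕ) : ℕ∞) ↔
      G.edist t w ≤ (j : ℕ∞) ∨ ∃ u, G.edist t u ≤ (j : ℕ∞) ∧ G.Adj u w := by
  constructor
  · intro h
    obtain ⟨q, hq⟩ := SimpleGraph.exists_walk_of_edist_ne_top
      (ne_top_of_le_ne_top (ENat.natCast_ne_top _) h)
    rw [← hq] at h
    have hlen : q.length ≤ j + 1 := by exact_mod_cast h
    rcases Nat.lt_or_ge q.length (j + 1) with hl | hl
    · left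
      rw [← hq]
      exact_mod_cast Nat.lt_succ_iff.1 hl
    · right
      have hnil : ¬ q.Nil := by
        intro hn
        have := SimpleGraph.Walk.length_eq_zero_iff.2 hn
        omega
      refine ⟨q.penultimate, ?_, q.adj_penultimate hnil⟩
      refine (SimpleGraph.edist_le q.dropLast).trans ?_
      have h1 : q.dropLast.length + 1 = q.length := by
        simp only [SimpleGraph.Walk.dropLast, SimpleGraph.Walk.take_length]
        omega
      have : q.dropLast.length ≤ j := by omega
      exact_mod_cast this
  · rintro (h | ⟨u, h, hu⟩)
    · exact h.trans (by exact_mod_cast Nat.le_succ j)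
    · calc G.edist t w ≤ G.edist t u + G.edist u w := SimpleGraph.edist_triangle
        _ ≤ j + 1 := add_le_add h (le_of_eq (SimpleGraph.edist_eq_one_iff_adj.2 hu))
        _ = ((j + 1 : ℕ) : ℕ∞) := by push_cast; rfl

lemma adj_mem_explore_fst {G : SimpleGraph V} {T : Finset V} {j : ℕ} {u w : V}
    (hu : u ∈ (explore G T j).1) (huw : G.Adj u w) : w ∈ (explore G T (j + 1)).1 := by
  induction j with
  | zero => simp [explore] at hu
  | succ j ih =>
    rw [explore_succ_fst, Finset.mem_union] at hu
    rw [explore_succ_fst, Finset.mem_union]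
    rcases hu with hu | hu
    · exact Or.inl (ih hu)
    · by_cases hw : w ∈ (explore G T (j + 1)).1
      · exact Or.inl hw
      · exact Or.inr (mem_explore_succ_snd.2 ⟨hw, u, hu, huw⟩)

lemma mem_explore_fst {G : SimpleGraph V} {T : Finset V} {j : ℕ} {w : V} :
    w ∈ (explore G T (j + 1)).1 ↔ ∃ t ∈ T, G.edist t w ≤ (j : ℕ∞) := by
  induction j generalizing w with
  | zero =>
    simp only [explore, Finset.empty_union, Nat.cast_zero, nonpos_iff_eq_zero,
      SimpleGraph.edist_eq_zero_iff]
    simp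
  | succ j ih =>
    rw [explore_succ_fst, Finset.mem_union, mem_explore_succ_snd]
    constructor
    · rintro (h | ⟨-, u, hu, huw⟩)
      · obtain ⟨t, ht, h⟩ := ih.1 h
        exact ⟨t, ht, edist_le_succ.2 (Or.inl h)⟩
      · obtain ⟨t, ht, h⟩ := ih.1 (by rw [explore_succ_fst]; exact Finset.mem_union_right _ hu)
        exact ⟨t, ht, edist_le_succ.2 (Or.inr ⟨u, h, huw⟩)⟩
    · rintro ⟨t, ht, h⟩
      rcases edist_le_succ.1 h with h | ⟨u, hu, huw⟩
      · exact Or.inl (ih.2 ⟨t, ht, h⟩)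
      · by_cases hw : w ∈ (explore G T (j + 1)).1
        · exact Or.inl hw
        · refine Or.inr ⟨hw, u, ?_, huw⟩
          have hu' := (ih (w := u)).2 ⟨t, ht, hu⟩
          rw [explore_succ_fst, Finset.mem_union] at hu'
          exact hu'.resolve_left fun hu1 => hw (adj_mem_explore_fst hu1 huw)

/-- The exploration up to level `j` is determined by the edges that meet the vertices seen before
level `j`. -/
lemma explore_congr {G G' : SimpleGraph V} {T : Finset V} {j : ℕ}
    (h : ∀ x y, x ∈ (explore G T j).1 ∨ y ∈ (explore G T j).1 → (G.Adj x y ↔ G'.Adj x y)) :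
    ∀ l ≤ j, explore G T l = explore G' T l := by
  induction j with
  | zero =>
    intro l hl
    obtain rfl : l = 0 := by omega
    rfl
  | succ j ih =>
    have hsub : (explore G T j).1 ⊆ (explore G T (j + 1)).1 := Finset.subset_union_left
    have ih' := ih fun x y hxy => h x y (hxy.imp (fun h => hsub h) fun h => hsub h)
    intro l hl
    rcases Nat.lt_succ_iff_lt_or_eq.1 (Nat.lt_succ_of_le hl) with hl | rfl
    · exact ih' l (by omega)
    · have h0 := ih' j le_rfl
      have h1 : (explore G T (j + 1)).1 = (explore G' T (j + 1)).1 := by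
        rw [explore_succ_fst, explore_succ_fst, h0]
      refine Prod.ext h1 ?_
      ext w
      rw [mem_explore_succ_snd, mem_explore_succ_snd, h1, h0]
      refine and_congr_right fun _ => exists_congr fun u => and_congr_right fun hu => ?_
      exact h u w (Or.inl (by
        rw [explore_succ_fst, h0]; exact Finset.mem_union_right _ hu))

/-- `F` is a function of the exploration from `T` up to level `j`. -/
def PastDetermined {α : Type*} (T : Finset V) (j : ℕ) (F : SimpleGraph V → α) : Prop :=
  ∀ G G' : SimpleGraph V, (∀ l ≤ j, explore G T l = explore G' T l) → F G = F G'

lemma PastDetermined.determinedBy {T : Finset V} {j : ℕ} {F : SimpleGraph V → ℝ}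
    (hF : PastDetermined T j F) (x : Finset V × Finset V) {Y W : Finset V}
    (hY : Disjoint x.1 Y) (hW : Disjoint x.1 W) :
    DeterminedBy (fun a b => ¬ (a ∈ W ∧ b ∈ Y) ∧ ¬ (b ∈ W ∧ a ∈ Y))
      fun G => F G * if explore G T j = x then 1 else 0 := by
  have key : ∀ G G' : SimpleGraph V,
      (∀ a b, ¬ (a ∈ W ∧ b ∈ Y) ∧ ¬ (b ∈ W ∧ a ∈ Y) → (G.Adj a b ↔ G'.Adj a b)) →
      explore G T j = x → ∀ l ≤ j, explore G T l = explore G' T l := by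
    intro G G' h hx
    refine explore_congr fun a b hab => h a b ?_
    rw [hx] at hab
    have hY' := fun a (ha : a ∈ x.1) => Finset.disjoint_left.1 hY ha
    have hW' := fun a (ha : a ∈ x.1) => Finset.disjoint_left.1 hW ha
    rcases hab with ha | hb
    · exact ⟨fun h => hW' a ha h.1, fun h => hY' a ha h.2⟩
    · exact ⟨fun h => hY' b hb h.2, fun h => hW' b hb h.1⟩
  intro G G' h
  by_cases hx : explore G T j = x
  · have h1 := key G G' h hx
    simp only [hF G G' h1, h1 j le_rfl]
  · by_cases hx' : explore G' T j = x
    · exact absurd ((key G' G (fun a b hab => (h a b hab).symm) hx' j le_rfl).symm.trans hx') hx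
    · simp [hx, hx']

/-- Averaging over fresh edges: edges that do not meet the vertices seen before level `j` are
independent of the exploration up to that level. -/
lemma expect_fresh (p : unitInterval) {T : Finset V} {j : ℕ} {F : SimpleGraph V → ℝ}
    (hF : PastDetermined T j F) (Y W : Finset V × Finset V → Finset V)
    (hWY : ∀ x, Disjoint (W x) (Y x)) (hY : ∀ x, Disjoint x.1 x.2 → Disjoint x.1 (Y x))
    (hW : ∀ x, Disjoint x.1 (W x)) (φ : Finset V × Finset V → V → Finset V → ℝ) :
    expect p (fun G => F G * ∏ w ∈ W (explore G T j),
        φ (explore G T j) w (nbrIn G w (Y (explore G T j)))) =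
      expect p (fun G => F G * ∏ w ∈ W (explore G T j),
        cellMean p (Y (explore G T j)) (φ (explore G T j) w)) := by
  refine expect_condition p (fun G => explore G T j) Y W hWY (fun x => ?_) φ
  by_cases hx : Disjoint x.1 x.2
  · convert hF.determinedBy x (hY x hx) (hW x)
  · intro G G' _
    have h : ∀ G : SimpleGraph V, explore G T j ≠ x := fun G h => hx (h ▸ disjoint_explore G T j)
    simp [h]

lemma cellMean_empty (p : unitInterval) (Y : Finset V) (a c : ℝ) :
    cellMean p Y (fun Z => if Z = ∅ then a else c) =
      (1 - (p : ℝ)) ^ Y.card * a + (1 - (1 - (p : ℝ)) ^ Y.card) * c := by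
  have h : cellMean p Y (fun Z => if Z = ∅ then a else c) =
      ∑ Z ∈ Y.powerset, (cellProb p Y Z * c + if Z = ∅ then cellProb p Y Z * (a - c) else 0) :=
    Finset.sum_congr rfl fun Z _ => by
      by_cases hZ : Z = ∅ <;> simp only [hZ, if_true, if_false] <;> ring
  rw [h, Finset.sum_add_distrib, ← Finset.sum_mul, sum_cellProb]
  simp [cellProb]
  ring

/-- The next level of the exploration, averaged over the fresh edges. -/
lemma expect_pow_front (p : unitInterval) {T : Finset V} {j : ℕ} {F : SimpleGraph V → ℝ}
    (hF : PastDetermined T j F) (c : ℝ) :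
    expect p (fun G => F G * c ^ (explore G T (j + 1)).2.card) =
      expect p (fun G => F G *
        ((1 - (p : ℝ)) ^ (explore G T j).2.card + (1 - (1 - (p : ℝ)) ^ (explore G T j).2.card) * c) ^
          (Fintype.card V - (explore G T (j + 1)).1.card)) := by
  have h := expect_fresh p hF (fun x => x.2) (fun x => (x.1 ∪ x.2)ᶜ)
    (fun x => Finset.disjoint_left.2 fun w hw hw' => by
      simp only [Finset.mem_compl, Finset.mem_union, not_or] at hw
      exact hw.2 hw')
    (fun x h => h)
    (fun x => Finset.disjoint_left.2 fun w hw hw' => by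
      simp only [Finset.mem_compl, Finset.mem_union, not_or] at hw'
      exact hw'.1 hw) (fun _ _ Z => if Z = ∅ then 1 else c)
  simp only [cellMean_empty, Finset.prod_const, mul_one] at h
  have e1 : ∀ G : SimpleGraph V, ((explore G T j).1 ∪ (explore G T j).2)ᶜ.card =
      Fintype.card V - (explore G T (j + 1)).1.card := fun G => by
    rw [Finset.card_compl, explore_succ_fst]
  simp only [e1] at h
  rw [← h]
  congr 1
  funext G
  congr 1
  rw [Finset.prod_ite]
  simp only [Finset.prod_const, one_pow, one_mul]
  congr 2
  ext w
  simp only [mem_explore_succ_snd, explore_succ_fst, Finset.mem_filter, Finset.mem_compl]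
  refine and_congr_right fun _ => ?_
  rw [← ne_eq, ← Finset.nonempty_iff_ne_empty]
  simp only [Finset.Nonempty, nbrIn, Finset.mem_filter, G.adj_comm w]

end Exploration

/-! ### Exponential moments of the sizes of the spheres -/

section Moments

variable {V : Type*} [Fintype V]

/-- The partial sum `1/d + 1/d² + ⋯ + 1/d^j`, the correction that accumulates when the exponential
moments are propagated through `j` levels of the exploration. -/
noncomputable def invGeom (d : ℝ) (j : ℕ) : ℝ := ∑ l ∈ Finset.range j, d⁻¹ ^ (l + 1)

lemma invGeom_nonneg {d : ℝ} (hd : 0 < d) (j : ℕ) : 0 ≤ invGeom d j :=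
  Finset.sum_nonneg fun _ _ => by positivity

lemma invGeom_le {d : ℝ} (hd : 2 ≤ d) (j : ℕ) : invGeom d j ≤ 2 / d := by
  have h : invGeom d j ≤ 2 / d - d⁻¹ ^ j * (2 / d) := by
    induction j with
    | zero => simp [invGeom]
    | succ j ih =>
      rw [invGeom, Finset.sum_range_succ, ← invGeom]
      have h1 : d⁻¹ ^ (j + 1) ≤ d⁻¹ ^ j * (2 / d) - d⁻¹ ^ (j + 1) * (2 / d) := by
        rw [pow_succ]
        have h2 : 0 < d⁻¹ ^ j := by positivity
        have h3 : d⁻¹ ≤ 2⁻¹ := inv_anti₀ (by norm_num) hd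
        have h4 : 0 < d⁻¹ := by positivity
        have : 2 / d = 2 * d⁻¹ := by ring
        rw [this]
        nlinarith [mul_pos h2 h4]
      linarith
  have : 0 ≤ d⁻¹ ^ j * (2 / d) := by positivity
  linarith

lemma one_sub_pow_le {p : ℝ} (hp0 : 0 ≤ p) (hp1 : p ≤ 1) (X : ℕ) : (1 - p) ^ X ≤ 1 / (1 + p * X) := by
  have h1 : (1 - p) ^ X ≤ Real.exp (-(p * X)) := by
    have := pow_le_pow_left₀ (sub_nonneg.2 hp1) (Real.one_sub_le_exp_neg p) X
    rw [← Real.exp_nat_mul] at this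
    rwa [show -(p * (X : ℝ)) = X * -p by ring]
  refine h1.trans ?_
  rw [Real.exp_neg, ← one_div]
  have : 0 ≤ p * X := by positivity
  exact one_div_le_one_div_of_le (by linarith) (by linarith [Real.add_one_le_exp (p * X)])

lemma le_one_sub_pow {p : ℝ} (hp1 : p ≤ 1) (X : ℕ) : 1 - p * X ≤ (1 - p) ^ X := by
  have := one_add_mul_le_pow (a := -p) (by linarith) X
  rw [← sub_eq_add_neg] at this
  linarith

/-- Upper bound for the exponential moments of the size of a sphere. -/
lemma expect_exp_front_le (p : unitInterval) (T : Finset V) {d : ℝ} (hd : d = p * Fintype.card V)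
    (hd0 : 0 < d) (j : ℕ) :
    ∀ y : ℝ, invGeom d j < y / d ^ j →
    expect p (fun G => Real.exp ((explore G T j).2.card / y)) ≤
      Real.exp (T.card / (y / d ^ j - invGeom d j)) := by
  induction j with
  | zero =>
    intro y _
    simp [explore, invGeom, expect_const]
  | succ j ih =>
    intro y hy
    have hs : invGeom d (j + 1) = invGeom d j + d⁻¹ ^ (j + 1) := by
      rw [invGeom, Finset.sum_range_succ, ← invGeom]
    have hy' : (y - 1) / d / d ^ j = y / d ^ (j + 1) - d⁻¹ ^ (j + 1) := by
      rw [inv_pow, pow_succ]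
      field_simp
    have hpos : 0 < (y - 1) / d / d ^ j := by
      rw [hy']
      have := invGeom_nonneg hd0 j
      linarith
    have hy1 : 1 < y := by
      have h1 : 0 < (y - 1) / d := by
        by_contra h
        exact absurd hpos (not_lt.2 (div_nonpos_of_nonpos_of_nonneg (not_lt.1 h) (by positivity)))
      by_contra h
      exact absurd h1 (not_lt.2 (div_nonpos_of_nonpos_of_nonneg (by linarith) hd0.le))
    have hih := ih ((y - 1) / d) (by rw [hy']; linarith)
    rw [hy'] at hih
    have hexp : Real.exp (1 / y) - 1 ≤ 1 / (y - 1) := by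
      have h1 : 1 - 1 / y ≤ Real.exp (-(1 / y)) := Real.one_sub_le_exp_neg _
      rw [Real.exp_neg] at h1
      have h2 : 0 < 1 - 1 / y := by
        rw [sub_pos, div_lt_one (by linarith)]; exact hy1
      have h3 := inv_anti₀ h2 h1
      rw [inv_inv] at h3
      have h4 : (1 - 1 / y)⁻¹ = 1 + 1 / (y - 1) := by
        have : y - 1 ≠ 0 := by linarith
        field_simp
        ring
      linarith
    have hE : (1 : ℝ) < Real.exp (1 / y) := by
      rw [Real.one_lt_exp_iff]; positivity
    have hst := expect_pow_front p (T := T) (j := j) (F := fun _ => 1) (fun _ _ _ => rfl)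
      (Real.exp (1 / y))
    simp only [one_mul, ← Real.exp_nat_mul] at hst
    have hdiv : ∀ G : SimpleGraph V, ((explore G T (j + 1)).2.card : ℝ) / y =
        ((explore G T (j + 1)).2.card : ℝ) * (1 / y) := fun G => by ring
    simp only [hdiv]
    rw [hst]
    refine le_trans (expect_mono p fun G => ?_) (hih.trans (le_of_eq ?_))
    · set X := (explore G T j).2.card
      set N := Fintype.card V - (explore G T (j + 1)).1.card
      have hN : (N : ℝ) ≤ Fintype.card V := by exact_mod_cast Nat.sub_le _ _
      have hX := le_one_sub_pow p.2.2 X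
      have hX1 : (1 - (p : ℝ)) ^ X ≤ 1 := pow_le_one₀ (sub_nonneg.2 p.2.2) (by linarith [p.2.1])
      have hX0 : 0 ≤ (1 - (p : ℝ)) ^ X := pow_nonneg (sub_nonneg.2 p.2.2) _
      calc ((1 - (p : ℝ)) ^ X + (1 - (1 - (p : ℝ)) ^ X) * Real.exp (1 / y)) ^ N
          ≤ (Real.exp ((1 - (1 - (p : ℝ)) ^ X) * (Real.exp (1 / y) - 1))) ^ N := by
            refine pow_le_pow_left₀ (by nlinarith) ?_ N
            refine le_trans (le_of_eq ?_) (Real.add_one_le_exp _)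
            ring
        _ = Real.exp (N * ((1 - (1 - (p : ℝ)) ^ X) * (Real.exp (1 / y) - 1))) := by
            rw [← Real.exp_nat_mul]
        _ ≤ Real.exp (Fintype.card V * (p * X * (1 / (y - 1)))) := by
            refine Real.exp_le_exp.2 (mul_le_mul hN (mul_le_mul (by linarith) hexp (by linarith) ?_)
              (mul_nonneg (by linarith) (by linarith)) (by positivity))
            exact mul_nonneg p.2.1 (by positivity)
        _ = Real.exp (X / ((y - 1) / d)) := by
            congr 1
            rw [hd] at hd0 ⊢
            have h1 : y - 1 ≠ 0 := by linarith
            field_simp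
    · congr 2
      rw [hs]
      ring

/-- The balls around `T` of radius less than `j` have at most four times their natural size. -/
def Thin (d : ℝ) (T : Finset V) (j : ℕ) (G : SimpleGraph V) : Prop :=
  ∀ l < j, ((explore G T (l + 1)).1.card : ℝ) ≤ 4 * d ^ l

lemma pastDetermined_thin_succ (d : ℝ) (T : Finset V) (j : ℕ) :
    PastDetermined T j (Thin d T (j + 1)) := by
  intro G G' h
  refine propext (forall_congr' fun l => forall_congr' fun hl => ?_)
  rw [explore_succ_fst, explore_succ_fst, h l (by omega)]

/-- Bound for the negative exponential moments of the size of a sphere, as long as the balls inside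
it are not unusually large. -/
lemma expect_thin_exp_neg_front_le (p : unitInterval) (T : Finset V) {d : ℝ}
    (hd : d = p * Fintype.card V) (hd4 : 4 ≤ d) (j : ℕ) (hj : 4 * d ^ j ≤ Fintype.card V) :
    ∀ y : ℝ, 0 < y →
    expect p (fun G => (if Thin d T j G then 1 else 0) *
        Real.exp (-((explore G T j).2.card / y))) ≤
      Real.exp (-(T.card / (Real.exp (16 * d ^ j / Fintype.card V) * (y / d ^ j + invGeom d j)))) := by
  have hd0 : 0 < d := by linarith
  have hn : (0 : ℝ) < Fintype.card V := lt_of_lt_of_le (by positivity) hj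
  induction j with
  | zero =>
    intro y hy
    simp only [explore, invGeom, Thin, Finset.range_zero, Finset.sum_empty, add_zero, pow_zero,
      div_one, not_lt_zero, false_imp_iff, implies_true, if_true, one_mul, expect_const]
    refine Real.exp_le_exp.2 (neg_le_neg ?_)
    refine div_le_div_of_nonneg_left (by positivity) hy ?_
    have : 1 ≤ Real.exp (16 * 1 / (Fintype.card V : ℝ)) := Real.one_le_exp (by positivity)
    nlinarith
  | succ j ih =>
    intro y hy
    have hdj : 0 < d ^ j := by positivity
    have hj' : 4 * d ^ j ≤ Fintype.card V := by
      have : d ^ j ≤ d ^ (j + 1) := by rw [pow_succ]; nlinarith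
      linarith
    set a := 4 * d ^ (j + 1) / Fintype.card V with ha
    have ha0 : 0 < a := by positivity
    have ha1 : a ≤ 1 := by rw [ha, div_le_one hn]; exact hj
    have hih := ih hj' ((1 + y) * (1 + 2 * a) / d) (by positivity)
    have hs : invGeom d (j + 1) = invGeom d j + d⁻¹ ^ (j + 1) := by
      rw [invGeom, Finset.sum_range_succ, ← invGeom]
    have hst := expect_pow_front p (T := T) (j := j)
      (F := fun G => if Thin d T (j + 1) G then 1 else 0)
      (fun G G' h => by simp only [pastDetermined_thin_succ d T j G G' h]) (Real.exp (-(1 / y)))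
    simp only [← Real.exp_nat_mul] at hst
    have hdiv : ∀ G : SimpleGraph V, -(((explore G T (j + 1)).2.card : ℝ) / y) =
        ((explore G T (j + 1)).2.card : ℝ) * (-(1 / y)) := fun G => by ring
    simp only [hdiv]
    rw [hst]
    refine le_trans (expect_mono p fun G => ?_) (hih.trans ?_)
    · by_cases hT : Thin d T (j + 1) G
      swap
      · simp only [hT, if_false, zero_mul]
        positivity
      have hT' : Thin d T j G := fun l hl => hT l (by omega)
      simp only [hT, hT', if_true, one_mul]
      set X := (explore G T j).2.card with hXdef
      set m := (explore G T (j + 1)).1.card with hm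
      have hmn : m ≤ Fintype.card V := Finset.card_le_univ _
      have hXm : X ≤ m := by rw [hm, card_explore_succ_fst]; exact Nat.le_add_left _ _
      have hmd : (m : ℝ) ≤ 4 * d ^ j := hT j (by omega)
      have hXmR : (X : ℝ) ≤ m := by exact_mod_cast hXm
      have hX := one_sub_pow_le p.2.1 p.2.2 X
      have hX0 : 0 ≤ (1 - (p : ℝ)) ^ X := pow_nonneg (sub_nonneg.2 p.2.2) _
      have hX1 : (1 - (p : ℝ)) ^ X ≤ 1 := pow_le_one₀ (sub_nonneg.2 p.2.2) (by linarith [p.2.1])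
      have hE : Real.exp (-(1 / y)) ≤ y / (1 + y) := by
        rw [Real.exp_neg]
        have h1 : (1 + y) / y ≤ Real.exp (1 / y) := by
          have := Real.add_one_le_exp (1 / y)
          have h2 : (1 + y) / y = 1 / y + 1 := by field_simp
          linarith
        have := inv_anti₀ (by positivity) h1
        rwa [inv_div] at this
      have hE0 := Real.exp_pos (-(1 / y))
      have hE' : 1 / (1 + y) ≤ 1 - Real.exp (-(1 / y)) := by
        have : 1 / (1 + y) = 1 - y / (1 + y) := by field_simp; ring
        linarith
      have hpX0 : 0 ≤ (p : ℝ) * X := mul_nonneg p.2.1 (by positivity)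
      have hpX : (p : ℝ) * X ≤ a := by
        rw [ha, le_div_iff₀ hn, mul_right_comm, ← hd, pow_succ]
        nlinarith
      have hX' : (p : ℝ) * X / (1 + p * X) ≤ 1 - (1 - (p : ℝ)) ^ X := by
        have : (p : ℝ) * X / (1 + p * X) = 1 - 1 / (1 + p * X) := by field_simp; ring
        linarith
      have hnm : (Fintype.card V : ℝ) * (1 - a / d) ≤ ((Fintype.card V - m : ℕ) : ℝ) := by
        rw [Nat.cast_sub hmn]
        have : (Fintype.card V : ℝ) * (a / d) = 4 * d ^ j := by
          rw [ha, pow_succ]; field_simp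
        linarith
      calc ((1 - (p : ℝ)) ^ X + (1 - (1 - (p : ℝ)) ^ X) * Real.exp (-(1 / y))) ^
            (Fintype.card V - m)
          ≤ (Real.exp (-((1 - (1 - (p : ℝ)) ^ X) * (1 - Real.exp (-(1 / y)))))) ^
            (Fintype.card V - m) := by
            refine pow_le_pow_left₀ ?_ ?_ _
            · have := mul_nonneg (sub_nonneg.2 hX1) hE0.le
              linarith
            · refine le_trans (le_of_eq ?_) (Real.add_one_le_exp _)
              ring
        _ = Real.exp (-(((Fintype.card V - m : ℕ) : ℝ) *
              ((1 - (1 - (p : ℝ)) ^ X) * (1 - Real.exp (-(1 / y)))))) := by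
            rw [← Real.exp_nat_mul]
            ring_nf
        _ ≤ Real.exp (-((Fintype.card V : ℝ) * (1 - a / d) *
              (((p : ℝ) * X / (1 + p * X)) * (1 / (1 + y))))) := by
            refine Real.exp_le_exp.2 (neg_le_neg ?_)
            refine mul_le_mul hnm (mul_le_mul hX' hE' (by positivity) (by linarith))
              (by positivity) (by positivity)
        _ ≤ Real.exp (-(X / ((1 + y) * (1 + 2 * a) / d))) := by
            refine Real.exp_le_exp.2 (neg_le_neg ?_)
            have h1 : 1 + (p : ℝ) * X ≤ (1 - a / d) * (1 + 2 * a) := by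
              have h2 : a / d ≤ a / 4 := div_le_div_of_nonneg_left ha0.le (by norm_num) hd4
              nlinarith
            have h3 : (X : ℝ) / ((1 + y) * (1 + 2 * a) / d) =
                d * X / (1 + y) * (1 / (1 + 2 * a)) := by field_simp
            have h4 : (Fintype.card V : ℝ) * (1 - a / d) * (((p : ℝ) * X / (1 + p * X)) * (1 / (1 + y))) =
                d * X / (1 + y) * ((1 - a / d) / (1 + p * X)) := by
              rw [hd]; field_simp
            rw [h3, h4]
            refine mul_le_mul_of_nonneg_left ?_ (by positivity)
            rw [div_le_div_iff₀ (by positivity) (by positivity)]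
            linarith
    · refine Real.exp_le_exp.2 (neg_le_neg ?_)
      have hs0 := invGeom_nonneg hd0 j
      refine div_le_div_of_nonneg_left (by positivity) (by positivity) ?_
      have h1 : (1 + 2 * a) * Real.exp (16 * d ^ j / Fintype.card V) ≤
          Real.exp (16 * d ^ (j + 1) / Fintype.card V) := by
        calc (1 + 2 * a) * Real.exp (16 * d ^ j / Fintype.card V)
            ≤ Real.exp (2 * a) * Real.exp (16 * d ^ j / Fintype.card V) := by
              refine mul_le_mul_of_nonneg_right ?_ (Real.exp_pos _).le
              linarith [Real.add_one_le_exp (2 * a)]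
          _ = Real.exp (2 * a + 16 * d ^ j / Fintype.card V) := by rw [Real.exp_add]
          _ ≤ _ := by
              refine Real.exp_le_exp.2 ?_
              have h5 : 2 * a + 16 * d ^ j / Fintype.card V =
                  (8 * d ^ (j + 1) + 16 * d ^ j) / Fintype.card V := by rw [ha]; ring
              rw [h5]
              refine div_le_div_of_nonneg_right ?_ hn.le
              rw [pow_succ]
              nlinarith
      have h6 : (1 + y) * (1 + 2 * a) / d / d ^ j + invGeom d j ≤
          (1 + 2 * a) * (y / d ^ (j + 1) + invGeom d (j + 1)) := by
        have h7 : (1 + y) * (1 + 2 * a) / d / d ^ j =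
            (1 + 2 * a) * (y / d ^ (j + 1) + d⁻¹ ^ (j + 1)) := by
          rw [inv_pow, pow_succ]; field_simp; ring
        rw [h7, hs]
        nlinarith
      calc Real.exp (16 * d ^ j / Fintype.card V) *
            ((1 + y) * (1 + 2 * a) / d / d ^ j + invGeom d j)
          ≤ Real.exp (16 * d ^ j / Fintype.card V) *
            ((1 + 2 * a) * (y / d ^ (j + 1) + invGeom d (j + 1))) :=
            mul_le_mul_of_nonneg_left h6 (Real.exp_pos _).le
        _ = ((1 + 2 * a) * Real.exp (16 * d ^ j / Fintype.card V)) *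
            (y / d ^ (j + 1) + invGeom d (j + 1)) := by ring
        _ ≤ _ := by
            refine mul_le_mul_of_nonneg_right h1 ?_
            have := invGeom_nonneg hd0 (j + 1)
            positivity

end Moments

/-! ### Sizes of spheres and balls -/

section Spheres

variable {V : Type*} [Fintype V]

/-- Chernoff bound for a large sphere, with exponential parameter of order `δ d / d ^ j`: the corrections
`invGeom` accumulated over the levels only cost a constant factor of `δ ^ 2 d` in the exponent. -/
lemma prob_front_large_le (p : unitInterval) (v : V) {d δ : ℝ} (hd : d = p * Fintype.card V)
    (hd2 : 2 ≤ d) (hδ0 : 0 < δ) (hδ1 : δ ≤ 1) (j : ℕ) :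
    prob p (fun G => (1 + δ) * d ^ j < ((explore G {v} j).2.card : ℝ)) ≤
      Real.exp (-(δ ^ 2 * d / 16)) := by
  have hd0 : 0 < d := by linarith
  set θ := δ * d / 8 with hθ
  have hθ0 : 0 < θ := by positivity
  have hs := invGeom_le hd2 j
  have hy : d ^ j / θ / d ^ j = 8 / (δ * d) := by rw [hθ]; field_simp
  have hgap : (8 - 2 * δ) / (δ * d) ≤ 8 / (δ * d) - invGeom d j := by
    have : (8 - 2 * δ) / (δ * d) = 8 / (δ * d) - 2 / d := by field_simp
    linarith
  have hgap0 : 0 < (8 - 2 * δ) / (δ * d) := div_pos (by linarith) (by positivity)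
  have h := expect_exp_front_le p {v} hd hd0 j (d ^ j / θ) (by rw [hy]; linarith)
  rw [hy, Finset.card_singleton, Nat.cast_one] at h
  refine (prob_le_expect p _ (c := Real.exp (-(θ * (1 + δ))))
    (F := fun G => Real.exp ((explore G {v} j).2.card / (d ^ j / θ)))
    (fun G => (Real.exp_pos _).le) ?_ (Real.exp_pos _).le).trans ?_
  · intro G hG
    rw [← Real.exp_add]
    refine Real.one_le_exp ?_
    have : (1 + δ) * d ^ j / (d ^ j / θ) ≤ ((explore G {v} j).2.card : ℝ) / (d ^ j / θ) :=
      div_le_div_of_nonneg_right hG.le (by positivity)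
    have h2 : (1 + δ) * d ^ j / (d ^ j / θ) = θ * (1 + δ) := by field_simp
    linarith
  · refine (mul_le_mul_of_nonneg_right h (Real.exp_pos _).le).trans ?_
    rw [← Real.exp_add]
    refine Real.exp_le_exp.2 ?_
    have h1 : 1 / (8 / (δ * d) - invGeom d j) ≤ θ * (1 + δ / 2) := by
      refine (one_div_le_one_div_of_le hgap0 hgap).trans ?_
      rw [one_div_div, div_le_iff₀ (by linarith), hθ]
      have : 0 < δ * d := by positivity
      nlinarith [mul_pos this hδ0]
    have h2 : θ * (1 + δ / 2) + -(θ * (1 + δ)) = -(δ ^ 2 * d / 16) := by rw [hθ]; ring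
    linarith

/-- No sphere of radius at most `i` is larger than its natural size by a factor more than
`1 + δ`. -/
def SmallSpheres (d δ : ℝ) (i : ℕ) (G : SimpleGraph V) : Prop :=
  ∀ v : V, ∀ j ≤ i, ((explore G {v} j).2.card : ℝ) ≤ (1 + δ) * d ^ j

lemma prob_not_smallSpheres_le (p : unitInterval) {d δ : ℝ} (hd : d = p * Fintype.card V)
    (hd2 : 2 ≤ d) (hδ0 : 0 < δ) (hδ1 : δ ≤ 1) (i : ℕ) :
    prob p (fun G : SimpleGraph V => ¬ SmallSpheres d δ i G) ≤
      Fintype.card V * (i + 1) * Real.exp (-(δ ^ 2 * d / 16)) := by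
  have h := prob_exists_le p ((Finset.univ : Finset V) ×ˢ Finset.range (i + 1))
    (fun x G => (1 + δ) * d ^ x.2 < ((explore G {x.1} x.2).2.card : ℝ))
  refine (prob_mono p fun G hG => ?_).trans (h.trans ?_)
  · simp only [SmallSpheres] at hG
    push Not at hG
    obtain ⟨v, j, hj, hlt⟩ := hG
    exact ⟨(v, j), by simp; omega, hlt⟩
  · refine (Finset.sum_le_card_nsmul _ _ _ fun x _ =>
      prob_front_large_le p x.1 hd hd2 hδ0 hδ1 x.2).trans (le_of_eq ?_)
    simp

lemma sum_pow_le {d : ℝ} (hd : 2 ≤ d) (j : ℕ) :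
    ∑ l ∈ Finset.range (j + 1), d ^ l ≤ (1 + 2 / d) * d ^ j := by
  have hd0 : 0 < d := by linarith
  induction j with
  | zero =>
    simp only [zero_add, Finset.sum_range_one, pow_zero, mul_one]
    linarith [show 0 < 2 / d by positivity]
  | succ j ih =>
    rw [Finset.sum_range_succ, pow_succ]
    have h1 : (1 + 2 / d) * (d ^ j * d) = d ^ j * d + 2 * d ^ j := by field_simp
    have h2 : 2 / d ≤ 1 := by rw [div_le_one hd0]; exact hd
    have h3 : 0 < d ^ j := by positivity
    nlinarith

lemma SmallSpheres.card_ball_le {d δ : ℝ} {i : ℕ} {G : SimpleGraph V} (h : SmallSpheres d δ i G)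
    (hd2 : 2 ≤ d) (hδ0 : 0 < δ) (v : V) {j : ℕ} (hj : j ≤ i) :
    ((explore G {v} (j + 1)).1.card : ℝ) ≤ (1 + δ) * (1 + 2 / d) * d ^ j := by
  rw [card_explore_fst]
  push_cast
  calc ∑ l ∈ Finset.range (j + 1), ((explore G {v} l).2.card : ℝ)
      ≤ ∑ l ∈ Finset.range (j + 1), (1 + δ) * d ^ l :=
        Finset.sum_le_sum fun l hl => h v l (by rw [Finset.mem_range] at hl; omega)
    _ = (1 + δ) * ∑ l ∈ Finset.range (j + 1), d ^ l := by rw [Finset.mul_sum]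
    _ ≤ (1 + δ) * ((1 + 2 / d) * d ^ j) :=
        mul_le_mul_of_nonneg_left (sum_pow_le hd2 j) (by linarith)
    _ = _ := by ring

lemma explore_fst_eq_biUnion (G : SimpleGraph V) (T : Finset V) (j : ℕ) :
    (explore G T j).1 = T.biUnion fun t => (explore G {t} j).1 := by
  cases j with
  | zero =>
    ext w
    simp [explore]
  | succ j =>
    ext w
    simp only [mem_explore_fst, Finset.mem_biUnion, Finset.mem_singleton, exists_eq_left]

lemma card_explore_fst_le (G : SimpleGraph V) (T : Finset V) (j : ℕ) {c : ℝ}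
    (h : ∀ v, ((explore G {v} j).1.card : ℝ) ≤ c) : ((explore G T j).1.card : ℝ) ≤ T.card * c := by
  rw [explore_fst_eq_biUnion]
  calc ((T.biUnion fun t => (explore G {t} j).1).card : ℝ)
      ≤ ((∑ t ∈ T, (explore G {t} j).1.card : ℕ) : ℝ) := by exact_mod_cast Finset.card_biUnion_le
    _ = ∑ t ∈ T, ((explore G {t} j).1.card : ℝ) := by push_cast; rfl
    _ ≤ T.card • c := Finset.sum_le_card_nsmul _ _ _ fun t _ => h t
    _ = T.card * c := by rw [nsmul_eq_mul]

/-- For at most two centres the crude bound in `Thin` follows from the bounds on the spheres. -/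
lemma SmallSpheres.thin {d δ : ℝ} {i : ℕ} {G : SimpleGraph V} (h : SmallSpheres d δ i G)
    (hd4 : 4 ≤ d) (hδ0 : 0 < δ) (hδ1 : δ ≤ 1 / 3) {T : Finset V} (hT : T.card ≤ 2) :
    Thin d T (i + 1) G := by
  intro l hl
  have h2 : (2 : ℝ) / d ≤ 1 / 2 := by
    rw [div_le_div_iff₀ (by linarith) (by norm_num)]; linarith
  have h2' : 0 < 2 / d := div_pos (by norm_num) (by linarith)
  have hl0 : 0 < d ^ l := pow_pos (by linarith) l
  have h1 := card_explore_fst_le G T (l + 1) fun v =>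
    h.card_ball_le (by linarith) hδ0 v (show l ≤ i by omega)
  have hT' : (T.card : ℝ) ≤ 2 := by exact_mod_cast hT
  have h3 : (1 + δ) * (1 + 2 / d) ≤ 2 := by nlinarith
  calc ((explore G T (l + 1)).1.card : ℝ) ≤ T.card * ((1 + δ) * (1 + 2 / d) * d ^ l) := h1
    _ ≤ 2 * (2 * d ^ l) := mul_le_mul hT' (mul_le_mul_of_nonneg_right h3 hl0.le)
        (by positivity) (by norm_num)
    _ = _ := by ring

lemma Thin.mono {d : ℝ} {T : Finset V} {j j' : ℕ} {G : SimpleGraph V} (h : Thin d T j' G)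
    (hj : j ≤ j') : Thin d T j G := fun l hl => h l (by omega)

/-- The spheres around two vertices have together almost `2 d ^ i` elements, i.e. they are almost
disjoint. The parameter `θ` will be `8 log n / δ`, much smaller than `d`. -/
lemma prob_thin_front_small_le (p : unitInterval) {T : Finset V} (hT : T.card = 2) {d δ θ : ℝ}
    (hd : d = p * Fintype.card V) (hd4 : 4 ≤ d) (hδ0 : 0 < δ) (hθ : 0 < θ) (i : ℕ)
    (hi : 4 * d ^ i ≤ Fintype.card V)
    (hC : Real.exp (16 * d ^ i / Fintype.card V) * (1 + 2 * θ / d) ≤ 1 + δ / 4) :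
    prob p (fun G => Thin d T i G ∧ ((explore G T i).2.card : ℝ) < (2 - δ) * d ^ i) ≤
      Real.exp (-(θ * δ / 2)) := by
  have hd0 : 0 < d := by linarith
  have hs := invGeom_le (show 2 ≤ d by linarith) i
  have hs0 := invGeom_nonneg hd0 i
  have hy : d ^ i / θ / d ^ i = 1 / θ := by field_simp
  have h := expect_thin_exp_neg_front_le p T hd hd4 i hi (d ^ i / θ) (by positivity)
  rw [hy, hT] at h
  refine (prob_le_expect p _ (c := Real.exp (θ * (2 - δ))) (F := fun G =>
    (if Thin d T i G then 1 else 0) * Real.exp (-((explore G T i).2.card / (d ^ i / θ))))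
    (fun G => by positivity) ?_ (Real.exp_pos _).le).trans ?_
  · rintro G ⟨hG1, hG2⟩
    simp only [hG1, if_true, one_mul]
    rw [← Real.exp_add]
    refine Real.one_le_exp ?_
    have : ((explore G T i).2.card : ℝ) / (d ^ i / θ) ≤ (2 - δ) * d ^ i / (d ^ i / θ) :=
      div_le_div_of_nonneg_right hG2.le (by positivity)
    have h2 : (2 - δ) * d ^ i / (d ^ i / θ) = θ * (2 - δ) := by field_simp
    linarith
  · refine (mul_le_mul_of_nonneg_right h (Real.exp_pos _).le).trans ?_
    rw [← Real.exp_add]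
    refine Real.exp_le_exp.2 ?_
    set C := Real.exp (16 * d ^ i / Fintype.card V)
    have hC0 : 0 < C := Real.exp_pos _
    have h1 : θ * (2 - δ / 2) ≤ ((2 : ℕ) : ℝ) / (C * (1 / θ + invGeom d i)) := by
      rw [le_div_iff₀ (by positivity)]
      have h3 : C * (1 / θ + invGeom d i) ≤ (1 + δ / 4) / θ := by
        have h4 : C * (1 / θ + 2 / d) = C * (1 + 2 * θ / d) / θ := by field_simp
        calc C * (1 / θ + invGeom d i) ≤ C * (1 / θ + 2 / d) := by gcongr
          _ = C * (1 + 2 * θ / d) / θ := h4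
          _ ≤ _ := div_le_div_of_nonneg_right hC hθ.le
      by_cases hδ : 2 - δ / 2 ≤ 0
      · have : θ * (2 - δ / 2) ≤ 0 := mul_nonpos_of_nonneg_of_nonpos hθ.le hδ
        have h5 : 0 ≤ C * (1 / θ + invGeom d i) := by positivity
        have := mul_nonpos_of_nonpos_of_nonneg this h5
        push_cast
        linarith
      · push Not at hδ
        calc θ * (2 - δ / 2) * (C * (1 / θ + invGeom d i))
            ≤ θ * (2 - δ / 2) * ((1 + δ / 4) / θ) := by gcongr
          _ = (2 - δ / 2) * (1 + δ / 4) := by field_simp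
          _ ≤ ((2 : ℕ) : ℝ) := by push_cast; nlinarith [sq_nonneg δ]
    nlinarith

lemma prob_low_degree_le (p : unitInterval) (v : V) {d : ℝ}
    (hd : d = p * Fintype.card V) (hd4 : 4 ≤ d) (hn : 32 * d ≤ Fintype.card V) :
    prob p (fun G => ((explore G {v} 1).2.card : ℝ) < d / 8) ≤ Real.exp (-(d / 8)) := by
  have hd0 : 0 < d := by linarith
  have h := expect_thin_exp_neg_front_le p {v} hd hd4 1 (by rw [pow_one]; linarith) 1 one_pos
  have hthin : ∀ G : SimpleGraph V, Thin d {v} 1 G := by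
    intro G l hl
    obtain rfl : l = 0 := by omega
    simp [explore]
  simp only [hthin, if_true, one_mul, div_one, pow_one, Finset.card_singleton, Nat.cast_one] at h
  refine (prob_le_expect p _ (c := Real.exp (d / 8)) (F := fun G =>
    Real.exp (-((explore G {v} 1).2.card : ℝ))) (fun G => by positivity) ?_
    (Real.exp_pos _).le).trans ?_
  · intro G hG
    rw [← Real.exp_add]
    exact Real.one_le_exp (by linarith)
  · refine (mul_le_mul_of_nonneg_right h (Real.exp_pos _).le).trans ?_
    rw [← Real.exp_add]
    refine Real.exp_le_exp.2 ?_
    have hC : Real.exp (16 * d / Fintype.card V) ≤ 2 := by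
      have h1 : 16 * d / Fintype.card V ≤ 1 / 2 := by
        rw [div_le_div_iff₀ (by linarith) (by norm_num)]; linarith
      have h2 : 1 - 1 / 2 ≤ Real.exp (-(1 / 2)) := Real.one_sub_le_exp_neg _
      rw [Real.exp_neg] at h2
      have h3 := inv_anti₀ (by norm_num) h2
      rw [inv_inv] at h3
      exact (Real.exp_le_exp.2 h1).trans (h3.trans (by norm_num))
    have h1 : d / 4 ≤ 1 / (Real.exp (16 * d / Fintype.card V) * (1 / d + invGeom d 1)) := by
      have h2 : 1 / d + invGeom d 1 = 2 / d := by simp [invGeom]; ring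
      rw [h2, le_div_iff₀ (by positivity)]
      calc d / 4 * (Real.exp (16 * d / Fintype.card V) * (2 / d))
          = Real.exp (16 * d / Fintype.card V) / 2 := by field_simp; norm_num
        _ ≤ 1 := by linarith
    linarith

/-! ### The diameter -/

lemma pastDetermined_thin (d : ℝ) (T : Finset V) (j : ℕ) : PastDetermined T j (Thin d T j) := by
  intro G G' h
  refine propext (forall_congr' fun l => forall_congr' fun hl => ?_)
  rw [h (l + 1) (by omega)]

/-- Two fixed vertices are unlikely to be at distance more than `i + 1`: the second one would have
to miss all the edges to the sphere of radius `i` around the first one. -/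
lemma prob_edist_gt_le (p : unitInterval) (u v : V) {d : ℝ} (hd : d = p * Fintype.card V)
    (hd4 : 4 ≤ d) (i : ℕ) (hi : 4 * d ^ i ≤ Fintype.card V) :
    prob p (fun G => Thin d {u} i G ∧ ¬ G.edist u v ≤ ((i + 1 : ℕ) : ℕ∞)) ≤
      Real.exp (-(1 / (Real.exp (16 * d ^ i / Fintype.card V) *
        (Fintype.card V / d ^ (i + 1) + 2 / d)))) := by
  have hd0 : 0 < d := by linarith
  have hn : (0 : ℝ) < Fintype.card V := lt_of_lt_of_le (by positivity) hi
  have hp0 : (0 : ℝ) < p := by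
    rcases p.2.1.eq_or_lt with h | h
    · rw [← h, zero_mul] at hd; linarith
    · exact h
  have h := expect_thin_exp_neg_front_le p {u} hd hd4 i hi (1 / p) (by positivity)
  rw [Finset.card_singleton, Nat.cast_one] at h
  have hy : 1 / (p : ℝ) / d ^ i = Fintype.card V / d ^ (i + 1) := by
    rw [pow_succ]
    nth_rewrite 2 [hd]
    field_simp
    rw [hd]
    ring
  rw [hy] at h
  have hfresh := expect_fresh p (T := {u}) (j := i)
    (F := fun G => (if Thin d {u} i G then 1 else 0) *
      if v ∉ (explore G {u} i).1 ∪ (explore G {u} i).2 then 1 else 0)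
    (fun G G' hGG' => by
      simp only [pastDetermined_thin d {u} i G G' hGG', hGG' i le_rfl])
    (fun x => x.2) (fun x => if v ∉ x.1 ∪ x.2 then {v} else ∅)
    (fun x => by
      by_cases hv : v ∉ x.1 ∪ x.2
      · rw [if_pos hv, Finset.disjoint_singleton_left]
        exact fun h' => hv (Finset.mem_union_right _ h')
      · rw [if_neg hv]; exact Finset.disjoint_empty_left _)
    (fun x hx => hx)
    (fun x => by
      by_cases hv : v ∉ x.1 ∪ x.2
      · rw [if_pos hv, Finset.disjoint_singleton_right]
        exact fun h' => hv (Finset.mem_union_left _ h')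
      · rw [if_neg hv]; exact Finset.disjoint_empty_right _)
    (fun _ _ Z => if Z = ∅ then 1 else 0)
  have hle : prob p (fun G => Thin d {u} i G ∧ ¬ G.edist u v ≤ ((i + 1 : ℕ) : ℕ∞)) ≤
      expect p (fun G => (if Thin d {u} i G then 1 else 0) *
        Real.exp (-((explore G {u} i).2.card / (1 / (p : ℝ))))) := by
    refine (expect_mono p fun G => ?_).trans (hfresh.le.trans (expect_mono p fun G => ?_))
    · by_cases hG : Thin d {u} i G ∧ ¬ G.edist u v ≤ ((i + 1 : ℕ) : ℕ∞)
      swap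
      · rw [if_neg hG]
        refine mul_nonneg (by positivity) (Finset.prod_nonneg fun w _ => by positivity)
      · have h1 : v ∉ (explore G {u} (i + 2)).1 := fun hv => hG.2 (by
          obtain ⟨t, ht, h⟩ := mem_explore_fst.1 hv
          rwa [Finset.mem_singleton.1 ht] at h)
        rw [explore_succ_fst, Finset.mem_union, not_or] at h1
        have h2 : v ∉ (explore G {u} i).1 ∪ (explore G {u} i).2 := h1.1
        have h3 : nbrIn G v (explore G {u} i).2 = ∅ := by
          refine Finset.filter_eq_empty_iff.2 fun z hz hzv => h1.2 ?_
          exact mem_explore_succ_snd.2 ⟨h1.1, z, hz, hzv.symm⟩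
        rw [if_pos hG]
        simp only [hG.1, h2, if_true, not_false_iff, one_mul, Finset.prod_singleton, h3, le_refl]
    · simp only [cellMean_empty, mul_one, mul_zero, add_zero]
      by_cases hG : Thin d {u} i G
      swap
      · simp [hG]
      by_cases h2 : v ∉ (explore G {u} i).1 ∪ (explore G {u} i).2
      · simp only [hG, h2, if_true, not_false_iff, one_mul, Finset.prod_singleton]
        have h4 : -(((explore G {u} i).2.card : ℝ) / (1 / (p : ℝ))) =
          ((explore G {u} i).2.card : ℝ) * (-p) := by field_simp
        rw [h4, Real.exp_nat_mul]
        exact pow_le_pow_left₀ (sub_nonneg.2 p.2.2) (Real.one_sub_le_exp_neg _) _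
      · simp only [h2, if_false, mul_zero, zero_mul]
        positivity
  refine hle.trans (h.trans (Real.exp_le_exp.2 (neg_le_neg ?_)))
  have hs := invGeom_le (show 2 ≤ d by linarith) i
  have hs0 := invGeom_nonneg hd0 i
  gcongr

end Spheres

/-! ### Random sensors separate positions -/

section Separation

variable {V : Type*} [Fintype V]

/-- If any two vertices are separated by at least `D` vertices, then random sensors leave few
unresolved pairs. -/
lemma exists_sensors_few_pairs (G : SimpleGraph V) {D : ℝ}
    (hD : ∀ u v : V, u ≠ v →
      D ≤ ((Finset.univ.filter fun s => G.edist s u ≠ G.edist s v).card : ℝ))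
    (k : ℕ) (A : Finset V) (hA : A.Nonempty) :
    ∃ f : Fin k → V, ((A.offDiag.filter fun x => ∀ i, G.edist (f i) x.1 = G.edist (f i) x.2).card : ℝ)
      ≤ (A.card : ℝ) ^ 2 * Real.exp (-(D * k / Fintype.card V)) := by
  have hne : Nonempty V := ⟨hA.choose⟩
  have hn : (0 : ℝ) < Fintype.card V := by exact_mod_cast Fintype.card_pos
  set B := (A.card : ℝ) ^ 2 * Real.exp (-(D * k / Fintype.card V))
  have hsum : ∑ f : Fin k → V,
      ((A.offDiag.filter fun x => ∀ i, G.edist (f i) x.1 = G.edist (f i) x.2).card : ℝ) ≤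
      ∑ _f : Fin k → V, B := by
    have h1 : ∀ f : Fin k → V,
        ((A.offDiag.filter fun x => ∀ i, G.edist (f i) x.1 = G.edist (f i) x.2).card : ℝ) =
        ∑ x ∈ A.offDiag, if ∀ i, G.edist (f i) x.1 = G.edist (f i) x.2 then 1 else 0 := by
      intro f
      rw [Finset.card_filter]
      push_cast
      rfl
    simp only [h1]
    rw [Finset.sum_comm]
    have h2 : ∀ x ∈ A.offDiag, (∑ f : Fin k → V,
        if ∀ i, G.edist (f i) x.1 = G.edist (f i) x.2 then (1 : ℝ) else 0) ≤
        (Fintype.card V : ℝ) ^ k * Real.exp (-(D * k / Fintype.card V)) := by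
      intro x hx
      set S := Finset.univ.filter fun s => G.edist s x.1 = G.edist s x.2
      have h3 : (∑ f : Fin k → V,
          if ∀ i, G.edist (f i) x.1 = G.edist (f i) x.2 then (1 : ℝ) else 0) = (S.card : ℝ) ^ k := by
        rw [← Finset.sum_filter, Finset.sum_const, nsmul_eq_mul, mul_one]
        have : (Finset.univ.filter fun f : Fin k → V =>
            ∀ i, G.edist (f i) x.1 = G.edist (f i) x.2) = Fintype.piFinset fun _ => S := by
          ext f
          simp [S]
        rw [this, Fintype.card_piFinset_const]
        push_cast
        simp
      rw [h3]
      have h4 : (S.card : ℝ) ≤ Fintype.card V * Real.exp (-(D / Fintype.card V)) := by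
        have h5 := hD x.1 x.2 (Finset.mem_offDiag.1 hx).2.2
        have h6 : S.card + (Finset.univ.filter fun s => G.edist s x.1 ≠ G.edist s x.2).card =
            Fintype.card V := by
          rw [← Finset.card_univ]
          exact Finset.card_filter_add_card_filter_not _
        have h7 : (S.card : ℝ) +
            ((Finset.univ.filter fun s => G.edist s x.1 ≠ G.edist s x.2).card : ℝ) =
            Fintype.card V := by exact_mod_cast h6
        have h8 := Real.one_sub_le_exp_neg (D / Fintype.card V)
        calc (S.card : ℝ) ≤ Fintype.card V - D := by linarith
          _ = Fintype.card V * (1 - D / Fintype.card V) := by field_simp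
          _ ≤ _ := mul_le_mul_of_nonneg_left h8 hn.le
      calc (S.card : ℝ) ^ k ≤ (Fintype.card V * Real.exp (-(D / Fintype.card V))) ^ k :=
            pow_le_pow_left₀ (by positivity) h4 k
        _ = _ := by
            rw [mul_pow, ← Real.exp_nat_mul]
            congr 2
            ring
    refine (Finset.sum_le_card_nsmul _ _ _ h2).trans ?_
    rw [Finset.sum_const, nsmul_eq_mul, nsmul_eq_mul, Finset.card_univ, Fintype.card_fun,
      Fintype.card_fin]
    have h9 : (A.offDiag.card : ℝ) ≤ (A.card : ℝ) ^ 2 := by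
      have : A.offDiag.card ≤ A.card ^ 2 := by
        rw [Finset.offDiag_card, sq]; exact Nat.sub_le _ _
      exact_mod_cast this
    push_cast
    have : 0 ≤ (Fintype.card V : ℝ) ^ k * Real.exp (-(D * k / Fintype.card V)) := by positivity
    nlinarith
  obtain ⟨f, -, hf⟩ := Finset.exists_le_of_sum_le
    (Finset.univ_nonempty (α := Fin k → V)) hsum
  exact ⟨f, hf⟩

lemma reach_card_le (G : SimpleGraph V) (C : Finset V) {M : ℝ}
    (hM : ∀ v, ((reach G {v}).card : ℝ) ≤ M) : ((reach G C).card : ℝ) ≤ C.card * M := by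
  have h : reach G C = C.biUnion fun v => reach G {v} := by
    ext w
    simp [mem_reach]
  rw [h]
  calc ((C.biUnion fun t => reach G {t}).card : ℝ)
      ≤ ((∑ t ∈ C, (reach G {t}).card : ℕ) : ℝ) := by exact_mod_cast Finset.card_biUnion_le
    _ = ∑ t ∈ C, ((reach G {t}).card : ℝ) := by push_cast; rfl
    _ ≤ C.card • M := Finset.sum_le_card_nsmul _ _ _ fun t _ => hM t
    _ = C.card * M := by rw [nsmul_eq_mul]

/-- If any two vertices are separated by at least `D` vertices and no closed neighbourhood has more
than `M` vertices, then `k` sensors suffice as soon as `2 M² exp (-D k / n) < 1`: a class of `c ≥ 2`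
unresolved positions accounts for `c (c - 1)` unresolved pairs, so that it stays smaller than the
previous set of possible positions even after it has grown by a factor `M`. -/
theorem localizationNumber_le_of_separated (G : SimpleGraph V) {D M : ℝ} (k : ℕ)
    (hD : ∀ u v : V, u ≠ v →
      D ≤ ((Finset.univ.filter fun s => G.edist s u ≠ G.edist s v).card : ℝ))
    (hM : ∀ v, ((reach G {v}).card : ℝ) ≤ M)
    (hk : 2 * M ^ 2 * Real.exp (-(D * k / Fintype.card V)) < 1) : localizationNumber G ≤ k := by
  by_cases hkn : k ≤ Fintype.card V
  swap
  · exact (Nat.sInf_le (copsWin_card G)).trans (by omega)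
  refine Nat.sInf_le (copsWin_of_shrink G k fun A => ?_)
  rcases A.eq_empty_or_nonempty with rfl | hA
  · obtain ⟨S, -, hS⟩ := Finset.exists_subset_card_eq (s := (Finset.univ : Finset V)) hkn
    exact ⟨S, hS, by simp⟩
  obtain ⟨f, hf⟩ := exists_sensors_few_pairs G hD k A hA
  obtain ⟨S, hfS, -, hS⟩ := Finset.exists_subsuperset_card_eq
    (Finset.subset_univ (Finset.univ.image f)) (n := k)
    (by simpa using Finset.card_image_le (s := Finset.univ) (f := f)) hkn
  refine ⟨S, hS, fun v hv => ?_⟩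
  by_cases huniq : ∀ u ∈ A, signature G S u = signature G S v → u = v
  · exact Or.inl huniq
  right
  push Not at huniq
  obtain ⟨u, hu, huv, hne⟩ := huniq
  set C := sigClass G S A (signature G S v) with hC
  have hc2 : 2 ≤ C.card := by
    have : ({u, v} : Finset V) ⊆ C := by
      intro x hx
      rw [Finset.mem_insert, Finset.mem_singleton] at hx
      rw [hC, sigClass, Finset.mem_filter]
      rcases hx with rfl | rfl
      · exact ⟨hu, huv⟩
      · exact ⟨hv, rfl⟩
    exact (Finset.card_pair hne).ge.trans (Finset.card_le_card this)
  have hsub : C.offDiag ⊆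
      A.offDiag.filter fun x => ∀ i, G.edist (f i) x.1 = G.edist (f i) x.2 := by
    intro x hx
    obtain ⟨h1, h2, h3⟩ := Finset.mem_offDiag.1 hx
    rw [hC, sigClass, Finset.mem_filter] at h1 h2
    refine Finset.mem_filter.2 ⟨Finset.mem_offDiag.2 ⟨h1.1, h2.1, h3⟩, fun i => ?_⟩
    have hi : f i ∈ S := hfS (Finset.mem_image_of_mem f (Finset.mem_univ i))
    have h4 := congrFun (h1.2.trans h2.2.symm) (f i)
    simpa [signature, hi] using h4
  have hcc : (C.card : ℝ) * (C.card - 1) ≤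
      (A.card : ℝ) ^ 2 * Real.exp (-(D * k / Fintype.card V)) := by
    refine le_trans (le_of_eq ?_) (le_trans (Nat.cast_le.2 (Finset.card_le_card hsub)) hf)
    rw [Finset.offDiag_card, Nat.cast_sub (Nat.le_mul_self _)]
    push_cast
    ring
  have hc2' : (2 : ℝ) ≤ C.card := by exact_mod_cast hc2
  have hM0 : 0 ≤ M := le_trans (Nat.cast_nonneg _) (hM v)
  have hA0 : (0 : ℝ) < A.card := by exact_mod_cast hA.card_pos
  have hlt : (C.card : ℝ) * M < A.card := by
    refine lt_of_pow_lt_pow_left₀ 2 hA0.le ?_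
    have h1 : (C.card : ℝ) ^ 2 ≤
        2 * ((A.card : ℝ) ^ 2 * Real.exp (-(D * k / Fintype.card V))) := by nlinarith
    calc ((C.card : ℝ) * M) ^ 2 = (C.card : ℝ) ^ 2 * M ^ 2 := by ring
      _ ≤ 2 * ((A.card : ℝ) ^ 2 * Real.exp (-(D * k / Fintype.card V))) * M ^ 2 :=
          mul_le_mul_of_nonneg_right h1 (sq_nonneg _)
      _ = (A.card : ℝ) ^ 2 * (2 * M ^ 2 * Real.exp (-(D * k / Fintype.card V))) := by ring
      _ < (A.card : ℝ) ^ 2 * 1 := mul_lt_mul_of_pos_left hk (by positivity)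
      _ = _ := by ring
  exact_mod_cast (reach_card_le G C hM).trans_lt hlt

end Separation

/-! ### The upper bound for a fixed number of vertices -/

section UpperBound

variable {V : Type*} [Fintype V]

/-- Two vertices are separated by the symmetric difference of the balls of radius `i` around
them. -/
lemma SmallSpheres.separated {d δ : ℝ} {i : ℕ} {G : SimpleGraph V} (h : SmallSpheres d δ i G)
    (hd2 : 2 ≤ d) (hδ0 : 0 < δ) (hd : (1 + δ) * (1 + 2 / d) ≤ 1 + 2 * δ) {u v : V}
    (huv : (2 - δ) * d ^ i ≤ ((explore G {u, v} i).2.card : ℝ)) :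
    (2 - 6 * δ) * d ^ i ≤ ((Finset.univ.filter fun s => G.edist s u ≠ G.edist s v).card : ℝ) := by
  set Bu := (explore G {u} (i + 1)).1 with hBu
  set Bv := (explore G {v} (i + 1)).1 with hBv
  have hmem : ∀ w s : V, s ∈ (explore G {w} (i + 1)).1 ↔ G.edist s w ≤ (i : ℕ∞) := by
    intro w s
    simp [mem_explore_fst, SimpleGraph.edist_comm]
  have hsub : (Bu \ Bv) ∪ (Bv \ Bu) ⊆ Finset.univ.filter fun s => G.edist s u ≠ G.edist s v := by
    intro s hs
    simp only [Finset.mem_union, Finset.mem_sdiff, hBu, hBv, hmem] at hs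
    simp only [Finset.mem_filter, Finset.mem_univ, true_and]
    intro h'
    rw [h'] at hs
    tauto
  have hdisj : Disjoint (Bu \ Bv) (Bv \ Bu) := by
    refine Finset.disjoint_left.2 fun s hs hs' => ?_
    rw [Finset.mem_sdiff] at hs hs'
    exact hs.2 hs'.1
  have hunion : (explore G {u, v} i).2.card ≤ (Bu ∪ Bv).card := by
    have : Bu ∪ Bv = (explore G {u, v} (i + 1)).1 := by
      rw [explore_fst_eq_biUnion G {u, v}]
      simp [hBu, hBv]
    rw [this, explore_succ_fst]
    exact Finset.card_le_card Finset.subset_union_right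
  have h1 := Finset.card_le_card hsub
  rw [Finset.card_union_of_disjoint hdisj] at h1
  have h2 : (Bu \ Bv).card + Bv.card = (Bu ∪ Bv).card := Finset.card_sdiff_add_card _ _
  have h3 : (Bv \ Bu).card + Bu.card = (Bu ∪ Bv).card := by
    rw [Finset.card_sdiff_add_card, Finset.union_comm]
  have hd0 : 0 < d ^ i := pow_pos (by linarith) i
  have h4 := h.card_ball_le hd2 hδ0 u le_rfl
  have h5 := h.card_ball_le hd2 hδ0 v le_rfl
  have h6 := mul_le_mul_of_nonneg_right hd hd0.le
  have h7 : ((Bu \ Bv).card : ℝ) + ((Bv \ Bu).card : ℝ) ≤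
    ((Finset.univ.filter fun s => G.edist s u ≠ G.edist s v).card : ℝ) := by exact_mod_cast h1
  have h8 : ((Bu \ Bv).card : ℝ) + (Bv.card : ℝ) = ((Bu ∪ Bv).card : ℝ) := by exact_mod_cast h2
  have h9 : ((Bv \ Bu).card : ℝ) + (Bu.card : ℝ) = ((Bu ∪ Bv).card : ℝ) := by exact_mod_cast h3
  have h10 : ((explore G {u, v} i).2.card : ℝ) ≤ ((Bu ∪ Bv).card : ℝ) := by exact_mod_cast hunion
  rw [← hBu] at h4
  rw [← hBv] at h5
  nlinarith

lemma SmallSpheres.reach_card_le {d δ : ℝ} {i : ℕ} {G : SimpleGraph V} (h : SmallSpheres d δ i G)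
    (hd4 : 4 ≤ d) (hδ0 : 0 < δ) (hδ1 : δ ≤ 1 / 3) (hi : 1 ≤ i) (v : V) :
    ((reach G {v}).card : ℝ) ≤ 2 * d := by
  have h1 : reach G {v} ⊆ (explore G {v} 2).1 := by
    intro w hw
    obtain ⟨u, hu, huw⟩ := mem_reach.1 hw
    rw [mem_explore_fst]
    refine ⟨u, hu, ?_⟩
    rcases huw with rfl | huw
    · simp
    · exact (SimpleGraph.edist_eq_one_iff_adj.2 huw).le
  have h2 := h.card_ball_le (by linarith) hδ0 v hi
  have h3 : (2 : ℝ) / d ≤ 1 / 2 := by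
    rw [div_le_div_iff₀ (by linarith) (by norm_num)]; linarith
  have h4 : 0 < 2 / d := div_pos (by norm_num) (by linarith)
  have h5 : (1 + δ) * (1 + 2 / d) ≤ 2 := by nlinarith
  rw [pow_one] at h2
  calc ((reach G {v}).card : ℝ) ≤ ((explore G {v} 2).1.card : ℝ) := by
        exact_mod_cast Finset.card_le_card h1
    _ ≤ (1 + δ) * (1 + 2 / d) * d := h2
    _ ≤ 2 * d := mul_le_mul_of_nonneg_right h5 (by linarith)

/-- With high probability all spheres have at most their natural size and all pairs of spheres are
almost disjoint, so that `localizationNumber_le_of_separated` applies. -/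
lemma prob_lt_localizationNumber_le (p : unitInterval) {d δ θ : ℝ} (hd : d = p * Fintype.card V)
    (hd4 : 4 ≤ d) (hδ0 : 0 < δ) (hδ1 : δ ≤ 1 / 3) (hθ : 0 < θ) {i : ℕ} (hi1 : 1 ≤ i)
    (hi : 4 * d ^ i ≤ Fintype.card V)
    (hC : Real.exp (16 * d ^ i / Fintype.card V) * (1 + 2 * θ / d) ≤ 1 + δ / 4)
    (hdδ : (1 + δ) * (1 + 2 / d) ≤ 1 + 2 * δ) (k : ℕ)
    (hk : 2 * (2 * d) ^ 2 * Real.exp (-((2 - 6 * δ) * d ^ i * k / Fintype.card V)) < 1) :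
    prob p (fun G : SimpleGraph V => k < localizationNumber G) ≤
      Fintype.card V * (i + 1) * Real.exp (-(δ ^ 2 * d / 16)) +
        (Fintype.card V) ^ 2 * Real.exp (-(θ * δ / 2)) := by
  have h1 := prob_not_smallSpheres_le (V := V) p hd (by linarith) hδ0 (by linarith) i
  have h2 := prob_exists_le p (Finset.univ : Finset V).offDiag
    (fun x G => Thin d {x.1, x.2} i G ∧
      ((explore G {x.1, x.2} i).2.card : ℝ) < (2 - δ) * d ^ i)
  have h3 : ∑ x ∈ (Finset.univ : Finset V).offDiag, prob p (fun G => Thin d {x.1, x.2} i G ∧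
      ((explore G {x.1, x.2} i).2.card : ℝ) < (2 - δ) * d ^ i) ≤
      (Fintype.card V) ^ 2 * Real.exp (-(θ * δ / 2)) := by
    refine (Finset.sum_le_card_nsmul _ _ _ fun x hx => prob_thin_front_small_le p
      (Finset.card_pair (Finset.mem_offDiag.1 hx).2.2) hd hd4 hδ0 hθ i hi hC).trans ?_
    rw [nsmul_eq_mul]
    refine mul_le_mul_of_nonneg_right ?_ (Real.exp_pos _).le
    have : (Finset.univ : Finset V).offDiag.card ≤ Fintype.card V ^ 2 := by
      rw [Finset.offDiag_card, Finset.card_univ, sq]; exact Nat.sub_le _ _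
    exact_mod_cast this
  refine (prob_mono p (Q := fun G => ¬ SmallSpheres d δ i G ∨
    ∃ x ∈ (Finset.univ : Finset V).offDiag, Thin d {x.1, x.2} i G ∧
      ((explore G {x.1, x.2} i).2.card : ℝ) < (2 - δ) * d ^ i) fun G hG => ?_).trans
    ((prob_or_le p _ _).trans (add_le_add h1 (h2.trans h3)))
  by_contra hcon
  push Not at hcon
  obtain ⟨hS, hpair⟩ := hcon
  refine absurd hG (not_lt.2 (localizationNumber_le_of_separated G k (fun u v huv => ?_)
    (fun v => hS.reach_card_le hd4 hδ0 hδ1 hi1 v) hk))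
  refine hS.separated (by linarith) hδ0 hdδ (hpair (u, v) (by simpa using huv) ?_)
  exact (hS.thin hd4 hδ0 hδ1 (Finset.card_pair huv).le).mono (by omega)

end UpperBound

/-! ### The lower bound for small edge probabilities -/

section SparseLowerBound

variable {V : Type*} [Fintype V]

lemma card_powersetCard_le (m : ℕ) :
    ((Finset.powersetCard m (Finset.univ : Finset V)).card : ℝ) ≤ (Fintype.card V : ℝ) ^ m := by
  rw [Finset.card_powersetCard, Finset.card_univ]
  exact_mod_cast Nat.choose_le_pow _ _

/-- All distances are at most `i + 1` with high probability. -/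
lemma prob_diam_gt_le (p : unitInterval) {d δ : ℝ} (hd : d = p * Fintype.card V)
    (hd4 : 4 ≤ d) (hδ0 : 0 < δ) (hδ1 : δ ≤ 1 / 3) (i : ℕ) (hi : 4 * d ^ i ≤ Fintype.card V) :
    prob p (fun G : SimpleGraph V => SmallSpheres d δ i G ∧
        ∃ x ∈ (Finset.univ : Finset (V × V)), ¬ G.edist x.1 x.2 ≤ ((i + 1 : ℕ) : ℕ∞)) ≤
      (Fintype.card V) ^ 2 * Real.exp (-(1 / (Real.exp (16 * d ^ i / Fintype.card V) *
        (Fintype.card V / d ^ (i + 1) + 2 / d)))) := by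
  refine (prob_mono p fun G hG => ?_).trans ((prob_exists_le p (Finset.univ : Finset (V × V))
    fun x G => Thin d {x.1} i G ∧ ¬ G.edist x.1 x.2 ≤ ((i + 1 : ℕ) : ℕ∞)).trans ?_)
  · obtain ⟨hS, x, hx, h⟩ := hG
    exact ⟨x, hx, (hS.thin hd4 hδ0 hδ1 (by simp)).mono (by omega), h⟩
  · refine (Finset.sum_le_card_nsmul _ _ _ fun x _ =>
      prob_edist_gt_le p x.1 x.2 hd hd4 i hi).trans (le_of_eq ?_)
    simp [sq]

/-- The vertices outside `A` that are at distance more than `r + 1` from `S` and have a neighbour in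
`A` at distance more than `r` from `S`. -/
noncomputable def farReach (G : SimpleGraph V) (S A : Finset V) (r : ℕ) : Finset V :=
  ((explore G S (r + 1)).1 ∪ A)ᶜ.filter fun w =>
    nbrIn G w (explore G S r).2 = ∅ ∧ ∃ v ∈ A, v ∉ (explore G S (r + 1)).1 ∧ G.Adj w v

lemma cellMean_split (p : unitInterval) {X A : Finset V} (h : Disjoint X A) (c : ℝ) :
    cellMean p (X ∪ A) (fun Z => if Z ∩ X = ∅ ∧ Z ≠ ∅ then c else 1) =
      1 - (1 - (p : ℝ)) ^ X.card * (1 - (1 - (p : ℝ)) ^ A.card) * (1 - c) := by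
  have h1 : cellMean p (X ∪ A) (fun Z => if Z ∩ X = ∅ ∧ Z ≠ ∅ then c else 1) =
      ∑ Z ∈ (X ∪ A).powerset, (cellProb p (X ∪ A) Z -
        (if Z ∩ X = ∅ then cellProb p (X ∪ A) Z else 0) * (1 - c) +
        (if Z = ∅ then cellProb p (X ∪ A) Z else 0) * (1 - c)) := by
    refine Finset.sum_congr rfl fun Z _ => ?_
    by_cases h2 : Z = ∅
    · simp [h2]
    · by_cases h3 : Z ∩ X = ∅ <;> simp only [h2, h3, ne_eq, not_false_iff, and_true, if_true,
        if_false] <;> ring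
  have h2 : ∑ Z ∈ (X ∪ A).powerset, (if Z ∩ X = ∅ then cellProb p (X ∪ A) Z else 0) =
      (1 - (p : ℝ)) ^ X.card := by
    rw [← Finset.sum_filter]
    have h3 : (X ∪ A).powerset.filter (fun Z => Z ∩ X = ∅) = A.powerset := by
      ext Z
      simp only [Finset.mem_filter, Finset.mem_powerset]
      constructor
      · rintro ⟨hZ, hZX⟩ z hz
        rcases Finset.mem_union.1 (hZ hz) with h' | h'
        · have : z ∈ Z ∩ X := Finset.mem_inter.2 ⟨hz, h'⟩
          rw [hZX] at this
          simp at this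
        · exact h'
      · intro hZ
        exact ⟨hZ.trans Finset.subset_union_right,
          Finset.disjoint_iff_inter_eq_empty.1 (h.symm.mono_left hZ)⟩
    rw [h3]
    have h4 : ∀ Z ∈ A.powerset, cellProb p (X ∪ A) Z = (1 - (p : ℝ)) ^ X.card * cellProb p A Z := by
      intro Z hZ
      have := Finset.card_le_card (Finset.mem_powerset.1 hZ)
      rw [cellProb, cellProb, Finset.card_union_of_disjoint h, Nat.add_sub_assoc this, pow_add]
      ring
    rw [Finset.sum_congr rfl h4, ← Finset.mul_sum, sum_cellProb, mul_one]
  have h5 : ∑ Z ∈ (X ∪ A).powerset, (if Z = ∅ then cellProb p (X ∪ A) Z else 0) =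
      (1 - (p : ℝ)) ^ X.card * (1 - (p : ℝ)) ^ A.card := by
    simp [cellProb, Finset.card_union_of_disjoint h, pow_add]
  rw [h1, Finset.sum_add_distrib, Finset.sum_sub_distrib, ← Finset.sum_mul, ← Finset.sum_mul,
    sum_cellProb, h2, h5]
  ring

/-- Given the exploration from `S`, the set `farReach G S A r` is a binomial random set. -/
lemma prob_farReach_small_le (p : unitInterval) (S A : Finset V) (r M : ℕ) (q : ℝ) (hq0 : 0 ≤ q)
    (hq : q ≤ (1 - (p : ℝ)) ^ M * (1 - (1 - (p : ℝ)) ^ (A.card - M))) (N : ℝ)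
    (hN : N + M + A.card ≤ Fintype.card V) :
    prob p (fun G => (explore G S (r + 1)).1.card ≤ M ∧
      ((farReach G S A r).card : ℝ) ≤ N * q / 4) ≤ Real.exp (-(N * q / 4)) := by
  have hpast : PastDetermined S r
      (fun G => if (explore G S (r + 1)).1.card ≤ M then (1 : ℝ) else 0) := by
    intro G G' h
    simp only [explore_succ_fst, h r le_rfl]
    congr
  have hfresh := expect_fresh p hpast (fun x => x.2 ∪ (A \ (x.1 ∪ x.2)))
    (fun x => (x.1 ∪ x.2 ∪ A)ᶜ)
    (fun x => Finset.disjoint_left.2 fun w hw hw' => by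
      simp only [Finset.mem_compl, Finset.mem_union, Finset.mem_sdiff, not_or] at hw hw'
      tauto)
    (fun x hx => Finset.disjoint_left.2 fun w hw hw' => by
      simp only [Finset.mem_union, Finset.mem_sdiff, not_or] at hw'
      rcases hw' with h | h
      · exact Finset.disjoint_left.1 hx hw h
      · exact h.2.1 hw)
    (fun x => Finset.disjoint_left.2 fun w hw hw' => by
      simp only [Finset.mem_compl, Finset.mem_union, not_or] at hw'
      exact hw'.1.1 hw)
    (fun x _ Z => if Z ∩ x.2 = ∅ ∧ Z ≠ ∅ then Real.exp (-1) else 1)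
  have he : Real.exp (-1) ≤ 1 / 2 := by
    rw [Real.exp_neg, ← one_div]
    exact one_div_le_one_div_of_le (by norm_num) (by linarith [Real.add_one_le_exp (1 : ℝ)])
  have hp1 : 0 ≤ 1 - (p : ℝ) := sub_nonneg.2 p.2.2
  have hp2 : 1 - (p : ℝ) ≤ 1 := by linarith [p.2.1]
  have hprod : ∀ G : SimpleGraph V,
      (∏ w ∈ ((explore G S r).1 ∪ (explore G S r).2 ∪ A)ᶜ,
        if nbrIn G w ((explore G S r).2 ∪ (A \ ((explore G S r).1 ∪ (explore G S r).2))) ∩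
            (explore G S r).2 = ∅ ∧
          nbrIn G w ((explore G S r).2 ∪ (A \ ((explore G S r).1 ∪ (explore G S r).2))) ≠ ∅
        then Real.exp (-1) else 1) = Real.exp (-((farReach G S A r).card : ℝ)) := by
    intro G
    rw [Finset.prod_ite]
    simp only [Finset.prod_const, one_pow, mul_one]
    rw [← Real.exp_nat_mul, mul_neg_one]
    congr 4
    refine Finset.filter_congr fun w hw => ?_
    rw [← explore_succ_fst]
    have h1 : nbrIn G w ((explore G S r).2 ∪ A \ (explore G S (r + 1)).1) ∩ (explore G S r).2 =
        nbrIn G w (explore G S r).2 := by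
      ext z
      simp only [nbrIn, Finset.mem_inter, Finset.mem_filter, Finset.mem_union]
      tauto
    rw [h1]
    refine and_congr_right fun h2 => ?_
    rw [← Finset.nonempty_iff_ne_empty]
    constructor
    · rintro ⟨z, hz⟩
      rw [nbrIn, Finset.mem_filter, Finset.mem_union, Finset.mem_sdiff] at hz
      rcases hz with ⟨hz | hz, hwz⟩
      · have : z ∈ nbrIn G w (explore G S r).2 := Finset.mem_filter.2 ⟨hz, hwz⟩
        rw [h2] at this
        simp at this
      · exact ⟨z, hz.1, hz.2, hwz⟩
    · rintro ⟨z, hz1, hz2, hz3⟩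
      refine ⟨z, ?_⟩
      rw [nbrIn, Finset.mem_filter, Finset.mem_union, Finset.mem_sdiff]
      exact ⟨Or.inr ⟨hz1, hz2⟩, hz3⟩
  simp only [hprod] at hfresh
  refine (prob_le_expect p _ (c := Real.exp (N * q / 4))
    (F := fun G => (if (explore G S (r + 1)).1.card ≤ M then 1 else 0) *
      Real.exp (-((farReach G S A r).card : ℝ)))
    (fun G => by positivity) ?_ (Real.exp_pos _).le).trans ?_
  · rintro G ⟨hG1, hG2⟩
    simp only [hG1, if_true, one_mul]
    rw [← Real.exp_add]
    exact Real.one_le_exp (by linarith)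
  · have hbound : expect p (fun G => (if (explore G S (r + 1)).1.card ≤ M then 1 else 0) *
        Real.exp (-((farReach G S A r).card : ℝ))) ≤ Real.exp (-(N * q / 2)) := by
      rw [hfresh, ← expect_const (V := V) p (Real.exp (-(N * q / 2)))]
      refine expect_mono p fun G => ?_
      by_cases hG : (explore G S (r + 1)).1.card ≤ M
      swap
      · simp only [hG, if_false, zero_mul]
        positivity
      simp only [hG, if_true, one_mul]
      have hdisj : Disjoint (explore G S r).2 (A \ ((explore G S r).1 ∪ (explore G S r).2)) :=
        Finset.disjoint_left.2 fun w hw hw' => by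
          simp only [Finset.mem_sdiff, Finset.mem_union, not_or] at hw'
          exact hw'.2.2 hw
      simp only [cellMean_split p hdisj, Finset.prod_const]
      rw [← explore_succ_fst]
      set X := (explore G S r).2
      set A' := A \ (explore G S (r + 1)).1
      have hX : X.card ≤ M := by
        refine le_trans (Finset.card_le_card ?_) hG
        rw [explore_succ_fst]
        exact Finset.subset_union_right
      have hA' : A.card - M ≤ A'.card := by
        have : A.card - (explore G S (r + 1)).1.card ≤ A'.card := Finset.le_card_sdiff _ _
        omega
      have hW : N ≤ ((((explore G S (r + 1)).1 ∪ A)ᶜ.card : ℕ) : ℝ) := by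
        have h1 := Finset.card_union_le (explore G S (r + 1)).1 A
        have h2 := Finset.card_compl_add_card ((explore G S (r + 1)).1 ∪ A)
        have h3 : Fintype.card V ≤ (((explore G S (r + 1)).1 ∪ A)ᶜ.card) + M + A.card := by omega
        have h4 : (Fintype.card V : ℝ) ≤
            ((((explore G S (r + 1)).1 ∪ A)ᶜ.card : ℕ) : ℝ) + M + A.card := by exact_mod_cast h3
        linarith
      have hqX : q ≤ (1 - (p : ℝ)) ^ X.card * (1 - (1 - (p : ℝ)) ^ A'.card) := by
        refine hq.trans (mul_le_mul (pow_le_pow_of_le_one hp1 hp2 hX) ?_ ?_ (by positivity))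
        · linarith [pow_le_pow_of_le_one hp1 hp2 hA']
        · linarith [pow_le_one₀ hp1 hp2 (n := A.card - M)]
      set qX := (1 - (p : ℝ)) ^ X.card * (1 - (1 - (p : ℝ)) ^ A'.card)
      have hqX1 : qX ≤ 1 := by
        refine mul_le_one₀ (pow_le_one₀ hp1 hp2) ?_ ?_
        · linarith [pow_le_one₀ hp1 hp2 (n := A'.card)]
        · linarith [pow_nonneg hp1 A'.card]
      have he0 := Real.exp_pos (-1)
      calc (1 - qX * (1 - Real.exp (-1))) ^ ((explore G S (r + 1)).1 ∪ A)ᶜ.card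
          ≤ (Real.exp (-(qX * (1 - Real.exp (-1))))) ^ ((explore G S (r + 1)).1 ∪ A)ᶜ.card := by
            refine pow_le_pow_left₀ ?_ (Real.one_sub_le_exp_neg _) _
            nlinarith
        _ = Real.exp (-((((explore G S (r + 1)).1 ∪ A)ᶜ.card : ℝ) *
              (qX * (1 - Real.exp (-1))))) := by
            rw [← Real.exp_nat_mul]
            ring_nf
        _ ≤ Real.exp (-(N * (q * (1 / 2)))) := by
            refine Real.exp_le_exp.2 (neg_le_neg ?_)
            refine mul_le_mul hW (mul_le_mul hqX (by linarith) (by norm_num) (by linarith))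
              (by positivity) (by positivity)
        _ = _ := by ring_nf
    refine (mul_le_mul_of_nonneg_right hbound (Real.exp_pos _).le).trans ?_
    rw [← Real.exp_add]
    exact Real.exp_le_exp.2 (by linarith)

/-- The robber evades `m` sensors if, for all `S` and `A`, many vertices can be reached from `A`
while being at the maximal distance `r + 2` from all of `S`. -/
lemma lt_localizationNumber_of_farReach (G : SimpleGraph V) (r m a : ℕ) (hm : m ≤ Fintype.card V)
    (ha2 : 2 ≤ a) (han : a ≤ Fintype.card V)
    (hdiam : ∀ u v : V, G.edist u v ≤ ((r + 2 : ℕ) : ℕ∞))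
    (hfar : ∀ S A : Finset V, S.card = m → A.card = a → a ≤ (farReach G S A r).card) :
    m < localizationNumber G := by
  have hmem : CopsWin G (localizationNumber G) :=
    Nat.sInf_mem (s := {k | CopsWin G k}) ⟨_, copsWin_card G⟩
  by_contra hcon
  push Not at hcon
  refine not_copsWin_of_evasive G _ {A | A.card = a} ?_ (fun A hA => hA.ge.trans' ha2) ?_ hmem
  · obtain ⟨A, -, hA⟩ := Finset.exists_subset_card_eq (s := (Finset.univ : Finset V)) han
    exact ⟨A, hA⟩
  · intro A hA S hS
    obtain ⟨S', hSS', -, hS'⟩ := Finset.exists_subsuperset_card_eq (Finset.subset_univ S)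
      (n := m) (by omega) hm
    obtain ⟨A', hA'sub, hA'⟩ := Finset.exists_subset_card_eq (hfar S' A hS' hA)
    have hdist : ∀ w ∈ A', ∀ s ∈ S', G.edist s w = ((r + 2 : ℕ) : ℕ∞) := by
      intro w hw s hs
      have hw' := hA'sub hw
      rw [farReach, Finset.mem_filter, Finset.mem_compl, Finset.mem_union, not_or] at hw'
      refine le_antisymm (hdiam s w) ?_
      by_contra hlt
      push Not at hlt
      have h1 : G.edist s w ≤ ((r + 1 : ℕ) : ℕ∞) := by
        have : ((r + 2 : ℕ) : ℕ∞) = ((r + 1 : ℕ) : ℕ∞) + 1 := by push_cast; ring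
        rw [this] at hlt
        exact Order.lt_add_one_iff_of_not_isMax (by simp) |>.1 hlt
      have h2 : w ∈ (explore G S' (r + 2)).1 := mem_explore_fst.2 ⟨s, hs, h1⟩
      rw [explore_succ_fst, Finset.mem_union] at h2
      rcases h2 with h2 | h2
      · exact hw'.1.1 h2
      · obtain ⟨u, hu, huw⟩ := (mem_explore_succ_snd.1 h2).2
        have : u ∈ nbrIn G w (explore G S' r).2 := Finset.mem_filter.2 ⟨hu, huw.symm⟩
        rw [hw'.2.1] at this
        simp at this
    refine ⟨A', hA', fun w hw => ?_, fun u hu v hv => ?_⟩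
    · have hw' := hA'sub hw
      rw [farReach, Finset.mem_filter] at hw'
      obtain ⟨-, -, v, hv, -, hwv⟩ := hw'
      exact mem_reach.2 ⟨v, hv, Or.inr hwv.symm⟩
    · funext s
      by_cases hs : s ∈ S
      · simp [signature, hs, hdist u hu s (hSS' hs), hdist v hv s (hSS' hs)]
      · simp [signature, hs]

/-- Union bound over all `S` and `A`: with high probability `farReach` is never small, so that
`lt_localizationNumber_of_farReach` applies. Here `M` bounds the size of the ball of radius `r`
around `S`, and `q` the probability of belonging to `farReach`. -/
lemma prob_localizationNumber_le_sparse (p : unitInterval) {d δ : ℝ} (hd : d = p * Fintype.card V)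
    (hd4 : 4 ≤ d) (hδ0 : 0 < δ) (hδ1 : δ ≤ 1 / 3) (r m a M : ℕ) (hm : m ≤ Fintype.card V)
    (ha2 : 2 ≤ a) (han : a ≤ Fintype.card V) (hi : 4 * d ^ (r + 1) ≤ Fintype.card V)
    (hM : m * ((1 + δ) * (1 + 2 / d) * d ^ r) ≤ M) (q : ℝ) (hq0 : 0 ≤ q)
    (hq : q ≤ (1 - (p : ℝ)) ^ M * (1 - (1 - (p : ℝ)) ^ (a - M))) (N : ℝ)
    (hN : N + M + a ≤ Fintype.card V) (haN : (a : ℝ) ≤ N * q / 4) :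
    prob p (fun G : SimpleGraph V => localizationNumber G ≤ m) ≤
      Fintype.card V * (r + 2) * Real.exp (-(δ ^ 2 * d / 16)) +
      ((Fintype.card V) ^ 2 * Real.exp (-(1 / (Real.exp (16 * d ^ (r + 1) / Fintype.card V) *
        (Fintype.card V / d ^ (r + 2) + 2 / d)))) +
      (Fintype.card V : ℝ) ^ (m + a) * Real.exp (-(N * q / 4))) := by
  have h1 := prob_not_smallSpheres_le (V := V) p hd (by linarith) hδ0 (by linarith) (r + 1)
  have h2 := prob_diam_gt_le (V := V) p hd hd4 hδ0 hδ1 (r + 1) hi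
  have h3 := prob_exists_le p ((Finset.powersetCard m (Finset.univ : Finset V)) ×ˢ
    (Finset.powersetCard a (Finset.univ : Finset V)))
    (fun x G => (explore G x.1 (r + 1)).1.card ≤ M ∧
      ((farReach G x.1 x.2 r).card : ℝ) ≤ N * q / 4)
  have h4 : ∑ x ∈ (Finset.powersetCard m (Finset.univ : Finset V)) ×ˢ
      (Finset.powersetCard a (Finset.univ : Finset V)),
      prob p (fun G => (explore G x.1 (r + 1)).1.card ≤ M ∧
        ((farReach G x.1 x.2 r).card : ℝ) ≤ N * q / 4) ≤
      (Fintype.card V : ℝ) ^ (m + a) * Real.exp (-(N * q / 4)) := by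
    refine (Finset.sum_le_card_nsmul _ _ (Real.exp (-(N * q / 4))) fun x hx => ?_).trans ?_
    · rw [Finset.mem_product, Finset.mem_powersetCard, Finset.mem_powersetCard] at hx
      exact prob_farReach_small_le p x.1 x.2 r M q hq0 (by rw [hx.2.2]; exact hq) N
        (by rw [hx.2.2]; exact hN)
    · rw [nsmul_eq_mul, Finset.card_product, Nat.cast_mul, pow_add]
      exact mul_le_mul_of_nonneg_right (mul_le_mul (card_powersetCard_le m) (card_powersetCard_le a)
        (by positivity) (by positivity)) (Real.exp_pos _).le
  have hcast : (Fintype.card V : ℝ) * (((r + 1 : ℕ) : ℝ) + 1) * Real.exp (-(δ ^ 2 * d / 16)) =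
      Fintype.card V * (r + 2) * Real.exp (-(δ ^ 2 * d / 16)) := by push_cast; ring
  rw [hcast] at h1
  refine (prob_mono p fun G hG => ?_).trans ((prob_or_le p _ _).trans (add_le_add h1
    ((prob_or_le p _ _).trans (add_le_add h2 (h3.trans h4)))))
  by_contra hcon
  rw [not_or, not_or, not_not] at hcon
  obtain ⟨hS, hdiam, hfar⟩ := hcon
  refine absurd hG (not_le.2 (lt_localizationNumber_of_farReach G r m a hm ha2 han
    (fun u v => ?_) fun S A hSm hAa => ?_))
  · by_contra huv
    exact hdiam ⟨hS, (u, v), Finset.mem_univ _, huv⟩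
  · by_contra hlt
    push Not at hlt
    refine hfar ⟨(S, A), by simp [hSm, hAa], ?_, ?_⟩
    · have hball := card_explore_fst_le G S (r + 1) fun v =>
        hS.card_ball_le (by linarith) hδ0 v (show r ≤ r + 1 by omega)
      rw [hSm] at hball
      exact_mod_cast hball.trans hM
    · have : ((farReach G S A r).card : ℝ) ≤ a := by exact_mod_cast hlt.le
      linarith

end SparseLowerBound

/-! ### The lower bound for large edge probabilities -/

section DenseLowerBound

variable {V : Type*} [Fintype V]

lemma exp_neg_two_mul_le {p : ℝ} (hp : 0 ≤ p) : Real.exp (-(2 * p)) ≤ p ^ 2 + (1 - p) ^ 2 := by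
  have h1 := Real.quadratic_le_exp_of_nonneg (x := 2 * p) (by linarith)
  rw [Real.exp_neg]
  refine inv_le_of_inv_le₀ (by nlinarith [sq_nonneg p, sq_nonneg (1 - p)]) (le_trans ?_ h1)
  rw [inv_le_iff_one_le_mul₀ (by nlinarith [sq_nonneg p, sq_nonneg (1 - p)])]
  nlinarith [sq_nonneg (p ^ 2), sq_nonneg p]

/-- The collision probability of two independent `p`-random subsets of `Y`. -/
lemma sum_cellProb_sq (p : unitInterval) (Y : Finset V) :
    ∑ Z ∈ Y.powerset, cellProb p Y Z ^ 2 = ((p : ℝ) ^ 2 + (1 - p) ^ 2) ^ Y.card := by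
  rw [← Finset.sum_pow_mul_eq_add_pow]
  refine Finset.sum_congr rfl fun Z _ => ?_
  rw [cellProb, mul_pow, ← pow_mul, ← pow_mul, ← pow_mul, ← pow_mul, mul_comm 2, mul_comm 2]

/-- The empty set is the most likely value of a `p`-random set with `p ≤ 1 / 2`. -/
lemma cellProb_le (p : unitInterval) (hp : (p : ℝ) ≤ 1 / 2) {Y Z : Finset V} (hZ : Z ⊆ Y) :
    cellProb p Y Z ≤ Real.exp (-(p * Y.card)) := by
  have h1 : (p : ℝ) ^ Z.card ≤ (1 - (p : ℝ)) ^ Z.card := pow_le_pow_left₀ p.2.1 (by linarith) _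
  have h2 : cellProb p Y Z ≤ (1 - (p : ℝ)) ^ Y.card := by
    calc cellProb p Y Z ≤ (1 - (p : ℝ)) ^ Z.card * (1 - (p : ℝ)) ^ (Y.card - Z.card) :=
          mul_le_mul_of_nonneg_right h1 (pow_nonneg (sub_nonneg.2 p.2.2) _)
      _ = _ := by rw [← pow_add, Nat.add_sub_cancel' (Finset.card_le_card hZ)]
  refine h2.trans ?_
  have h3 := pow_le_pow_left₀ (sub_nonneg.2 p.2.2) (Real.one_sub_le_exp_neg (p : ℝ)) Y.card
  rw [← Real.exp_nat_mul] at h3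
  rwa [show -((p : ℝ) * Y.card) = Y.card * -(p : ℝ) by ring]

/-- Laplace transform of the probability of the cell of a random set, obtained from its mean, the
collision probability `(p² + (1 - p)²) ^ |Y| ≥ exp (-2 p |Y|)`, and its maximum. -/
lemma cellMean_exp_neg_le (p : unitInterval) (hp : (p : ℝ) ≤ 1 / 2) (Y : Finset V) {D : ℝ}
    (hD : 0 ≤ D) :
    cellMean p Y (fun Z => Real.exp (-(D * cellProb p Y Z))) ≤
      Real.exp (-(D * Real.exp (-(p * Y.card)) ^ 2 / (1 + D * Real.exp (-(p * Y.card))))) := by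
  set t := Real.exp (-((p : ℝ) * Y.card)) with ht
  have ht0 : 0 < t := Real.exp_pos _
  have hsq : t ^ 2 ≤ ∑ Z ∈ Y.powerset, cellProb p Y Z ^ 2 := by
    rw [sum_cellProb_sq]
    refine le_trans (le_of_eq ?_)
      (pow_le_pow_left₀ (Real.exp_pos _).le (exp_neg_two_mul_le p.2.1) Y.card)
    rw [ht, ← Real.exp_nat_mul, ← Real.exp_nat_mul]
    congr 1
    push_cast
    ring
  have h1 : cellMean p Y (fun Z => Real.exp (-(D * cellProb p Y Z))) ≤
      ∑ Z ∈ Y.powerset, (cellProb p Y Z - cellProb p Y Z ^ 2 * (D / (1 + D * t))) := by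
    refine Finset.sum_le_sum fun Z hZ => ?_
    have hπ := cellProb_le p hp (Finset.mem_powerset.1 hZ)
    rw [← ht] at hπ
    have hπ0 := cellProb_nonneg p Y Z
    set π := cellProb p Y Z
    have h2 : Real.exp (-(D * π)) ≤ 1 / (1 + D * π) := by
      rw [Real.exp_neg, ← one_div]
      exact one_div_le_one_div_of_le (by positivity) (by linarith [Real.add_one_le_exp (D * π)])
    have h3 : 1 / (1 + D * π) = 1 - π * (D / (1 + D * π)) := by field_simp; ring
    have h4 : D / (1 + D * t) ≤ D / (1 + D * π) := by gcongr
    calc π * Real.exp (-(D * π)) ≤ π * (1 - π * (D / (1 + D * t))) := by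
          refine mul_le_mul_of_nonneg_left ?_ hπ0
          rw [h3] at h2
          linarith [mul_le_mul_of_nonneg_left h4 hπ0]
      _ = _ := by ring
  refine h1.trans ?_
  rw [Finset.sum_sub_distrib, sum_cellProb, ← Finset.sum_mul]
  refine le_trans ?_ (Real.one_sub_le_exp_neg _)
  have h5 : 0 ≤ D / (1 + D * t) := by positivity
  have h6 := mul_le_mul_of_nonneg_right hsq h5
  have h7 : D * t ^ 2 / (1 + D * t) = t ^ 2 * (D / (1 + D * t)) := by ring
  linarith

/-- A birthday-type estimate: if the vertices of two disjoint sets of size `D` all have different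
neighbourhoods inside `Y`, then those of the second set avoid the neighbourhoods realized by the
first set, whose total probability is a sum of independent terms. -/
lemma expect_no_collision_le (p : unitInterval) (hp : (p : ℝ) ≤ 1 / 2) {H : SimpleGraph V → ℝ}
    (hH0 : ∀ G, 0 ≤ H G) (W₁ W₂ Y : Finset V) (h12 : Disjoint W₁ W₂) (h1 : Disjoint W₁ Y)
    (h2 : Disjoint W₂ Y) (D : ℕ) (hD1 : W₁.card = D) (hD2 : W₂.card = D)
    (hH : DeterminedBy (fun x y => ¬ (x ∈ W₁ ∪ W₂ ∧ y ∈ Y) ∧ ¬ (y ∈ W₁ ∪ W₂ ∧ x ∈ Y)) H) :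
    expect p (fun G => H G *
      if ∀ y ∈ W₁ ∪ W₂, ∀ z ∈ W₁ ∪ W₂, nbrIn G y Y = nbrIn G z Y → y = z then 1 else 0) ≤
      expect p H * Real.exp (-((D * Real.exp (-(p * Y.card))) ^ 2 /
        (1 + D * Real.exp (-(p * Y.card))))) := by
  set r : SimpleGraph V → V → Finset V := fun G w => if w ∈ W₁ then nbrIn G w Y else ∅ with hr
  set F : SimpleGraph V → ℝ := fun G => H G * if Set.InjOn (r G) W₁ then 1 else 0 with hF
  have hrdet : DeterminedBy (fun x y => ¬ (x ∈ W₂ ∧ y ∈ Y) ∧ ¬ (y ∈ W₂ ∧ x ∈ Y)) r := by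
    intro G G' h
    funext w
    by_cases hw : w ∈ W₁
    · simp only [hr, hw, if_true]
      refine Finset.filter_congr fun z hz => h w z ⟨?_, ?_⟩
      · exact fun h' => Finset.disjoint_left.1 h12 hw h'.1
      · exact fun h' => Finset.disjoint_left.1 h1 hw h'.2
    · simp [hr, hw]
  have hA := expect_condition p r (F := F) (fun _ => Y) (fun _ => W₂) (fun _ => h2)
    (fun a G G' h => by
      have e1 := hrdet G G' h
      have e2 : H G = H G' := by
        refine hH G G' fun x y hxy => h x y ?_
        simp only [Finset.mem_union] at hxy
        tauto
      simp only [hF, e1, e2]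
      congr)
    (fun a _ Z => if Z ∈ W₁.image a then 0 else 1)
  have hstep1 : expect p (fun G => H G *
      if ∀ y ∈ W₁ ∪ W₂, ∀ z ∈ W₁ ∪ W₂, nbrIn G y Y = nbrIn G z Y → y = z then 1 else 0) ≤
      expect p (fun G => F G * ∏ w ∈ W₂, if nbrIn G w Y ∈ W₁.image (r G) then 0 else 1) := by
    refine expect_mono p fun G => ?_
    by_cases hG : ∀ y ∈ W₁ ∪ W₂, ∀ z ∈ W₁ ∪ W₂, nbrIn G y Y = nbrIn G z Y → y = z
    · rw [if_pos hG]
      have e1 : Set.InjOn (r G) W₁ := by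
        intro y hy z hz hyz
        rw [Finset.mem_coe] at hy hz
        simp only [hr, hy, hz, if_true] at hyz
        exact hG y (Finset.mem_union_left _ hy) z (Finset.mem_union_left _ hz) hyz
      have e2 : ∏ w ∈ W₂, (if nbrIn G w Y ∈ W₁.image (r G) then (0 : ℝ) else 1) = 1 := by
        refine Finset.prod_eq_one fun w hw => if_neg fun hmem => ?_
        obtain ⟨y, hy, hyw⟩ := Finset.mem_image.1 hmem
        simp only [hr, hy, if_true] at hyw
        have := hG y (Finset.mem_union_left _ hy) w (Finset.mem_union_right _ hw) hyw
        exact Finset.disjoint_left.1 h12 hy (this ▸ hw)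
      rw [e2]
      simp [hF, e1]
    · rw [if_neg hG, mul_zero]
      refine mul_nonneg (mul_nonneg (hH0 G) (by positivity)) (Finset.prod_nonneg fun w _ => ?_)
      positivity
  have hstep2 : expect p (fun G => F G * ∏ w ∈ W₂,
      cellMean p Y (fun Z => if Z ∈ W₁.image (r G) then 0 else 1)) ≤
      expect p (fun G => H G * ∏ w ∈ W₁, Real.exp (-(D * cellProb p Y (nbrIn G w Y)))) := by
    refine expect_mono p fun G => ?_
    by_cases hG : Set.InjOn (r G) W₁
    swap
    · simp only [hF, hG, if_false, mul_zero, zero_mul]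
      exact mul_nonneg (hH0 G) (Finset.prod_nonneg fun w _ => (Real.exp_pos _).le)
    simp only [hF, hG, if_true, mul_one, Finset.prod_const, hD2]
    refine mul_le_mul_of_nonneg_left ?_ (hH0 G)
    have e1 : cellMean p Y (fun Z => if Z ∈ W₁.image (r G) then 0 else 1) =
        1 - ∑ w ∈ W₁, cellProb p Y (nbrIn G w Y) := by
      have e2 : ∑ Z ∈ Y.powerset, (if Z ∈ W₁.image (r G) then cellProb p Y Z else 0) =
          ∑ w ∈ W₁, cellProb p Y (nbrIn G w Y) := by
        rw [← Finset.sum_filter]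
        have e3 : Y.powerset.filter (fun Z => Z ∈ W₁.image (r G)) = W₁.image (r G) := by
          ext Z
          rw [Finset.mem_filter, Finset.mem_powerset, and_iff_right_iff_imp]
          intro hZ
          obtain ⟨w, hw, rfl⟩ := Finset.mem_image.1 hZ
          simp only [hr, hw, if_true]
          exact nbrIn_subset G w Y
        rw [e3, Finset.sum_image hG]
        exact Finset.sum_congr rfl fun w hw => by simp only [hr, hw, if_true]
      rw [eq_sub_iff_add_eq, ← e2, cellMean, ← Finset.sum_add_distrib]
      refine (Finset.sum_congr rfl fun Z _ => ?_).trans (sum_cellProb p Y)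
      by_cases hZ : Z ∈ W₁.image (r G) <;> simp [hZ]
    have e4 : 0 ≤ cellMean p Y (fun Z => if Z ∈ W₁.image (r G) then (0 : ℝ) else 1) :=
      Finset.sum_nonneg fun Z _ => mul_nonneg (cellProb_nonneg p Y Z) (by positivity)
    calc cellMean p Y (fun Z => if Z ∈ W₁.image (r G) then (0 : ℝ) else 1) ^ D
        ≤ Real.exp (-∑ w ∈ W₁, cellProb p Y (nbrIn G w Y)) ^ D := by
          refine pow_le_pow_left₀ e4 ?_ D
          rw [e1]
          exact Real.one_sub_le_exp_neg _
      _ = ∏ w ∈ W₁, Real.exp (-(D * cellProb p Y (nbrIn G w Y))) := by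
          rw [← Real.exp_nat_mul, ← Real.exp_sum]
          congr 1
          rw [Finset.sum_neg_distrib, ← Finset.mul_sum]
          ring
  have hB := expect_prod_nbrIn p (F := H) Y W₁ h1
    (hH.mono fun x y hxy => by simp only [Finset.mem_union] at hxy; tauto)
    (fun _ Z => Real.exp (-(D * cellProb p Y Z)))
  refine hstep1.trans ((hA.le.trans hstep2).trans (hB.le.trans ?_))
  refine mul_le_mul_of_nonneg_left ?_ (expect_nonneg p hH0)
  rw [Finset.prod_const, hD1]
  refine (pow_le_pow_left₀ (Finset.sum_nonneg fun Z _ => mul_nonneg (cellProb_nonneg p Y Z)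
    (Real.exp_pos _).le) (cellMean_exp_neg_le p hp Y (Nat.cast_nonneg D)) D).trans (le_of_eq ?_)
  rw [← Real.exp_nat_mul]
  congr 1
  ring

/-- Two neighbours of `x` outside `S` are adjacent to the same vertices of `S`. -/
def Collides (G : SimpleGraph V) (x : V) (S : Finset V) : Prop :=
  ∃ y ∈ (explore G {x} 1).2 \ S, ∃ z ∈ (explore G {x} 1).2 \ S, y ≠ z ∧
    nbrIn G y (S \ {x}) = nbrIn G z (S \ {x})

/-- If `x` has at least `2 D` neighbours outside `S`, they fail to collide only with small
probability: the expected number of collisions is at least of order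
`(D exp (-p |S|)) ^ 2`. -/
lemma prob_not_collides_le (p : unitInterval) (hp : (p : ℝ) ≤ 1 / 2) (x : V) (S : Finset V)
    (D : ℕ) {u : ℝ} (hu1 : 1 ≤ u) (hu : u ≤ D * Real.exp (-(p * S.card))) :
    prob p (fun G => 2 * D + S.card ≤ (explore G {x} 1).2.card ∧ ¬ Collides G x S) ≤
      Real.exp (-(u / 2)) := by
  have hsplit : ∀ X : Finset V × Finset V, ∃ W : Finset V × Finset V,
      2 * D + S.card ≤ X.2.card → W.1 ⊆ X.2 \ S ∧ W.2 ⊆ X.2 \ S ∧ Disjoint W.1 W.2 ∧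
        W.1.card = D ∧ W.2.card = D := by
    intro X
    by_cases hX : 2 * D + S.card ≤ X.2.card
    · have h1 : X.2.card - S.card ≤ (X.2 \ S).card := Finset.le_card_sdiff _ _
      obtain ⟨W₁, hW₁, hc₁⟩ := Finset.exists_subset_card_eq (s := X.2 \ S) (n := D) (by omega)
      have h2 : ((X.2 \ S) \ W₁).card = (X.2 \ S).card - W₁.card := Finset.card_sdiff_of_subset hW₁
      obtain ⟨W₂, hW₂, hc₂⟩ := Finset.exists_subset_card_eq (s := (X.2 \ S) \ W₁) (n := D)
        (by omega)
      refine ⟨(W₁, W₂), fun _ => ⟨hW₁, hW₂.trans Finset.sdiff_subset, ?_, hc₁, hc₂⟩⟩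
      exact Finset.disjoint_left.2 fun w hw hw' => (Finset.mem_sdiff.1 (hW₂ hw')).2 hw
    · exact ⟨(∅, ∅), fun h => absurd h hX⟩
  choose W hW using hsplit
  set Y := S \ {x} with hY
  have hfst : ∀ G : SimpleGraph V, (explore G {x} 1).1 = {x} := fun G => by simp [explore]
  have hpart : ∀ Q : SimpleGraph V → ℝ, expect p Q = ∑ X : Finset V × Finset V,
      expect p (fun G => Q G * if explore G {x} 1 = X then 1 else 0) := by
    intro Q
    rw [← expect_sum]
    congr 1
    funext G
    rw [Finset.sum_eq_single (explore G {x} 1)]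
    · simp
    · intro X _ hX
      simp [hX.symm]
    · simp
  set F : SimpleGraph V → ℝ := fun G => if 2 * D + S.card ≤ (explore G {x} 1).2.card then 1 else 0
    with hF
  have hpast : PastDetermined {x} 1 F := by
    intro G G' h
    simp only [hF, h 1 le_rfl]
  have hF1 : expect p F ≤ 1 := by
    rw [← expect_const (V := V) p 1]
    refine expect_mono p fun G => ?_
    simp only [hF]
    split_ifs <;> norm_num
  obtain ⟨P, hP⟩ : ∃ P : SimpleGraph V → Prop, P = fun G =>
    2 * D + S.card ≤ (explore G {x} 1).2.card ∧ ¬ Collides G x S := ⟨_, rfl⟩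
  have key : ∀ X : Finset V × Finset V,
      expect p (fun G => (if P G then 1 else 0) * if explore G {x} 1 = X then 1 else 0) ≤
      expect p (fun G => F G * if explore G {x} 1 = X then 1 else 0) * Real.exp (-(u / 2)) := by
    intro X
    have hnn : ∀ G, 0 ≤ F G * if explore G {x} 1 = X then 1 else 0 := fun G => by
      simp only [hF]; positivity
    by_cases hX : 2 * D + S.card ≤ X.2.card ∧ X.1 = {x} ∧ Disjoint X.1 X.2
    swap
    · refine le_trans (le_of_eq ?_) (mul_nonneg (expect_nonneg p hnn) (Real.exp_pos _).le)
      refine Eq.trans (congrArg (expect p) (funext fun G => ?_)) (expect_const (V := V) p 0)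
      by_cases hG : explore G {x} 1 = X
      · have : ¬ 2 * D + S.card ≤ (explore G {x} 1).2.card := fun h => hX
          ⟨hG ▸ h, hG ▸ hfst G, hG ▸ disjoint_explore G {x} 1⟩
        simp [hP, this]
      · simp [hG]
    obtain ⟨hX1, hX2, hX3⟩ := hX
    obtain ⟨hWa, hWb, hWd, hca, hcb⟩ := hW X hX1
    have hdisjY : ∀ W' ⊆ X.2 \ S, Disjoint W' Y := fun W' h => Finset.disjoint_left.2
      fun w hw hw' => (Finset.mem_sdiff.1 (h hw)).2 (Finset.mem_sdiff.1 hw').1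
    have hunion : (W X).1 ∪ (W X).2 ⊆ X.2 \ S := Finset.union_subset hWa hWb
    have hdet : DeterminedBy (fun a b => ¬ (a ∈ (W X).1 ∪ (W X).2 ∧ b ∈ Y) ∧
        ¬ (b ∈ (W X).1 ∪ (W X).2 ∧ a ∈ Y)) fun G => F G * if explore G {x} 1 = X then 1 else 0 := by
      refine hpast.determinedBy X ?_ ?_
      · rw [hX2, hY]
        exact Finset.disjoint_left.2 fun w hw hw' => (Finset.mem_sdiff.1 hw').2 hw
      · exact hX3.mono_right (hunion.trans Finset.sdiff_subset)
    have hcol := expect_no_collision_le p hp hnn (W X).1 (W X).2 Y hWd (hdisjY _ hWa)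
      (hdisjY _ hWb) D hca hcb hdet
    refine (expect_mono p fun G => ?_).trans (hcol.trans
      (mul_le_mul_of_nonneg_left (Real.exp_le_exp.2 (neg_le_neg ?_)) (expect_nonneg p hnn)))
    · by_cases hG : explore G {x} 1 = X
      swap
      · simp [hG]
      by_cases hc : Collides G x S
      · simp only [hP, hc, not_true, and_false, if_false, zero_mul]
        exact mul_nonneg (hnn G) (by positivity)
      · have hinj : ∀ y ∈ (W X).1 ∪ (W X).2, ∀ z ∈ (W X).1 ∪ (W X).2,
            nbrIn G y Y = nbrIn G z Y → y = z := by
          intro y hy z hz hyz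
          by_contra hne
          exact hc ⟨y, hG ▸ hunion hy, z, hG ▸ hunion hz, hne, hyz⟩
        rw [if_pos hinj]
        simp [hF, hP, hc]
    · have hYS : (Y.card : ℝ) ≤ S.card := by
        exact_mod_cast Finset.card_le_card Finset.sdiff_subset
      have h5 : u ≤ D * Real.exp (-(p * Y.card)) := by
        refine hu.trans (mul_le_mul_of_nonneg_left (Real.exp_le_exp.2 (neg_le_neg ?_))
          (Nat.cast_nonneg D))
        exact mul_le_mul_of_nonneg_left hYS p.2.1
      rw [le_div_iff₀ (by linarith)]
      nlinarith
  rw [← hP, prob, hpart]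
  refine (Finset.sum_le_sum fun X _ => key X).trans ?_
  rw [← Finset.sum_mul, ← hpart]
  exact mul_le_of_le_one_left (Real.exp_pos _).le hF1

lemma mem_explore_one {G : SimpleGraph V} {x y : V} : y ∈ (explore G {x} 1).2 ↔ G.Adj x y := by
  rw [mem_explore_succ_snd]
  simp only [explore, Finset.empty_union, Finset.mem_singleton, exists_eq_left,
    and_iff_right_iff_imp]
  exact fun h => h.ne'

/-- The robber evades `m` sensors in a graph of diameter two if every neighbourhood contains two
vertices that `m` sensors cannot tell apart. -/
lemma lt_localizationNumber_of_collides (G : SimpleGraph V) (m : ℕ) (hm : m ≤ Fintype.card V)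
    (hV : 2 ≤ Fintype.card V) (hdiam : ∀ u v : V, G.edist u v ≤ ((2 : ℕ) : ℕ∞))
    (hcol : ∀ x S, S.card = m → Collides G x S) : m < localizationNumber G := by
  have hmem : CopsWin G (localizationNumber G) :=
    Nat.sInf_mem (s := {k | CopsWin G k}) ⟨_, copsWin_card G⟩
  by_contra hcon
  push Not at hcon
  refine not_copsWin_of_evasive G _ {A | A.card = 2} ?_ (fun A hA => hA.ge) ?_ hmem
  · obtain ⟨A, -, hA⟩ := Finset.exists_subset_card_eq (s := (Finset.univ : Finset V)) hV
    exact ⟨A, hA⟩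
  · intro A hA S hS
    obtain ⟨S', hSS', -, hS'⟩ := Finset.exists_subsuperset_card_eq (Finset.subset_univ S)
      (n := m) (by omega) hm
    obtain ⟨x, hx⟩ : A.Nonempty := Finset.card_pos.1 (by rw [hA]; norm_num)
    obtain ⟨y, hy, z, hz, hyz, hnb⟩ := hcol x S' hS'
    rw [Finset.mem_sdiff, mem_explore_one] at hy hz
    have hdist : ∀ w, G.Adj x w → w ∉ S' → ∀ s ∈ S', G.edist s w =
        if s = x ∨ s ∈ nbrIn G w (S' \ {x}) then 1 else 2 := by
      intro w hxw hw s hs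
      by_cases h : s = x ∨ s ∈ nbrIn G w (S' \ {x})
      · rw [if_pos h, SimpleGraph.edist_eq_one_iff_adj]
        rcases h with rfl | h
        · exact hxw
        · exact (Finset.mem_filter.1 h).2.symm
      · rw [if_neg h]
        rw [not_or] at h
        refine le_antisymm (hdiam s w) ?_
        by_contra hlt
        push Not at hlt
        have h1 : G.edist s w ≤ 1 := by
          have : (2 : ℕ∞) = 1 + 1 := by norm_num
          rw [this] at hlt
          exact Order.lt_add_one_iff_of_not_isMax (by simp) |>.1 hlt
        rcases h1.lt_or_eq with h2 | h2
        · rw [Order.lt_one_iff, SimpleGraph.edist_eq_zero_iff] at h2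
          exact hw (h2 ▸ hs)
        · rw [SimpleGraph.edist_eq_one_iff_adj] at h2
          exact h.2 (Finset.mem_filter.2 ⟨Finset.mem_sdiff.2 ⟨hs, by simpa using h.1⟩, h2.symm⟩)
    have hsig : signature G S y = signature G S z := by
      funext s
      by_cases hs : s ∈ S
      · simp only [signature, hs, if_true]
        rw [hdist y hy.1 hy.2 s (hSS' hs), hdist z hz.1 hz.2 s (hSS' hs), hnb]
      · simp [signature, hs]
    refine ⟨{y, z}, Finset.card_pair hyz, fun w hw => ?_, fun a ha b hb => ?_⟩
    · rw [Finset.mem_insert, Finset.mem_singleton] at hw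
      rcases hw with rfl | rfl
      · exact mem_reach.2 ⟨x, hx, Or.inr hy.1⟩
      · exact mem_reach.2 ⟨x, hx, Or.inr hz.1⟩
    · rw [Finset.mem_insert, Finset.mem_singleton] at ha hb
      rcases ha with rfl | rfl <;> rcases hb with rfl | rfl <;> simp [hsig]

/-- Union bound over all `x` and `S`: with high probability every neighbourhood contains a collision, so
that `lt_localizationNumber_of_collides` applies. -/
lemma prob_localizationNumber_le_dense (p : unitInterval) (hp : (p : ℝ) ≤ 1 / 2) {d δ : ℝ}
    (hd : d = p * Fintype.card V) (hd4 : 4 ≤ d) (hδ0 : 0 < δ) (hδ1 : δ ≤ 1 / 3) (m D : ℕ)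
    (hm : m ≤ Fintype.card V) (hi : 32 * d ≤ Fintype.card V)
    (hD : ((2 * D + m : ℕ) : ℝ) ≤ d / 8) {u : ℝ} (hu1 : 1 ≤ u)
    (hu : u ≤ D * Real.exp (-(p * m))) :
    prob p (fun G : SimpleGraph V => localizationNumber G ≤ m) ≤
      Fintype.card V * 2 * Real.exp (-(δ ^ 2 * d / 16)) +
      ((Fintype.card V) ^ 2 * Real.exp (-(1 / (Real.exp (16 * d ^ 1 / Fintype.card V) *
        (Fintype.card V / d ^ 2 + 2 / d)))) +
      (Fintype.card V * Real.exp (-(d / 8)) +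
        (Fintype.card V : ℝ) ^ (m + 1) * Real.exp (-(u / 2)))) := by
  have h1 := prob_not_smallSpheres_le (V := V) p hd (by linarith) hδ0 (by linarith) 1
  have h2 := prob_diam_gt_le (V := V) p hd hd4 hδ0 hδ1 1 (by rw [pow_one]; linarith)
  have h3 := prob_exists_le p (Finset.univ : Finset V)
    (fun x G => ((explore G {x} 1).2.card : ℝ) < d / 8)
  have h3' : ∑ x : V, prob p (fun G => ((explore G {x} 1).2.card : ℝ) < d / 8) ≤
      Fintype.card V * Real.exp (-(d / 8)) := by
    refine (Finset.sum_le_card_nsmul _ _ _ fun x _ =>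
      prob_low_degree_le p x hd hd4 hi).trans (le_of_eq ?_)
    simp
  have h4 := prob_exists_le p ((Finset.powersetCard m (Finset.univ : Finset V)) ×ˢ
    (Finset.univ : Finset V))
    (fun x G => 2 * D + x.1.card ≤ (explore G {x.2} 1).2.card ∧ ¬ Collides G x.2 x.1)
  have h4' : ∑ x ∈ (Finset.powersetCard m (Finset.univ : Finset V)) ×ˢ (Finset.univ : Finset V),
      prob p (fun G => 2 * D + x.1.card ≤ (explore G {x.2} 1).2.card ∧ ¬ Collides G x.2 x.1) ≤
      (Fintype.card V : ℝ) ^ (m + 1) * Real.exp (-(u / 2)) := by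
    refine (Finset.sum_le_card_nsmul _ _ (Real.exp (-(u / 2))) fun x hx => ?_).trans ?_
    · rw [Finset.mem_product, Finset.mem_powersetCard] at hx
      exact prob_not_collides_le p hp x.2 x.1 D hu1 (by rw [hx.1.2]; exact hu)
    · rw [nsmul_eq_mul, Finset.card_product, Nat.cast_mul, pow_succ, Finset.card_univ]
      exact mul_le_mul_of_nonneg_right (mul_le_mul_of_nonneg_right (card_powersetCard_le m)
        (by positivity)) (Real.exp_pos _).le
  have hcast : (Fintype.card V : ℝ) * (((1 : ℕ) : ℝ) + 1) * Real.exp (-(δ ^ 2 * d / 16)) =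
      Fintype.card V * 2 * Real.exp (-(δ ^ 2 * d / 16)) := by norm_num
  rw [hcast] at h1
  refine (prob_mono p fun G hG => ?_).trans ((prob_or_le p _ _).trans (add_le_add h1
    ((prob_or_le p _ _).trans (add_le_add h2 ((prob_or_le p _ _).trans
      (add_le_add (h3.trans h3') (h4.trans h4')))))))
  by_contra hcon
  rw [not_or, not_or, not_or, not_not] at hcon
  obtain ⟨hS, hdiam, hdeg, hcol⟩ := hcon
  refine absurd hG (not_le.2 (lt_localizationNumber_of_collides G m hm ?_ (fun u v => ?_)
    fun x S hSm => ?_))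
  · have : (2 : ℝ) ≤ Fintype.card V := by linarith
    exact_mod_cast this
  · by_contra huv
    exact hdiam ⟨hS, (u, v), Finset.mem_univ _, huv⟩
  · by_contra hc
    refine hcol ⟨(S, x), by simp [hSm], ?_, hc⟩
    by_contra hlt
    refine hdeg ⟨x, Finset.mem_univ _, ?_⟩
    push Not at hlt
    rw [hSm] at hlt
    have : ((explore G {x} 1).2.card : ℝ) < ((2 * D + m : ℕ) : ℝ) := by exact_mod_cast hlt
    linarith

end DenseLowerBound

/-! ### The error terms for large `n` -/

section Parameters

lemma natCast_pow_mul_exp_le {n : ℕ} (hn : 1 ≤ n) {k : ℕ} {x : ℝ}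
    (h : (k + 1) * Real.log n ≤ x) : (n : ℝ) ^ k * Real.exp (-x) ≤ 1 / n := by
  have hn0 : (0 : ℝ) < n := by exact_mod_cast hn
  have h1 : (n : ℝ) ^ k = Real.exp (k * Real.log n) := by
    rw [Real.exp_nat_mul, Real.exp_log hn0]
  have h2 : 1 / (n : ℝ) = Real.exp (-Real.log n) := by
    rw [Real.exp_neg, Real.exp_log hn0, one_div]
  rw [h1, h2, ← Real.exp_add]
  exact Real.exp_le_exp.2 (by linarith)

/-- The choice `δ = 8 √(log n / d)` of the relative error in the sizes of the spheres. -/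
lemma exists_sphere_error {L d : ℝ} (hL : 1 ≤ L) (hd : 1000 * L ≤ d) :
    ∃ δ : ℝ, 0 < δ ∧ δ ≤ 1 / 3 ∧ δ ^ 2 * d / 16 = 4 * L ∧ (1 + δ) * (1 + 2 / d) ≤ 1 + 2 * δ ∧
      (L ^ 3 ≤ d → δ * L ≤ 8) := by
  have hd0 : 0 < d := by linarith
  have hsq : (8 * √(L / d)) ^ 2 = 64 * (L / d) := by
    rw [mul_pow, Real.sq_sqrt (by positivity)]; norm_num
  have hpos : 0 < 8 * √(L / d) := by positivity
  have h1 : 8 * √(L / d) ≤ 1 / 3 := by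
    refine le_of_sq_le_sq ?_ (by norm_num)
    rw [hsq]
    have : L / d ≤ 1 / 1000 := by rw [div_le_div_iff₀ hd0 (by norm_num)]; linarith
    linarith
  refine ⟨8 * √(L / d), hpos, h1, ?_, ?_, ?_⟩
  · rw [hsq]; field_simp; norm_num
  · have h2 : 2 / d ≤ 8 * √(L / d) / 2 := by
      refine le_of_sq_le_sq ?_ (by positivity)
      rw [div_pow (8 * √(L / d)), hsq, div_pow]
      have : 64 * (L / d) / 2 ^ 2 = 16 * L * d / d ^ 2 := by field_simp; norm_num
      rw [this]
      gcongr
      nlinarith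
    have h3 : 0 < 2 / d := by positivity
    nlinarith
  · intro h
    refine le_of_sq_le_sq ?_ (by norm_num)
    rw [mul_pow, hsq]
    have : L / d * L ^ 2 ≤ 1 := by
      rw [div_mul_eq_mul_div, div_le_one hd0]
      calc L * L ^ 2 = L ^ 3 := by ring
        _ ≤ d := h
    linarith

lemma exp_neg_mul_le_one_sub_pow {p : ℝ} (hp : p ≤ 1 / 2) (M : ℕ) :
    Real.exp (-(p * M * (1 + 2 * p))) ≤ (1 - p) ^ M := by
  have h1 : Real.exp (-(p * (1 + 2 * p))) ≤ 1 - p := by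
    rw [Real.exp_neg]
    refine inv_le_of_inv_le₀ (by linarith) ?_
    have h2 : (1 - p)⁻¹ ≤ p * (1 + 2 * p) + 1 := by
      rw [inv_le_iff_one_le_mul₀ (by linarith)]
      nlinarith [sq_nonneg p]
    linarith [Real.add_one_le_exp (p * (1 + 2 * p))]
  calc Real.exp (-(p * M * (1 + 2 * p))) = Real.exp (-(p * (1 + 2 * p))) ^ M := by
        rw [← Real.exp_nat_mul]; ring_nf
    _ ≤ _ := pow_le_pow_left₀ (Real.exp_pos _).le h1 M

set_option maxHeartbeats 1000000 in
/-- The failure probability for the lower bound when `p` is at most of order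
`log log n / log n`. -/
lemma prob_lt_sparse_le (n : ℕ) (p : unitInterval) {d κ : ℝ} (r : ℕ) (hd : d = p * n)
    (hL2 : 8192 ≤ Real.log (Real.log n)) (hd1 : 1000 * Real.log n ≤ d) (hd2 : 100 * d ≤ n)
    (hi : 100 * d ^ (r + 1) ≤ n) (hin : r + 2 ≤ n)
    (hp : (p : ℝ) ≤ Real.log (Real.log n) / (16 * Real.log n))
    (hK : 0 < Real.log d - 3 * Real.log (Real.log n))
    (hdiam : (n : ℝ) ^ 2 * Real.exp (-(1 / (Real.exp (16 * d ^ (r + 1) / n) *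
        (n / d ^ (r + 2) + 2 / d)))) ≤ κ) :
    prob p (fun G : SimpleGraph (Fin n) => (localizationNumber G : ℝ) <
      (Real.log d - 3 * Real.log (Real.log n)) * (n / d ^ (r + 1))) ≤ κ + 2 / n := by
  set L := Real.log n with hLdef
  set L₂ := Real.log L with hL2def
  have hn1 : 1 ≤ n := by omega
  have hn0 : (0 : ℝ) < n := by exact_mod_cast hn1
  have hL0 : 0 < L := by
    by_contra h
    have hLnn : 0 ≤ L := Real.log_natCast_nonneg n
    have : L = 0 := le_antisymm (not_lt.1 h) hLnn
    rw [hL2def, this, Real.log_zero] at hL2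
    norm_num at hL2
  have hLexp : Real.exp L₂ = L := Real.exp_log hL0
  have hL2L : L₂ + 1 ≤ L := by rw [← hLexp]; exact Real.add_one_le_exp _
  have hL8 : 8193 ≤ L := by linarith
  have hd0 : 0 < d := by linarith
  have hd1' : 1 ≤ d := by linarith
  have hlogd : Real.log d ≤ L := Real.log_le_log hd0 (by linarith)
  have hdL3 : L ^ 3 ≤ d := by
    have : Real.exp (3 * L₂) ≤ d := by
      rw [← Real.exp_log hd0]; exact Real.exp_le_exp.2 (by linarith)
    rwa [show (3 : ℝ) * L₂ = ((3 : ℕ) : ℝ) * L₂ by norm_num, Real.exp_nat_mul, hLexp] at this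
  have hdr : d ≤ d ^ (r + 1) := by
    have : (1 : ℝ) ≤ d ^ r := one_le_pow₀ hd1'
    rw [pow_succ]; nlinarith
  have hdr0 : 0 < d ^ (r + 1) := by positivity
  have hp0 : (0 : ℝ) ≤ p := p.2.1
  have hp0' : (0 : ℝ) < p := by
    rcases hp0.eq_or_lt with h | h
    · rw [← h, zero_mul] at hd; linarith
    · exact h
  have hp1 : (p : ℝ) ≤ 1 / 2 := by
    refine hp.trans ?_
    rw [div_le_div_iff₀ (by linarith) (by norm_num)]; linarith
  obtain ⟨δ, hδ0, hδ1, hδ2, hδ3, hδ4⟩ := exists_sphere_error (by linarith : 1 ≤ L) hd1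
  have hδL := hδ4 hdL3
  set K := (Real.log d - 3 * L₂) * (n / d ^ (r + 1)) with hKdef
  have hK0 : 0 < K := by positivity
  set m := ⌊K⌋₊ with hm
  have hmK : (m : ℝ) ≤ K := Nat.floor_le hK0.le
  have hKL : K ≤ n * L / d := by
    calc K ≤ L * (n / d) := by
          refine mul_le_mul (by linarith) ?_ (by positivity) hL0.le
          exact div_le_div_of_nonneg_left hn0.le hd0 hdr
      _ = _ := by ring
  -- `pK d ^ r` is the exponent in the proportion of vertices far away from `K` sensors
  have hpK : (p : ℝ) * (K * d ^ r) = Real.log d - 3 * L₂ := by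
    rw [hKdef, pow_succ]
    have hdn : d / n = p := by rw [hd]; field_simp
    rw [← hdn]
    field_simp
  set M := ⌈(m : ℝ) * ((1 + δ) * (1 + 2 / d) * d ^ r)⌉₊ with hM
  have hMle : (m : ℝ) * ((1 + δ) * (1 + 2 / d) * d ^ r) ≤ M := Nat.le_ceil _
  have hMlt : (M : ℝ) ≤ (m : ℝ) * ((1 + δ) * (1 + 2 / d) * d ^ r) + 1 :=
    (Nat.ceil_lt_add_one (by positivity)).le
  have hpM : (p : ℝ) * M ≤ Real.log d - 3 * L₂ + 17 := by
    have h1 : (m : ℝ) * ((1 + δ) * (1 + 2 / d) * d ^ r) ≤ (1 + 2 * δ) * (K * d ^ r) := by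
      calc (m : ℝ) * ((1 + δ) * (1 + 2 / d) * d ^ r)
          ≤ K * ((1 + 2 * δ) * d ^ r) := by gcongr
        _ = _ := by ring
    have h2 : (p : ℝ) * M ≤ (1 + 2 * δ) * (Real.log d - 3 * L₂) + p := by
      calc (p : ℝ) * M ≤ p * ((1 + 2 * δ) * (K * d ^ r) + 1) :=
            mul_le_mul_of_nonneg_left (by linarith) hp0
        _ = (1 + 2 * δ) * (p * (K * d ^ r)) + p := by ring
        _ = _ := by rw [hpK]
    have h3 : δ * (Real.log d - 3 * L₂) ≤ 8 := by
      refine le_trans (mul_le_mul_of_nonneg_left ?_ hδ0.le) hδL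
      linarith
    linarith
  have hpM2 : (p : ℝ) * M ≤ 2 * L := by linarith
  have hML : (M : ℝ) ≤ 2 * (n * L / d) := by
    have h1 : (p : ℝ) * M * (n / d) = M := by rw [hd]; field_simp
    rw [← h1]
    calc (p : ℝ) * M * (n / d) ≤ 2 * L * (n / d) := by gcongr
      _ = _ := by ring
  have hnd : 1 ≤ n / d := by rw [le_div_iff₀ hd0]; linarith
  have hnLd : L ≤ n * L / d := by
    have : n * L / d = L * (n / d) := by ring
    rw [this]; nlinarith
  -- so large that a vertex has a neighbour in `A` outside the ball around `S` with probability at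
  -- least `1 / 2`, even if the ball, of size at most `M ≤ 2 n log n / d`, meets `A`
  set a := ⌈4 * (n * L / d)⌉₊ with ha
  have hale : 4 * (n * L / d) ≤ a := Nat.le_ceil _
  have halt : (a : ℝ) ≤ 5 * (n * L / d) := by
    have := (Nat.ceil_lt_add_one (show 0 ≤ 4 * (n * L / d) by positivity)).le
    linarith
  have hMa : M ≤ a := by
    have : (M : ℝ) ≤ a := by linarith
    exact_mod_cast this
  have hLd : n * L / d ≤ n / 1000 := by
    rw [div_le_div_iff₀ hd0 (by norm_num)]
    nlinarith
  -- The term `3 log log n` gives `(log n) ^ 3 / d`; the factor `(log n) ^ (1 / 4)` is lost in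
  -- `(1 - p) ^ M ≥ exp (-p M (1 + 2 p))`, where the upper bound on `p` enters.
  set q := Real.exp (11 / 4 * L₂ - 17) / (2 * d) with hq
  have hqle : q ≤ (1 - (p : ℝ)) ^ M * (1 - (1 - (p : ℝ)) ^ (a - M)) := by
    have h1 : Real.exp (11 / 4 * L₂ - 17) / d ≤ (1 - (p : ℝ)) ^ M := by
      refine le_trans ?_ (exp_neg_mul_le_one_sub_pow hp1 M)
      have h2 : Real.exp (11 / 4 * L₂ - 17) / d = Real.exp (11 / 4 * L₂ - 17 - Real.log d) := by
        rw [Real.exp_sub _ (Real.log d), Real.exp_log hd0]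
      rw [h2]
      refine Real.exp_le_exp.2 ?_
      have h3 : (p : ℝ) * M * (2 * p) ≤ L₂ / 4 := by
        calc (p : ℝ) * M * (2 * p) ≤ 2 * L * (2 * (L₂ / (16 * L))) := by gcongr
          _ = L₂ / 4 := by field_simp; norm_num
      linarith
    have h4 : (1 - (p : ℝ)) ^ (a - M) ≤ 1 / 2 := by
      refine (one_sub_pow_le hp0 p.2.2 _).trans ?_
      have h5 : 2 * L ≤ p * ((a - M : ℕ) : ℝ) := by
        rw [Nat.cast_sub hMa]
        calc 2 * L = p * (2 * (n * L / d)) := by rw [hd]; field_simp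
          _ ≤ _ := mul_le_mul_of_nonneg_left (by linarith) hp0
      exact one_div_le_one_div_of_le (by norm_num) (by linarith)
    calc q = Real.exp (11 / 4 * L₂ - 17) / d * (1 / 2) := by rw [hq]; ring
      _ ≤ _ := mul_le_mul h1 (by linarith) (by norm_num) (pow_nonneg (by linarith) _)
  -- At least `n / 2` vertices are neither in `A` nor close to `S`. The number of pairs `(S, A)` is at
  -- most `n ^ (m + a)`, with `m + a + 1 ≤ 8 n log n / d`.
  have hNq : 8 * L * (n * L / d) ≤ (n : ℝ) / 2 * q / 4 := by
    have h1 : 128 * L ^ 2 ≤ Real.exp (11 / 4 * L₂ - 17) := by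
      have h2 : (128 : ℝ) ≤ Real.exp (3 / 4 * L₂ - 17) := by
        linarith [Real.add_one_le_exp (3 / 4 * L₂ - 17)]
      have h3 : L ^ 2 = Real.exp (2 * L₂) := by
        rw [show (2 : ℝ) * L₂ = ((2 : ℕ) : ℝ) * L₂ by norm_num, Real.exp_nat_mul, hLexp]
      rw [h3, show 11 / 4 * L₂ - 17 = (3 / 4 * L₂ - 17) + 2 * L₂ by ring, Real.exp_add]
      exact mul_le_mul_of_nonneg_right h2 (Real.exp_pos _).le
    calc 8 * L * (n * L / d) = (128 * L ^ 2) * (n / (16 * d)) := by field_simp; norm_num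
      _ ≤ Real.exp (11 / 4 * L₂ - 17) * (n / (16 * d)) := by gcongr
      _ = _ := by rw [hq]; field_simp; norm_num
  have hmle : (m : ℝ) ≤ n * L / d := hmK.trans hKL
  have hfin := prob_localizationNumber_le_sparse (V := Fin n) p (d := d) (δ := δ)
    (by rw [Fintype.card_fin]; exact hd) (by linarith) hδ0 hδ1 r m a M
    (by
      rw [Fintype.card_fin]
      have : (m : ℝ) ≤ n := by linarith
      exact_mod_cast this)
    (by
      have : (2 : ℝ) ≤ a := by linarith
      exact_mod_cast this)
    (by
      rw [Fintype.card_fin]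
      have : (a : ℝ) ≤ n := by linarith
      exact_mod_cast this)
    (by rw [Fintype.card_fin]; linarith) hMle q (by positivity) hqle (n / 2)
    (by rw [Fintype.card_fin]; linarith)
    (le_trans (by nlinarith) hNq)
  rw [Fintype.card_fin] at hfin
  have hsub : prob p (fun G : SimpleGraph (Fin n) => (localizationNumber G : ℝ) < K) ≤
      prob p (fun G : SimpleGraph (Fin n) => localizationNumber G ≤ m) :=
    prob_mono p fun G hG => Nat.le_floor hG.le
  have ht1 : (n : ℝ) * (r + 2) * Real.exp (-(δ ^ 2 * d / 16)) ≤ 1 / n := by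
    rw [hδ2]
    have h1 : (n : ℝ) * (r + 2) ≤ (n : ℝ) ^ 2 := by
      have : (r : ℝ) + 2 ≤ n := by exact_mod_cast hin
      rw [sq]; gcongr
    refine le_trans (mul_le_mul_of_nonneg_right h1 (Real.exp_pos _).le)
      (natCast_pow_mul_exp_le hn1 ?_)
    push_cast
    linarith
  have ht3 : (n : ℝ) ^ (m + a) * Real.exp (-((n : ℝ) / 2 * q / 4)) ≤ 1 / n := by
    refine natCast_pow_mul_exp_le hn1 (le_trans ?_ hNq)
    push_cast
    rw [← hLdef]
    have : ((m : ℝ) + a + 1) ≤ 8 * (n * L / d) := by linarith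
    calc ((m : ℝ) + a + 1) * L ≤ 8 * (n * L / d) * L := by gcongr
      _ = _ := by ring
  calc _ ≤ _ := hsub
    _ ≤ _ := hfin
    _ ≤ 1 / n + (κ + 1 / n) := add_le_add ht1 (add_le_add hdiam ht3)
    _ = κ + 2 / n := by ring

set_option maxHeartbeats 1000000 in
/-- The failure probability for the lower bound when `p` is at least of order
`log log n / log n`. -/
lemma prob_lt_dense_le (n : ℕ) (p : unitInterval) {d κ : ℝ} (hd : d = p * n)
    (hL2 : 8192 ≤ Real.log (Real.log n)) (hd1 : 1000 * Real.log n ≤ d) (hd2 : 100 * d ≤ n)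
    (hp : Real.log (Real.log n) / (16 * Real.log n) ≤ (p : ℝ))
    (hK : 0 < Real.log d - 3 * Real.log (Real.log n))
    (hdiam : (n : ℝ) ^ 2 * Real.exp (-(1 / (Real.exp (16 * d ^ 1 / n) *
        (n / d ^ 2 + 2 / d)))) ≤ κ) :
    prob p (fun G : SimpleGraph (Fin n) => (localizationNumber G : ℝ) <
      (Real.log d - 3 * Real.log (Real.log n)) * (n / d ^ 1)) ≤ κ + 3 / n := by
  set L := Real.log n with hLdef
  set L₂ := Real.log L with hL2def
  have hL0 : 0 < L := by
    by_contra h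
    have hLnn : 0 ≤ L := Real.log_natCast_nonneg n
    have : L = 0 := le_antisymm (not_lt.1 h) hLnn
    rw [hL2def, this, Real.log_zero] at hL2
    norm_num at hL2
  have hLexp : Real.exp L₂ = L := Real.exp_log hL0
  have hL2L : L₂ + 1 ≤ L := by rw [← hLexp]; exact Real.add_one_le_exp _
  have hL8 : 8193 ≤ L := by linarith
  have hd0 : 0 < d := by linarith
  have hn0 : (0 : ℝ) < n := by linarith
  have hn1 : 1 ≤ n := by exact_mod_cast hn0
  have hlogd : Real.log d ≤ L := Real.log_le_log hd0 (by linarith)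
  have hp0 : (0 : ℝ) ≤ p := p.2.1
  have hp0' : (0 : ℝ) < p := by
    rcases hp0.eq_or_lt with h | h
    · rw [← h, zero_mul] at hd; linarith
    · exact h
  have hp1 : (p : ℝ) ≤ 1 / 2 := by
    by_contra h
    push Not at h
    rw [hd] at hd2
    nlinarith
  obtain ⟨δ, hδ0, hδ1, hδ2, hδ3, hδ4⟩ := exists_sphere_error (by linarith : 1 ≤ L) hd1
  set K := (Real.log d - 3 * L₂) * (n / d ^ 1) with hKdef
  have hK0 : 0 < K := by positivity
  set m := ⌊K⌋₊ with hm
  have hmK : (m : ℝ) ≤ K := Nat.floor_le hK0.le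
  have hpK : (p : ℝ) * K = Real.log d - 3 * L₂ := by
    rw [hKdef, pow_one]
    have hdn : d / n = p := by rw [hd]; field_simp
    rw [← hdn]
    field_simp
  have hmL : (m : ℝ) ≤ 16 * L ^ 2 / L₂ := by
    refine hmK.trans ?_
    rw [le_div_iff₀ (by linarith)]
    rw [div_le_iff₀ (by positivity)] at hp
    calc K * L₂ ≤ K * (p * (16 * L)) := mul_le_mul_of_nonneg_left hp hK0.le
      _ = (p * K) * (16 * L) := by ring
      _ ≤ L * (16 * L) := by rw [hpK]; gcongr; linarith
      _ = _ := by ring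
  have hmL' : (m : ℝ) ≤ L ^ 2 / 512 := by
    refine hmL.trans ?_
    rw [div_le_div_iff₀ (by linarith) (by norm_num)]
    nlinarith [sq_nonneg L]
  have hL3d : L ^ 3 ≤ d := by
    have h1 : L ^ 5 / 120 ≤ n := by
      have := Real.pow_div_factorial_le_exp (x := L) hL0.le 5
      rw [hLdef, Real.exp_log hn0, ← hLdef] at this
      norm_num [Nat.factorial] at this
      exact this
    have h2 : 1 ≤ p * (16 * L) := by
      rw [div_le_iff₀ (by positivity)] at hp
      linarith
    have h3 : (n : ℝ) ≤ d * (16 * L) := by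
      rw [hd]
      nlinarith
    have h4 : L ^ 3 * (16 * L) ≤ d * (16 * L) := by
      refine le_trans ?_ (h1.trans h3)
      have : L ^ 4 * (16 * 120) ≤ L ^ 4 * L := mul_le_mul_of_nonneg_left (by linarith) (by positivity)
      nlinarith
    exact le_of_mul_le_mul_right h4 (by positivity)
  have hL2d : L ^ 2 ≤ d := by
    refine le_trans ?_ hL3d
    have : L ^ 2 * 1 ≤ L ^ 2 * L := mul_le_mul_of_nonneg_left (by linarith) (by positivity)
    nlinarith
  -- half of the degree bound `d / 8`, leaving room for the neighbours in `S`
  set D := ⌊d / 32⌋₊ with hD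
  have hDle : (D : ℝ) ≤ d / 32 := Nat.floor_le (by positivity)
  have hDge : d / 64 ≤ D := by
    have := (Nat.lt_floor_add_one (d / 32)).le
    rw [← hD] at this
    linarith
  -- The term `3 log log n` makes this at least of order `(log n) ^ 3`, which beats the logarithm
  -- `(m + 1) log n` of the number of pairs `(x, S)` because `m ≤ (log n) ^ 2 / 512`.
  have hu : L ^ 3 / 64 ≤ D * Real.exp (-(p * m)) := by
    have h1 : Real.exp (3 * L₂ - Real.log d) ≤ Real.exp (-(p * m)) := by
      refine Real.exp_le_exp.2 ?_
      have := mul_le_mul_of_nonneg_left hmK hp0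
      linarith
    have h2 : Real.exp (3 * L₂ - Real.log d) = L ^ 3 / d := by
      rw [Real.exp_sub, Real.exp_log hd0, show (3 : ℝ) * L₂ = ((3 : ℕ) : ℝ) * L₂ by norm_num,
        Real.exp_nat_mul, hLexp]
    rw [h2] at h1
    calc L ^ 3 / 64 = d / 64 * (L ^ 3 / d) := by field_simp
      _ ≤ _ := mul_le_mul hDge h1 (by positivity) (by positivity)
  have hL3 : L ^ 2 * 8193 ≤ L ^ 3 := by
    have := mul_le_mul_of_nonneg_left hL8 (sq_nonneg L)
    calc L ^ 2 * 8193 ≤ L ^ 2 * L := this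
      _ = _ := by ring
  have hL22 : L * 8193 ≤ L ^ 2 := by nlinarith
  have hfin := prob_localizationNumber_le_dense (V := Fin n) p hp1 (d := d) (δ := δ)
    (by rw [Fintype.card_fin]; exact hd) (by linarith) hδ0 hδ1 m D
    (by
      rw [Fintype.card_fin]
      have : (m : ℝ) ≤ n := by linarith
      exact_mod_cast this)
    (by rw [Fintype.card_fin]; linarith)
    (by push_cast; linarith) (u := L ^ 3 / 64) (by linarith) hu
  rw [Fintype.card_fin] at hfin
  have hsub : prob p (fun G : SimpleGraph (Fin n) => (localizationNumber G : ℝ) < K) ≤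
      prob p (fun G : SimpleGraph (Fin n) => localizationNumber G ≤ m) :=
    prob_mono p fun G hG => Nat.le_floor hG.le
  have ht1 : (n : ℝ) * 2 * Real.exp (-(δ ^ 2 * d / 16)) ≤ 1 / n := by
    rw [hδ2]
    have h1 : (n : ℝ) * 2 ≤ (n : ℝ) ^ 2 := by
      rw [sq]
      exact mul_le_mul_of_nonneg_left (by linarith) hn0.le
    refine le_trans (mul_le_mul_of_nonneg_right h1 (Real.exp_pos _).le)
      (natCast_pow_mul_exp_le hn1 ?_)
    push_cast
    linarith
  have ht3 : (n : ℝ) * Real.exp (-(d / 8)) ≤ 1 / n := by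
    have := natCast_pow_mul_exp_le hn1 (k := 1) (x := d / 8) (by push_cast; linarith)
    rwa [pow_one] at this
  have ht4 : (n : ℝ) ^ (m + 1) * Real.exp (-(L ^ 3 / 64 / 2)) ≤ 1 / n := by
    refine natCast_pow_mul_exp_le hn1 ?_
    push_cast
    rw [← hLdef]
    have h1 : ((m : ℝ) + 1 + 1) * L ≤ (L ^ 2 / 512 + 2) * L :=
      mul_le_mul_of_nonneg_right (by linarith) hL0.le
    have h2 : (L ^ 2 / 512 + 2) * L = L ^ 3 / 512 + 2 * L := by ring
    linarith
  calc _ ≤ _ := hsub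
    _ ≤ _ := hfin
    _ ≤ 1 / n + (κ + (1 / n + 1 / n)) :=
        add_le_add ht1 (add_le_add hdiam (add_le_add ht3 ht4))
    _ = κ + 3 / n := by ring

/-- The error term for the diameter: the hypothesis `d ^ (i + 1) / n - 2 log n → ∞` is sharp enough
because `d ≥ (log n) ^ 3` makes the corrections to the exponent negligible. -/
lemma diam_error_le {n : ℝ} {i : ℕ} {d C : ℝ} (hn : 0 < n) (hL : 1000 ≤ Real.log n)
    (hLd : Real.log n ^ 3 ≤ d) (hi : 100 * d ^ i ≤ n) (hC : C ≤ Real.log n)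
    (hx : 2 * Real.log n + (C + 1) ≤ d ^ (i + 1) / n) :
    n ^ 2 * Real.exp (-(1 / (Real.exp (16 * d ^ i / n) * (n / d ^ (i + 1) + 2 / d)))) ≤
      Real.exp (-C) := by
  set L := Real.log n with hLdef
  have hd0 : 0 < d := lt_of_lt_of_le (by positivity) hLd
  set x := d ^ (i + 1) / n with hxdef
  have hx0 : 0 < x := by positivity
  have e1 : d ^ i / n = x / d := by rw [hxdef, pow_succ]; field_simp
  have e2 : n / d ^ (i + 1) = 1 / x := by rw [hxdef, one_div_div]
  have hxd : x / d ≤ 1 / 100 := by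
    rw [← e1, div_le_div_iff₀ hn (by norm_num)]; linarith
  have hxd0 : 0 < x / d := by positivity
  have hE : x * (1 - 18 * (x / d)) ≤ 1 / (Real.exp (16 * d ^ i / n) * (n / d ^ (i + 1) + 2 / d)) := by
    rw [mul_div_assoc, e1, e2]
    have h1 : 1 / x + 2 / d = 1 / x * (1 + 2 * (x / d)) := by field_simp
    have h2 : 1 + 2 * (x / d) ≤ Real.exp (2 * (x / d)) := by
      linarith [Real.add_one_le_exp (2 * (x / d))]
    have h3 : Real.exp (16 * (x / d)) * (1 / x + 2 / d) ≤ 1 / x * Real.exp (18 * (x / d)) := by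
      rw [h1]
      calc Real.exp (16 * (x / d)) * (1 / x * (1 + 2 * (x / d)))
          ≤ Real.exp (16 * (x / d)) * (1 / x * Real.exp (2 * (x / d))) := by gcongr
        _ = 1 / x * (Real.exp (16 * (x / d)) * Real.exp (2 * (x / d))) := by ring
        _ = _ := by rw [← Real.exp_add]; ring_nf
    have h4 : 1 / (1 / x * Real.exp (18 * (x / d))) = x * Real.exp (-(18 * (x / d))) := by
      rw [Real.exp_neg]; field_simp
    calc x * (1 - 18 * (x / d)) ≤ x * Real.exp (-(18 * (x / d))) :=
          mul_le_mul_of_nonneg_left (Real.one_sub_le_exp_neg _) hx0.le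
      _ = 1 / (1 / x * Real.exp (18 * (x / d))) := h4.symm
      _ ≤ _ := one_div_le_one_div_of_le (by positivity) h3
  have hmain : 2 * L + C ≤ x * (1 - 18 * (x / d)) := by
    rcases le_total x (4 * L) with h | h
    · have h1 : 18 * (x * (x / d)) ≤ 1 := by
        have h2 : x * (x / d) ≤ 16 * L ^ 2 / d := by
          rw [mul_div_assoc', div_le_div_iff_of_pos_right hd0]
          nlinarith
        have h3 : 16 * L ^ 2 / d ≤ 1 / 18 := by
          rw [div_le_div_iff₀ hd0 (by norm_num)]
          have : L ^ 2 * 1000 ≤ L ^ 2 * L := mul_le_mul_of_nonneg_left hL (sq_nonneg L)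
          nlinarith
        linarith
      nlinarith
    · nlinarith
  have hn2 : n ^ 2 = Real.exp (2 * L) := by
    rw [show (2 : ℝ) * L = ((2 : ℕ) : ℝ) * L by norm_num, Real.exp_nat_mul, hLdef, Real.exp_log hn]
  rw [hn2, ← Real.exp_add]
  exact Real.exp_le_exp.2 (by linarith)

end Parameters

/-! ### Asymptotics -/

section Asymptotic

/-- If every fixed relative error `η` is good enough with probability tending to one, then so is
some relative error tending to zero. -/
lemma exists_error_tendsto_zero (B : ℝ → ℕ → ℝ)
    (h : ∀ η, 0 < η → η ≤ 1 → ∀ κ, 0 < κ → ∀ᶠ n in atTop, B η n ≤ κ) :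
    ∃ ε : ℕ → ℝ, Tendsto ε atTop (𝓝 0) ∧ ∀ κ, 0 < κ → ∀ᶠ n in atTop, B (ε n) n ≤ κ := by
  have h' : ∀ m : ℕ, ∃ N, ∀ n ≥ N, B (1 / ((m : ℝ) + 1)) n ≤ 1 / ((m : ℝ) + 1) := by
    intro m
    have h0 : (0 : ℝ) < 1 / ((m : ℝ) + 1) := by positivity
    refine eventually_atTop.1 (h _ h0 ?_ _ h0)
    rw [div_le_one (by positivity)]
    linarith [Nat.cast_nonneg (α := ℝ) m]
  choose N hN using h'
  set g : ℕ → ℕ := fun n => Nat.findGreatest (fun m => ∀ m' ≤ m, N m' ≤ n) n with hg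
  have hgt : Tendsto g atTop atTop := by
    refine tendsto_atTop.2 fun M => ?_
    filter_upwards [eventually_ge_atTop (max M (∑ m' ∈ Finset.range (M + 1), N m'))] with n hn
    refine Nat.le_findGreatest ((le_max_left _ _).trans hn) fun m' hm' => ?_
    refine le_trans ?_ ((le_max_right _ _).trans hn)
    exact Finset.single_le_sum (f := N) (fun _ _ => Nat.zero_le _)
      (Finset.mem_range.2 (by omega))
  have hlim : Tendsto (fun n => 1 / ((g n : ℝ) + 1)) atTop (𝓝 0) :=
    tendsto_one_div_add_atTop_nhds_zero_nat.comp hgt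
  refine ⟨fun n => 1 / ((g n : ℝ) + 1), hlim, fun κ hκ => ?_⟩
  filter_upwards [eventually_ge_atTop (N 0), hlim.eventually_lt_const hκ] with n hn hn'
  have hspec := Nat.findGreatest_spec (P := fun m => ∀ m' ≤ m, N m' ≤ n) (Nat.zero_le n)
    (fun m' hm' => by
      obtain rfl : m' = 0 := by omega
      exact hn)
  exact (hN (g n) n (hspec (g n) le_rfl)).trans hn'.le

/-- It suffices to bound the failure probabilities; `AAS` is stated with the measure `binomialRandom`
itself, `prob` is its real-valued version. -/
lemma aas_of_prob_not_le (p : ℕ → unitInterval) (P : (n : ℕ) → SimpleGraph (Fin n) → Prop)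
    (h : ∀ κ, 0 < κ → ∀ᶠ n in atTop, prob (p n) (fun G => ¬ P n G) ≤ κ) : AAS p P := by
  have hreal : Tendsto (fun n => (SimpleGraph.binomialRandom (Fin n) (p n)).real {G | P n G})
      atTop (𝓝 1) := by
    have hone : ∀ n, 1 - prob (p n) (fun G => ¬ P n G) ≤
        (SimpleGraph.binomialRandom (Fin n) (p n)).real {G | P n G} := by
      intro n
      rw [← prob_eq_real, sub_le_iff_le_add]
      refine le_trans ?_ (prob_or_le (p n) (P n) fun G => ¬ P n G)
      have : prob (p n) (fun G => P n G ∨ ¬ P n G) = 1 := by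
        rw [prob_eq_real]
        simp [em]
      exact this.ge
    refine Metric.tendsto_atTop'.2 fun ε hε => ?_
    obtain ⟨N, hN⟩ := eventually_atTop.1 (h (ε / 2) (by linarith))
    refine ⟨N, fun n hn => ?_⟩
    have h1 := hone n
    have h2 := hN n hn.le
    have h3 : (SimpleGraph.binomialRandom (Fin n) (p n)).real {G | P n G} ≤ 1 :=
      MeasureTheory.measureReal_le_one
    rw [Real.dist_eq, abs_lt]
    constructor <;> linarith
  have := ENNReal.tendsto_ofReal hreal
  simpa [AAS, MeasureTheory.measureReal_def] using this

variable {p : ℕ → unitInterval} {i : ℕ → ℕ}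

/-- The inequalities between the parameters that are used for large `n`. In particular `i ≥ 1`,
because `d ^ (i + 1) / n` is unbounded while `d / n` is not. -/
lemma eventually_parameters (h1 : (fun n : ℕ => Real.log n) =o[atTop] deg p)
    (h2 : deg p =o[atTop] (fun n : ℕ => (n : ℝ)))
    (h3 : (fun n : ℕ => deg p n ^ i n) =o[atTop] (fun n : ℕ => (n : ℝ)))
    (h4 : Tendsto (fun n : ℕ => deg p n ^ (i n + 1) / n - 2 * Real.log n) atTop atTop)
    {C : ℝ} (hC : 1000 ≤ C) :
    ∀ᶠ n : ℕ in atTop, C * Real.log n ≤ deg p n ∧ C * deg p n ≤ n ∧ C * deg p n ^ i n ≤ n ∧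
      2 * Real.log n + C ≤ deg p n ^ (i n + 1) / n ∧ C ≤ Real.log (Real.log n) ∧
      C ≤ Real.log n ∧ C ≤ n ∧ 1 ≤ i n ∧ i n + 1 ≤ n := by
  have hC0 : 0 < C := by linarith
  have hlog : Tendsto (fun n : ℕ => Real.log n) atTop atTop :=
    Real.tendsto_log_atTop.comp tendsto_natCast_atTop_atTop
  filter_upwards [(isLittleO_iff.1 h1) (inv_pos.2 hC0), (isLittleO_iff.1 h2) (inv_pos.2 hC0),
    (isLittleO_iff.1 h3) (inv_pos.2 hC0), tendsto_atTop.1 h4 C,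
    tendsto_atTop.1 (Real.tendsto_log_atTop.comp hlog) C, tendsto_atTop.1 hlog C,
    tendsto_atTop.1 (tendsto_natCast_atTop_atTop (R := ℝ)) C] with n e1 e2 e3 e4 e5 e6 e7
  have hn0 : (0 : ℝ) < n := by linarith
  have hd0 : 0 ≤ deg p n := mul_nonneg (p n).2.1 hn0.le
  rw [Real.norm_eq_abs, Real.norm_of_nonneg hd0, ← div_eq_inv_mul, le_div_iff₀ hC0] at e1
  rw [Real.norm_of_nonneg hd0, Real.norm_of_nonneg hn0.le, ← div_eq_inv_mul, le_div_iff₀ hC0] at e2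
  rw [Real.norm_of_nonneg (pow_nonneg hd0 _), Real.norm_of_nonneg hn0.le, ← div_eq_inv_mul,
    le_div_iff₀ hC0] at e3
  rw [abs_of_nonneg (by linarith)] at e1
  have hd2 : 2 ≤ deg p n := by nlinarith
  have hi1 : 1 ≤ i n := by
    by_contra hi
    obtain hi : i n = 0 := by omega
    rw [hi, zero_add, pow_one] at e4
    have : deg p n / n ≤ 1 := by rw [div_le_one hn0]; nlinarith
    linarith
  have hin : i n + 1 ≤ n := by
    have a1 : (2 : ℝ) ^ i n ≤ deg p n ^ i n := pow_le_pow_left₀ (by norm_num) hd2 _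
    have a2 : (2 : ℝ) ^ i n ≤ n := by
      have : 0 < (2 : ℝ) ^ i n := by positivity
      nlinarith
    have a3 : 2 ^ i n ≤ n := by exact_mod_cast a2
    have a4 : i n < 2 ^ i n := Nat.lt_two_pow_self
    omega
  exact ⟨by linarith, by linarith, by linarith, by linarith, e5, e6, e7, hi1, hin⟩

/-- The lower bound holds asymptotically almost surely. It is trivial for `d ≤ (log n) ^ 3`; otherwise
the size of `p` compared to `log log n / log n` decides which robber strategy is used. -/
lemma eventually_prob_lt_lower (h1 : (fun n : ℕ => Real.log n) =o[atTop] deg p)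
    (h2 : deg p =o[atTop] (fun n : ℕ => (n : ℝ)))
    (h3 : (fun n : ℕ => deg p n ^ i n) =o[atTop] (fun n : ℕ => (n : ℝ)))
    (h4 : Tendsto (fun n : ℕ => deg p n ^ (i n + 1) / n - 2 * Real.log n) atTop atTop)
    {κ : ℝ} (hκ : 0 < κ) :
    ∀ᶠ n : ℕ in atTop, prob (p n) (fun G : SimpleGraph (Fin n) =>
      (localizationNumber G : ℝ) < (Real.log (deg p n) - 3 * Real.log (Real.log n)) *
        (n / deg p n ^ i n)) ≤ κ := by
  set C := max 8192 (max (6 / κ) (1 - Real.log (κ / 2))) with hC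
  have hC1 : 8192 ≤ C := le_max_left _ _
  have hC2 : 6 / κ ≤ C := (le_max_left _ _).trans (le_max_right _ _)
  have hC3 : 1 - Real.log (κ / 2) ≤ C := (le_max_right _ _).trans (le_max_right _ _)
  filter_upwards [eventually_parameters h1 h2 h3 h4 (show 1000 ≤ C by linarith)] with n hn
  obtain ⟨e1, e2, e3, e4, e5, e6, e7, hi1, hin⟩ := hn
  have hn0 : (0 : ℝ) < n := by linarith
  have hdef : deg p n = p n * n := rfl
  set d := deg p n with hd
  set L := Real.log n with hL
  have hL0 : 0 < L := by linarith
  have hd0 : 0 < d := lt_of_lt_of_le (by positivity) e1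
  have hpow0 : 0 < d ^ i n := by positivity
  by_cases hK : Real.log d - 3 * Real.log L ≤ 0
  · refine le_trans (prob_mono (p n) (Q := fun _ => False) fun G hG => ?_) ?_
    · have : (Real.log d - 3 * Real.log L) * (n / d ^ i n) ≤ 0 :=
        mul_nonpos_of_nonpos_of_nonneg hK (by positivity)
      have h0 : (0 : ℝ) ≤ localizationNumber G := Nat.cast_nonneg _
      linarith
    · simp only [prob, if_false, expect_const]
      exact hκ.le
  push Not at hK
  have hd1' : 1000 * L ≤ d := le_trans (by gcongr; linarith) e1
  have hd2' : 100 * d ≤ n := le_trans (by gcongr; linarith) e2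
  have hi' : 100 * d ^ i n ≤ n := le_trans (by gcongr; linarith) e3
  have hLd : L ^ 3 ≤ d := by
    have : Real.exp (3 * Real.log L) ≤ d := by
      rw [← Real.exp_log hd0]; exact Real.exp_le_exp.2 (by linarith)
    rwa [show (3 : ℝ) * Real.log L = ((3 : ℕ) : ℝ) * Real.log L by norm_num, Real.exp_nat_mul,
      Real.exp_log hL0] at this
  have hdiam := diam_error_le (C := -Real.log (κ / 2)) hn0 (by linarith) hLd hi' (by linarith)
    (by linarith)
  rw [neg_neg, Real.exp_log (by linarith)] at hdiam
  have h3n : 3 / (n : ℝ) ≤ κ / 2 := by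
    rw [div_le_div_iff₀ hn0 (by norm_num)]
    rw [div_le_iff₀ hκ] at hC2
    nlinarith
  have h2n : 2 / (n : ℝ) ≤ 3 / n := by gcongr; norm_num
  obtain ⟨r, hr⟩ : ∃ r, i n = r + 1 := ⟨i n - 1, by omega⟩
  rw [hr] at hi' hdiam ⊢
  rcases le_total (p n : ℝ) (Real.log L / (16 * L)) with hp | hp
  · have := prob_lt_sparse_le n (p n) r hdef (by linarith) hd1' hd2' hi' (by omega) hp hK hdiam
    linarith
  · have hr0 : r = 0 := by
      -- for `r ≥ 1` the bounds `d ^ 2 ≤ n` and `p ≥ 1 / log n` contradict each other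
      by_contra hr0
      have a1 : d ^ 2 ≤ n := by
        have b1 : d ^ 2 ≤ d ^ (r + 1) := pow_le_pow_right₀ (by linarith) (by omega)
        nlinarith
      have a2 : 1 ≤ p n * L := by
        rw [div_le_iff₀ (by positivity)] at hp
        nlinarith
      have a3 : (n : ℝ) ≤ d * L := by
        rw [hdef]
        nlinarith
      have a4 : L ^ 3 / 6 ≤ n := by
        have := Real.pow_div_factorial_le_exp (x := L) hL0.le 3
        rw [hL, Real.exp_log hn0, ← hL] at this
        norm_num [Nat.factorial] at this
        exact this
      have a5 : d ≤ L := by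
        have : d * d ≤ L * d := by nlinarith
        exact le_of_mul_le_mul_right this hd0
      linarith
    rw [hr0] at hdiam ⊢
    have := prob_lt_dense_le n (p n) hdef (by linarith) hd1' hd2' hp hK hdiam
    linarith

set_option maxHeartbeats 1000000 in
/-- The upper bound holds asymptotically almost surely, with a fixed relative error `η`. -/
lemma eventually_prob_gt_upper (h1 : (fun n : ℕ => Real.log n) =o[atTop] deg p)
    (h2 : deg p =o[atTop] (fun n : ℕ => (n : ℝ)))
    (h3 : (fun n : ℕ => deg p n ^ i n) =o[atTop] (fun n : ℕ => (n : ℝ)))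
    (h4 : Tendsto (fun n : ℕ => deg p n ^ (i n + 1) / n - 2 * Real.log n) atTop atTop)
    {η : ℝ} (hη0 : 0 < η) (hη1 : η ≤ 1) {κ : ℝ} (hκ : 0 < κ) :
    ∀ᶠ n : ℕ in atTop, prob (p n) (fun G : SimpleGraph (Fin n) =>
      (1 + η) * (Real.log (deg p n) + 2 * Real.log (Real.log n)) * (n / deg p n ^ i n) <
        (localizationNumber G : ℝ)) ≤ κ := by
  -- the separation of pairs and the closed neighbourhoods are within a factor `1 ± O(δ)`
  set δ := η / 24 with hδ
  have hδ0 : 0 < δ := by positivity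
  have hδ1 : δ ≤ 1 / 24 := by rw [hδ]; linarith
  set c := Real.log (1 + δ / 16) / 16 with hc
  have hc0 : 0 < c := div_pos (Real.log_pos (by linarith)) (by norm_num)
  set C := max 1000 (max (2 / κ) (max (2 / η) (max (256 / δ ^ 2) (1 / c)))) with hC
  have hC1 : 1000 ≤ C := le_max_left _ _
  have hC2 : 2 / κ ≤ C := (le_max_left _ _).trans (le_max_right _ _)
  have hC3 : 2 / η ≤ C := (le_max_left _ _).trans ((le_max_right _ _).trans (le_max_right _ _))
  have hC4 : 256 / δ ^ 2 ≤ C := (le_max_left _ _).trans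
    ((le_max_right _ _).trans ((le_max_right _ _).trans (le_max_right _ _)))
  have hC5 : 1 / c ≤ C := (le_max_right _ _).trans
    ((le_max_right _ _).trans ((le_max_right _ _).trans (le_max_right _ _)))
  clear_value C
  filter_upwards [eventually_parameters h1 h2 h3 h4 hC1] with n hn
  obtain ⟨e1, e2, e3, -, e5, e6, e7, hi1, hin⟩ := hn
  have hn0 : (0 : ℝ) < n := by linarith
  have hn1 : 1 ≤ n := by exact_mod_cast hn0
  have hdef : deg p n = p n * n := rfl
  generalize deg p n = d at *
  generalize i n = j at *
  set L := Real.log n with hL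
  have hL0 : 0 < L := by linarith
  have hd0 : 0 < d := lt_of_lt_of_le (by positivity) e1
  have hpow0 : 0 < d ^ j := by positivity
  have hCL : C ≤ C * L := by nlinarith
  have hlogd : 0 ≤ Real.log d := Real.log_nonneg (by linarith)
  set s := Real.log d + 2 * Real.log L with hs
  have hs1 : 1 ≤ s := by linarith
  set X := s * (n / d ^ j) with hX
  have hndC : C ≤ n / d ^ j := by rw [le_div_iff₀ hpow0]; exact e3
  have hXη : 2 / η ≤ X := by
    calc 2 / η ≤ C := hC3
      _ ≤ n / d ^ j := hndC
      _ ≤ X := by rw [hX]; nlinarith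
  have hX0 : 0 < X := lt_of_lt_of_le (by positivity) hXη
  set k := ⌈(1 + η / 2) * X⌉₊ with hk
  have hkle : (1 + η / 2) * X ≤ k := Nat.le_ceil _
  have hklt : (k : ℝ) ≤ (1 + η) * X := by
    have a1 := (Nat.ceil_lt_add_one (show 0 ≤ (1 + η / 2) * X by positivity)).le
    have a2 : 1 ≤ η / 2 * X := by
      rw [div_le_iff₀ hη0] at hXη
      linarith
    rw [← hk] at a1
    linarith
  set θ := 8 * L / δ with hθ
  have hθ0 : 0 < θ := by positivity
  have hdL : 256 * L ≤ δ ^ 2 * d := by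
    rw [div_le_iff₀ (by positivity)] at hC4
    calc 256 * L ≤ (C * δ ^ 2) * L := by gcongr
      _ = δ ^ 2 * (C * L) := by ring
      _ ≤ δ ^ 2 * d := by gcongr
  have hCexp : Real.exp (16 * d ^ j / n) * (1 + 2 * θ / d) ≤ 1 + δ / 4 := by
    have a1 : Real.exp (16 * d ^ j / n) ≤ 1 + δ / 16 := by
      rw [← Real.exp_log (show 0 < 1 + δ / 16 by linarith)]
      refine Real.exp_le_exp.2 ?_
      have a3 : d ^ j / n ≤ c := by
        rw [div_le_iff₀ hc0] at hC5
        rw [div_le_iff₀ hn0]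
        calc d ^ j = 1 * d ^ j := (one_mul _).symm
          _ ≤ (C * c) * d ^ j := by gcongr
          _ = c * (C * d ^ j) := by ring
          _ ≤ c * n := by gcongr
      calc 16 * d ^ j / n = 16 * (d ^ j / n) := by ring
        _ ≤ 16 * c := by gcongr
        _ = _ := by rw [hc]; ring
    have a2 : 2 * θ / d ≤ δ / 16 := by
      rw [hθ, div_le_div_iff₀ hd0 (by norm_num)]
      have : 2 * (8 * L / δ) * 16 = 256 * L / δ := by ring
      rw [this, div_le_iff₀ hδ0]
      calc 256 * L ≤ δ ^ 2 * d := hdL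
        _ = _ := by ring
    calc Real.exp (16 * d ^ j / n) * (1 + 2 * θ / d) ≤ (1 + δ / 16) * (1 + δ / 16) := by gcongr
      _ ≤ _ := by nlinarith
  have hdδ : (1 + δ) * (1 + 2 / d) ≤ 1 + 2 * δ := by
    have a1 : 2 / d ≤ δ / 2 := by
      rw [div_le_div_iff₀ hd0 (by norm_num)]
      have : δ ^ 2 * d ≤ δ * d := by nlinarith [mul_pos hδ0 hd0]
      linarith
    have a2 : 0 < 2 / d := by positivity
    nlinarith
  have hksmall : 2 * (2 * d) ^ 2 * Real.exp (-((2 - 6 * δ) * d ^ j * k / n)) < 1 := by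
    have a1 : 2 * s ≤ (2 - 6 * δ) * d ^ j * k / n := by
      rw [le_div_iff₀ hn0]
      have b1 : s * n = X * d ^ j := by rw [hX]; field_simp
      have b2 : 2 ≤ (2 - 6 * δ) * (1 + η / 2) := by rw [hδ]; nlinarith
      calc 2 * s * n = 2 * (X * d ^ j) := by rw [← b1]; ring
        _ ≤ ((2 - 6 * δ) * (1 + η / 2)) * (X * d ^ j) :=
            mul_le_mul_of_nonneg_right b2 (by positivity)
        _ = (2 - 6 * δ) * d ^ j * ((1 + η / 2) * X) := by ring
        _ ≤ _ := mul_le_mul_of_nonneg_left hkle (mul_nonneg (by linarith) hpow0.le)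
    have a2 : Real.exp (-((2 - 6 * δ) * d ^ j * k / n)) ≤ 1 / (d ^ 2 * 16) := by
      have b1 : Real.exp (2 * Real.log d) = d ^ 2 := by
        rw [show (2 : ℝ) * Real.log d = ((2 : ℕ) : ℝ) * Real.log d by norm_num, Real.exp_nat_mul,
          Real.exp_log hd0]
      have b2 : (16 : ℝ) ≤ Real.exp (4 * Real.log L) := by
        linarith [Real.add_one_le_exp (4 * Real.log L)]
      rw [Real.exp_neg, ← one_div]
      refine one_div_le_one_div_of_le (by positivity) ?_
      calc d ^ 2 * 16 ≤ Real.exp (2 * Real.log d) * Real.exp (4 * Real.log L) := by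
            rw [b1]; gcongr
        _ = Real.exp (2 * s) := by rw [← Real.exp_add, hs]; ring_nf
        _ ≤ _ := Real.exp_le_exp.2 a1
    calc 2 * (2 * d) ^ 2 * Real.exp (-((2 - 6 * δ) * d ^ j * k / n))
        ≤ 2 * (2 * d) ^ 2 * (1 / (d ^ 2 * 16)) := by gcongr
      _ = 1 / 2 := by field_simp; norm_num
      _ < 1 := by norm_num
  have hfin := prob_lt_localizationNumber_le (V := Fin n) (p n) (d := d) (δ := δ) (θ := θ) (i := j)
    (by rw [Fintype.card_fin]; exact hdef) (by linarith) hδ0 (by linarith) hθ0 hi1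
    (by
      rw [Fintype.card_fin]
      exact le_trans (by gcongr; linarith) e3)
    (by rw [Fintype.card_fin]; exact hCexp) hdδ k (by rw [Fintype.card_fin]; exact hksmall)
  rw [Fintype.card_fin] at hfin
  have ht1 : (n : ℝ) * (j + 1) * Real.exp (-(δ ^ 2 * d / 16)) ≤ 1 / n := by
    have a1 : (n : ℝ) * (j + 1) ≤ (n : ℝ) ^ 2 := by
      have : (j : ℝ) + 1 ≤ n := by exact_mod_cast hin
      rw [sq]; gcongr
    refine le_trans (mul_le_mul_of_nonneg_right a1 (Real.exp_pos _).le)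
      (natCast_pow_mul_exp_le hn1 ?_)
    push_cast
    linarith
  have ht2 : (n : ℝ) ^ 2 * Real.exp (-(θ * δ / 2)) ≤ 1 / n := by
    refine natCast_pow_mul_exp_le hn1 ?_
    have : θ * δ / 2 = 4 * L := by rw [hθ]; field_simp; norm_num
    rw [this]
    push_cast
    linarith
  have h2n : 2 / (n : ℝ) ≤ κ := by
    rw [div_le_iff₀ hκ] at hC2
    rw [div_le_iff₀ hn0]
    nlinarith
  have hsub : prob (p n) (fun G : SimpleGraph (Fin n) => (1 + η) * s * (n / d ^ j) <
      (localizationNumber G : ℝ)) ≤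
      prob (p n) (fun G : SimpleGraph (Fin n) => k < localizationNumber G) := by
    refine prob_mono (p n) fun G hG => ?_
    have : (k : ℝ) < localizationNumber G := by
      refine lt_of_le_of_lt hklt ?_
      rw [hX, ← mul_assoc]
      exact hG
    exact_mod_cast this
  have h2n' : 1 / (n : ℝ) + 1 / n = 2 / n := by ring
  linarith

/-- If `log log n` is negligible compared to `log d`, then both bounds agree asymptotically. -/
lemma eventually_prob_not_near (h1 : (fun n : ℕ => Real.log n) =o[atTop] deg p)
    (h2 : deg p =o[atTop] (fun n : ℕ => (n : ℝ)))
    (h3 : (fun n : ℕ => deg p n ^ i n) =o[atTop] (fun n : ℕ => (n : ℝ)))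
    (h4 : Tendsto (fun n : ℕ => deg p n ^ (i n + 1) / n - 2 * Real.log n) atTop atTop)
    {g : ℕ → ℝ}
    (hg : ∀ c, 0 < c → ∀ᶠ n : ℕ in atTop, Real.log (Real.log n) ≤ c * g n ∧
      |Real.log (deg p n) - g n| ≤ c * g n) :
    ZetaAsymp p (fun n => g n * (n / deg p n ^ i n)) := by
  obtain ⟨ε, hε, hB⟩ := exists_error_tendsto_zero (fun η n =>
    prob (p n) fun G : SimpleGraph (Fin n) =>
      ¬ ((1 - η) * (g n * (n / deg p n ^ i n)) ≤ (localizationNumber G : ℝ) ∧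
      (localizationNumber G : ℝ) ≤ (1 + η) * (g n * (n / deg p n ^ i n)))) (by
    intro η hη0 hη1 κ hκ
    have hl := eventually_prob_lt_lower h1 h2 h3 h4 (show 0 < κ / 2 by linarith)
    have hu := eventually_prob_gt_upper h1 h2 h3 h4 (show 0 < η / 8 by linarith) (by linarith)
      (show 0 < κ / 2 by linarith)
    filter_upwards [hl, hu, hg (η / 8) (by linarith),
      eventually_parameters h1 h2 h3 h4 (le_refl 1000)] with n hln hun hgn hpar
    obtain ⟨e1, -, -, -, e5, e6, e7, -, -⟩ := hpar
    obtain ⟨g1, g2⟩ := hgn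
    rw [abs_le] at g2
    have hn0 : (0 : ℝ) < n := by linarith
    have hd0 : 0 < deg p n := by linarith
    have hnd : (0 : ℝ) ≤ n / deg p n ^ i n := by positivity
    have hg0 : 0 ≤ g n := by
      by_contra hneg
      push Not at hneg
      nlinarith
    refine (prob_mono (p n) fun G hG => ?_).trans
      ((prob_or_le (p n) _ _).trans ((add_le_add hln hun).trans (by linarith)))
    by_contra hcon
    rw [not_or, not_lt, not_lt] at hcon
    refine hG ⟨le_trans ?_ hcon.1, hcon.2.trans ?_⟩
    · rw [← mul_assoc]
      refine mul_le_mul_of_nonneg_right ?_ hnd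
      nlinarith
    · rw [← mul_assoc]
      refine mul_le_mul_of_nonneg_right ?_ hnd
      calc (1 + η / 8) * (Real.log (deg p n) + 2 * Real.log (Real.log n))
          ≤ (1 + η / 8) * ((1 + 3 * (η / 8)) * g n) := by
            refine mul_le_mul_of_nonneg_left ?_ (by linarith)
            linarith
        _ = ((1 + η / 8) * (1 + 3 * (η / 8))) * g n := by ring
        _ ≤ (1 + η) * g n := mul_le_mul_of_nonneg_right (by nlinarith) hg0)
  exact ⟨ε, hε, aas_of_prob_not_le p _ hB⟩

end Asymptotic

end LocalizationGame

open LocalizationGame in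
theorem theorem2p1 (p : ℕ → unitInterval) :
    (∀ i : ℕ → ℕ,
      (fun n : ℕ => Real.log n) =o[atTop] LocalizationGame.deg p →
      LocalizationGame.deg p =o[atTop] (fun n : ℕ => (n : ℝ)) →
      (fun n : ℕ => LocalizationGame.deg p n ^ i n) =o[atTop] (fun n : ℕ => (n : ℝ)) →
      Tendsto (fun n : ℕ => LocalizationGame.deg p n ^ (i n + 1) / n - 2 * Real.log n)
        atTop atTop →
      (∃ ε : ℕ → ℝ, Tendsto ε atTop (𝓝 0) ∧
        LocalizationGame.AAS p (fun n G =>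
          (Real.log (LocalizationGame.deg p n) - 3 * Real.log (Real.log n)) *
              (n / LocalizationGame.deg p n ^ i n) ≤
            (LocalizationGame.localizationNumber G : ℝ) ∧
          (LocalizationGame.localizationNumber G : ℝ) ≤
            (1 + ε n) *
              (Real.log (LocalizationGame.deg p n) + 2 * Real.log (Real.log n)) *
              (n / LocalizationGame.deg p n ^ i n))) ∧
      (∀ ω : ℕ → ℝ, Tendsto ω atTop atTop →
        (∀ᶠ n : ℕ in atTop, Real.log n ^ ω n ≤ LocalizationGame.deg p n) →
        LocalizationGame.ZetaAsymp p (fun n =>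
          n * Real.log (LocalizationGame.deg p n) / LocalizationGame.deg p n ^ i n))) ∧
    (∀ (i : ℕ) (x : ℝ), 1 ≤ i → 1 / ((i : ℝ) + 1) < x → x < 1 / (i : ℝ) →
      (∃ e : ℕ → ℝ, Tendsto e atTop (𝓝 0) ∧
        ∀ᶠ n : ℕ in atTop, LocalizationGame.deg p n = (n : ℝ) ^ (x + e n)) →
      LocalizationGame.ZetaAsymp p (fun n =>
        x * n * Real.log n / LocalizationGame.deg p n ^ i)) := by
  have hlog : Tendsto (fun n : ℕ => Real.log n) atTop atTop :=
    Real.tendsto_log_atTop.comp tendsto_natCast_atTop_atTop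
  have hlog2 : Tendsto (fun n : ℕ => Real.log (Real.log n)) atTop atTop :=
    Real.tendsto_log_atTop.comp hlog
  refine ⟨fun i h1 h2 h3 h4 => ⟨?_, fun ω hω hd => ?_⟩, fun i x hi hx1 hx2 hex => ?_⟩
  · obtain ⟨ε, hε, hB⟩ := exists_error_tendsto_zero (fun η n =>
      prob (p n) fun G : SimpleGraph (Fin n) =>
        (1 + η) * (Real.log (deg p n) + 2 * Real.log (Real.log n)) * (n / deg p n ^ i n) <
          (localizationNumber G : ℝ))
      (fun η hη0 hη1 κ hκ => eventually_prob_gt_upper h1 h2 h3 h4 hη0 hη1 hκ)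
    refine ⟨ε, hε, aas_of_prob_not_le p _ fun κ hκ => ?_⟩
    filter_upwards [hB (κ / 2) (by linarith),
      eventually_prob_lt_lower h1 h2 h3 h4 (show 0 < κ / 2 by linarith)] with n hu hl
    refine (prob_mono (p n) fun G hG => ?_).trans
      ((prob_or_le (p n) _ _).trans ((add_le_add hl hu).trans (by linarith)))
    rwa [not_and_or, not_le, not_le] at hG
  · have h := eventually_prob_not_near h1 h2 h3 h4 (g := fun n => Real.log (deg p n)) (by
      intro c hc
      filter_upwards [hd, tendsto_atTop.1 hω (1 / c), tendsto_atTop.1 hlog2 0,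
        tendsto_atTop.1 hlog 1] with n hdn hωn hl2 hl
      have hL : 0 < Real.log n := by linarith
      have a1 : ω n * Real.log (Real.log n) ≤ Real.log (deg p n) := by
        rw [← Real.log_rpow hL]
        exact Real.log_le_log (Real.rpow_pos_of_pos hL _) hdn
      have a2 : Real.log (Real.log n) ≤ c * Real.log (deg p n) := by
        rw [div_le_iff₀ hc] at hωn
        calc Real.log (Real.log n) ≤ (ω n * c) * Real.log (Real.log n) := by nlinarith
          _ = c * (ω n * Real.log (Real.log n)) := by ring
          _ ≤ _ := mul_le_mul_of_nonneg_left a1 hc.le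
      exact ⟨a2, by simpa using hl2.trans a2⟩)
    convert h using 2 with n
    ring
  · obtain ⟨e, he, hde⟩ := hex
    have hi0 : (0 : ℝ) < i := by exact_mod_cast hi
    have hx0 : 0 < x := lt_trans (by positivity) hx1
    have hxi : x * i < 1 := by rwa [lt_div_iff₀ hi0] at hx2
    have hxi1 : 1 < x * (i + 1) := by rwa [div_lt_iff₀ (by positivity)] at hx1
    have hcast := tendsto_natCast_atTop_atTop (R := ℝ)
    -- `d ^ m = n ^ (x m + o(1))` for every fixed `m`
    have hlim : ∀ m : ℝ, Tendsto (fun n => (x + e n) * m) atTop (𝓝 (x * m)) := fun m => by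
      simpa using (he.const_add x).mul_const m
    have hpow : ∀ᶠ n : ℕ in atTop, ∀ m : ℕ, deg p n ^ m = (n : ℝ) ^ ((x + e n) * m) := by
      filter_upwards [hde] with n hn m
      rw [hn, Real.rpow_mul (Nat.cast_nonneg n), Real.rpow_natCast]
    have hlogo : ∀ y : ℝ, 0 < y →
        (fun n : ℕ => Real.log n) =o[atTop] (fun n : ℕ => (n : ℝ) ^ y) := fun y hy =>
      (isLittleO_log_rpow_atTop hy).comp_tendsto hcast
    have h1 : (fun n : ℕ => Real.log n) =o[atTop] deg p := by
      refine (hlogo (x / 2) (by linarith)).trans_isBigO (IsBigO.of_bound 1 ?_)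
      filter_upwards [hpow, (hlim 1).eventually_const_lt (show x / 2 < x * 1 by linarith),
        eventually_ge_atTop 1] with n hn hlt hn1
      have hn1' : (1 : ℝ) ≤ n := by exact_mod_cast hn1
      have := hn 1
      rw [pow_one, Nat.cast_one] at this
      rw [this, Real.norm_of_nonneg (by positivity), Real.norm_of_nonneg (by positivity), one_mul]
      exact Real.rpow_le_rpow_of_exponent_le hn1' hlt.le
    have h3 : (fun n : ℕ => deg p n ^ i) =o[atTop] (fun n : ℕ => (n : ℝ)) := by
      have a1 : (fun n : ℕ => (n : ℝ) ^ ((x * i + 1) / 2)) =o[atTop] (fun n : ℕ => (n : ℝ)) := by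
        refine isLittleO_of_tendsto' ?_ ?_
        · filter_upwards [eventually_ge_atTop 1] with n hn h0
          have : (1 : ℝ) ≤ n := by exact_mod_cast hn
          linarith
        · refine ((tendsto_rpow_neg_atTop (show 0 < 1 - (x * i + 1) / 2 by linarith)).comp
            hcast).congr' ?_
          filter_upwards [eventually_ge_atTop 1] with n hn
          have hn0 : (0 : ℝ) < n := by exact_mod_cast hn
          rw [Function.comp_apply, neg_sub, Real.rpow_sub hn0, Real.rpow_one]
      refine IsBigO.trans_isLittleO (IsBigO.of_bound 1 ?_) a1
      filter_upwards [hpow, (hlim i).eventually_lt_const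
        (show x * i < (x * i + 1) / 2 by linarith), eventually_ge_atTop 1] with n hn hlt hn1
      have hn1' : (1 : ℝ) ≤ n := by exact_mod_cast hn1
      rw [hn i, Real.norm_of_nonneg (by positivity), Real.norm_of_nonneg (by positivity), one_mul]
      exact Real.rpow_le_rpow_of_exponent_le hn1' hlt.le
    have hd1 : ∀ᶠ n : ℕ in atTop, 1 ≤ deg p n := by
      filter_upwards [hpow, (hlim 1).eventually_const_lt (show 0 < x * 1 by linarith),
        eventually_ge_atTop 1] with n hn hlt hn1
      have := hn 1
      rw [pow_one, Nat.cast_one] at this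
      rw [this]
      exact Real.one_le_rpow (by exact_mod_cast hn1) hlt.le
    have h2 : deg p =o[atTop] (fun n : ℕ => (n : ℝ)) := by
      refine IsBigO.trans_isLittleO (IsBigO.of_bound 1 ?_) h3
      filter_upwards [hd1] with n hn
      rw [one_mul, Real.norm_of_nonneg (by positivity), Real.norm_of_nonneg (by positivity)]
      exact le_self_pow₀ hn (by omega)
    have h4 : Tendsto (fun n : ℕ => deg p n ^ (i + 1) / n - 2 * Real.log n) atTop atTop := by
      set y := (x * (i + 1) - 1) / 2 with hy
      have hy0 : 0 < y := by rw [hy]; linarith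
      have a1 : Tendsto (fun n : ℕ => (1 / 2 : ℝ) * (n : ℝ) ^ y) atTop atTop :=
        ((tendsto_rpow_atTop hy0).comp hcast).const_mul_atTop (by norm_num)
      refine tendsto_atTop_mono' _ ?_ a1
      filter_upwards [hpow, (hlim (i + 1)).eventually_const_lt
        (show y + 1 < x * (i + 1) by rw [hy]; linarith), eventually_ge_atTop 1,
        (isLittleO_iff.1 (hlogo y hy0)) (show (0 : ℝ) < 1 / 4 by norm_num)] with n hn hlt hn1 ho
      have hn1' : (1 : ℝ) ≤ n := by exact_mod_cast hn1
      rw [Real.norm_of_nonneg (Real.log_natCast_nonneg n), Real.norm_of_nonneg (by positivity)] at ho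
      have a2 : (n : ℝ) ^ y ≤ deg p n ^ (i + 1) / n := by
        rw [le_div_iff₀ (by linarith), hn (i + 1)]
        calc (n : ℝ) ^ y * n = (n : ℝ) ^ (y + 1) := by
              rw [Real.rpow_add_one (by linarith)]
          _ ≤ _ := Real.rpow_le_rpow_of_exponent_le hn1' (by push_cast; exact hlt.le)
      linarith
    have h := eventually_prob_not_near (i := fun _ => i) h1 h2 h3 h4
      (g := fun n => x * Real.log n) (by
      intro c hc
      have ho : (fun n : ℕ => Real.log (Real.log n)) =o[atTop] (fun n : ℕ => Real.log n) :=
        Real.isLittleO_log_id_atTop.comp_tendsto hlog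
      have hcx : 0 < c * x := by positivity
      filter_upwards [hde, (isLittleO_iff.1 ho) hcx, tendsto_atTop.1 hlog2 0,
        eventually_ge_atTop 1, Metric.tendsto_nhds.1 he (c * x) hcx] with n hn hon hl2 hn1 hen
      have hL0 : 0 ≤ Real.log n := Real.log_natCast_nonneg n
      have hn1' : (0 : ℝ) < n := by exact_mod_cast hn1
      rw [Real.norm_of_nonneg hl2, Real.norm_of_nonneg hL0] at hon
      rw [dist_zero_right, Real.norm_eq_abs] at hen
      refine ⟨by linarith, ?_⟩
      rw [hn, Real.log_rpow hn1', ← sub_mul, add_sub_cancel_left, abs_mul, abs_of_nonneg hL0]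
      calc |e n| * Real.log n ≤ c * x * Real.log n := by gcongr
        _ = _ := by ring)
    convert h using 2 with n
    ring
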